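/- A graph has a finite non-empty vertex set $V$ and a finite edge set $E$; loops and multiple edges are allowed. A polarized weighted graph $(G,\mathbf q)$ is a graph with edge lengths $m\colon E\to\mathbb R_{>0}$ and a function $\mathbf q\colon V\to\mathbb Z_{\ge 0}$ such that $K(p):=v(p)-2+2\mathbf q(p)\ge 0$ for every $p\in V$, where $v(p)$ is the valency (loops count twice). A polarized metric graph $\overline\Gamma=(\Gamma,\mathbf q)$ is the metric graph $\Gamma$ obtained by gluing segments of lengths $m(e)$ according to such a weighted graph, with its designated vertex set $V$ and with $\mathbf q$; put $\mathbf q=0$ and $K=0$ on $\Gamma\setminus V$, and call $K$ the canonical divisor. For connected $\overline\Gamma$, the genus is $g=\#E-\#V+1+\sum_{p\in V}\mathbf q(p)$. If $g\ge 2$, the minimal model of $\overline\Gamma$ is the polarized weighted graph $\overline G=(G,\mathbf q)$ giving rise to the same metric graph $\Gamma$, with vertex set the support of $K$ and with $\mathbf q$ restricted to it. Let $\Delta f=-f''\,dx-\sum_p(\text{sum of the outgoing slopes of } f \text{ at } p)\,\delta_p$ be the Laplacian on $\Gamma$ (in the sense of distributions). For a probability measure $\mu$ on $\Gamma$, the Green's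 function $g_\mu$ is the continuous function with $\Delta_x g_\mu(x,y)=\delta_y-\mu$ and $\int_\Gamma g_\mu(x,y)\,\mu(x)=0$. The admissible measure of $\overline\Gamma$ is the unique probability measure $\mu$ for which $g_\mu(x,x)+\sum_{p\in V} K(p)\,g_\mu(p,x)$ is constant in $x$. With $\delta$ the total length of $\Gamma$, put $$\varphi=-\tfrac14\delta+\tfrac14\int_\Gamma g_\mu(x,x)\big((10g+2)\mu(x)-\delta_K(x)\big),\qquad \epsilon=\int_\Gamma g_\mu(x,x)\big((2g-2)\mu(x)+\delta_K(x)\big),$$ $$\lambda=\frac{g-1}{6(2g+1)}\varphi+\frac1{12}(\delta+\epsilon),\qquad s(\overline\Gamma)=(8g+4)\lambda-g\,\delta_0-\sum_{h=1}^{\lfloor g/2\rfloor}4h(g-h)\,\delta_h,$$ where $\delta_K=\sum_p K(p)\delta_p$, $\delta_0$ is the total length of the edges that are not bridges, and $\delta_h$ is the total length of the bridges whose removal leaves components of genera $h$ and $g-h$. The number $s(\overline\Gamma)$ is the slope of $\overline\Gamma$. A separation of a connected graph is a decomposition into two connected subgraphs with exactly one common vertex and disjoint non-empty edge sets; a block of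 $G$ is a maximal subgraph among the connected subgraphs that have no separation. **Theorem.** Let $\overline\Gamma=(\Gamma,\mathbf q)$ be a connected polarized metric graph of genus $g\ge 2$ with minimal model $\overline G=(G,\mathbf q)$. Then $s(\overline\Gamma)=0$ if and only if one of the following two conditions holds: (a) $\mathbf q\equiv 0$ and $G$ is the graph on two vertices joined by $g+1$ parallel edges; (b) every block of $G$ that has an edge is a single loop or a single bridge (this includes the case that $G$ is a single point without edges), and $G$ has at most $g$ loops. -/

import Mathlib

open MeasureTheory Graph
open scoped Interval ContDiff

noncomputable section

namespace MetricGraph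

/-! ### Combinatorics of multigraphs -/

section Combinatorics

variable {V E : Type*}

/-- The vertices `x` and `y` are joined by a path in `H`. -/
def Reachable (H : Graph V E) : V → V → Prop :=
  Relation.ReflTransGen fun x y => ∃ e, H.IsLink e x y

/-- Connected graphs (non-empty by convention). -/
def Connected (H : Graph V E) : Prop :=
  V(H).Nonempty ∧ ∀ x ∈ V(H), ∀ y ∈ V(H), Reachable H x y

/-- A bridge: an edge whose removal splits a connected component. -/
def IsBridge (H : Graph V E) (e : E) : Prop :=
  ∃ x y, H.IsLink e x y ∧ ¬ Reachable (H.deleteEdges {e}) x y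

/-- The connected component of the vertex `x`. -/
def component (H : Graph V E) (x : V) : Graph V E :=
  H.induce {y | y ∈ V(H) ∧ Reachable H x y}

/-- The genus `b₁(H) + ∑_{p ∈ V(H)} q(p)` of a connected finite graph `H` with vertex genera `q`;
the first Betti number of such a graph is `#E(H) - #V(H) + 1`. -/
def genusOf (q : V → ℕ) (H : Graph V E) : ℤ :=
  ((E(H).ncard : ℤ) - (V(H).ncard : ℤ) + 1) + ∑ᶠ p ∈ V(H), (q p : ℤ)

/-- A separation of `H`: a decomposition into two connected subgraphs with exactly one common
vertex and with disjoint non-empty edge sets. -/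
structure IsSeparation (H A B : Graph V E) : Prop where
  left_le : A ≤ H
  right_le : B ≤ H
  left_connected : Connected A
  right_connected : Connected B
  vertex_union : V(A) ∪ V(B) = V(H)
  edge_union : E(A) ∪ E(B) = E(H)
  vertex_inter : ∃ v, V(A) ∩ V(B) = {v}
  edge_disjoint : Disjoint E(A) E(B)
  left_nonempty : E(A).Nonempty
  right_nonempty : E(B).Nonempty

/-- Connected graphs without a separating vertex. -/
def Inseparable (H : Graph V E) : Prop :=
  Connected H ∧ ¬ ∃ A B, IsSeparation H A B

/-- Blocks: maximal inseparable subgraphs. -/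
def IsBlock (G H : Graph V E) : Prop :=
  Maximal (fun H' : Graph V E => H' ≤ G ∧ Inseparable H') H

/-- Every block of `G` (having an edge at all) is a single loop or a single bridge of `G`.
If `G` is a point without edges, then its only block is that point. -/
def BlocksAreLoopsAndBridges (G : Graph V E) : Prop :=
  ∀ H, IsBlock G H → E(H).Nonempty →
    ∃ e, E(H) = {e} ∧ ((∃ x, G.IsLoopAt e x) ∨ IsBridge G e)

end Combinatorics

/-! ### Weighted graphs and the metric graphs glued from them -/

/-- A weighted graph with vertex set `V` and edge set `E`; loops and multiple edges are allowed.
The (arbitrary) orientation of each edge serves to parametrize it by `[0, m e]`. -/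
structure WeightedGraph (V E : Type*) where
  src : E → V
  tgt : E → V
  m : E → ℝ
  m_pos : ∀ e, 0 < m e

namespace WeightedGraph

variable {V E : Type*} (G : WeightedGraph V E)

/-- The underlying unoriented multigraph. -/
def toGraph : Graph V E where
  vertexSet := Set.univ
  IsLink e x y := (x = G.src e ∧ y = G.tgt e) ∨ (x = G.tgt e ∧ y = G.src e)
  edgeSet := Set.univ
  isLink_symm := fun e _ => ⟨fun x y h => by tauto⟩
  eq_or_eq_of_isLink_of_isLink := by
    rintro e x y v w (⟨rfl, rfl⟩ | ⟨rfl, rfl⟩) (⟨rfl, rfl⟩ | ⟨rfl, rfl⟩) <;> simp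
  edge_mem_iff_exists_isLink := fun e =>
    ⟨fun _ => ⟨_, _, Or.inl ⟨rfl, rfl⟩⟩, fun _ => Set.mem_univ e⟩
  left_mem_of_isLink := fun _ x _ _ => Set.mem_univ x

/-- The valency: the number of half-edges emanating at `p` (a loop counts twice). -/
def valency (p : V) : ℕ := {e | G.src e = p}.ncard + {e | G.tgt e = p}.ncard

/-- The points of the metric graph obtained by gluing a segment of length `m e` for each edge `e`
to the vertices: the vertices, and the points in the interiors of the edges. -/
inductive Point (G : WeightedGraph V E) : Type _
  | vertex (p : V) : Point G
  | inner (e : E) (t : Set.Ioo (0 : ℝ) (G.m e)) : Point G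

open Classical in
/-- The parametrization `[0, m e] → Γ` of the edge `e` by arc length, extended to `ℝ` by
constants. -/
def edgePoint (e : E) (t : ℝ) : G.Point :=
  if h : t ∈ Set.Ioo 0 (G.m e) then .inner e ⟨t, h⟩
  else if t ≤ 0 then .vertex (G.src e) else .vertex (G.tgt e)

/-- The quotient topology of the gluing. -/
instance : TopologicalSpace G.Point :=
  ⨆ e : E, TopologicalSpace.coinduced (G.edgePoint e) inferInstance

instance : MeasurableSpace G.Point := borel _

instance : BorelSpace G.Point := ⟨rfl⟩

variable [Fintype E]

/-- Test functions: functions on the metric graph given by a family `ψ` of functions that are smooth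
on the closed edges and agree at the vertices. -/
def IsTestFunction (φ : G.Point → ℝ) (ψ : E → ℝ → ℝ) : Prop :=
  ∀ e, ContDiff ℝ ∞ (ψ e) ∧ ∀ t ∈ Set.Icc 0 (G.m e), φ (G.edgePoint e t) = ψ e t

/-- The integral of `f` against the Laplacian `Δφ` of the test function `φ` given by `ψ`, where
`Δφ = -φ'' dx - ∑_p (sum of the outgoing slopes of φ at p) δ_p`. -/
def laplacianPairing (f : G.Point → ℝ) (ψ : E → ℝ → ℝ) : ℝ :=
  ∑ e, (-(∫ t in (0 : ℝ)..G.m e, f (G.edgePoint e t) * deriv (deriv (ψ e)) t)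
    - f (.vertex (G.src e)) * deriv (ψ e) 0 + f (.vertex (G.tgt e)) * deriv (ψ e) (G.m e))

/-- The equation `Δf = ν₁ - ν₂` in the sense of distributions. -/
def HasLaplacian (f : G.Point → ℝ) (ν₁ ν₂ : Measure G.Point) : Prop :=
  ∀ φ ψ, G.IsTestFunction φ ψ → G.laplacianPairing f ψ = ∫ x, φ x ∂ν₁ - ∫ x, φ x ∂ν₂

/-- `g` is the Green's function `g_μ` of the measure `μ` of total mass one:
`Δ_x g(x, y) = δ_y - μ` and `∫ g(x, y) dμ(x) = 0`. -/
structure IsGreenFunction (μ : Measure G.Point) (g : G.Point → G.Point → ℝ) : Prop where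
  continuous : ∀ y, Continuous fun x => g x y
  laplacian : ∀ y, G.HasLaplacian (fun x => g x y) (Measure.dirac y) μ
  integral_eq_zero : ∀ y, ∫ x, g x y ∂μ = 0

end WeightedGraph

/-! ### Polarizations -/

/-- A polarized weighted graph. It is also the datum of a polarized metric graph, namely the
metric graph `Point` glued from it, with its designated vertex set and the vertex genera `q`. -/
structure PolarizedGraph (V E : Type*) extends WeightedGraph V E where
  q : V → ℕ
  polarization : ∀ p, 0 ≤ (toWeightedGraph.valency p : ℤ) - 2 + 2 * (q p : ℤ)

namespace PolarizedGraph

variable {V E : Type*} (G : PolarizedGraph V E)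

/-- The coefficient at `p` of the canonical divisor. -/
def K (p : V) : ℤ := (G.valency p : ℤ) - 2 + 2 * (G.q p : ℤ)

/-- The genus of a connected polarized graph. -/
def genus : ℤ := genusOf G.q G.toGraph

/-- The vertex genera as a function on the metric graph, zero outside the designated vertices. -/
def pointGenus : G.Point → ℕ
  | .vertex p => G.q p
  | .inner _ _ => 0

/-- The canonical divisor as a function on the metric graph. -/
def pointK : G.Point → ℤ
  | .vertex p => G.K p
  | .inner _ _ => 0

/-- `G` is the minimal model of the polarized metric graph `Γ`: there is an isomorphism `Φ` of
metric graphs from the metric graph of `G` to `Γ` (it is bijective, and every designated edge of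
`Γ` is, up to orientation, an isometrically parametrized segment of an edge of `G`), which
respects the polarizations, and for which the vertices of `G` are the points of the support of
the canonical divisor of `Γ`. -/
def IsMinimalModel {V₀ E₀ : Type*} (G : PolarizedGraph V E) (Γ : PolarizedGraph V₀ E₀) : Prop :=
  ∃ Φ : G.Point ≃ Γ.Point,
    (∀ e₀ : E₀, ∃ e : E, ∃ a : ℝ, 0 ≤ a ∧ a + Γ.m e₀ ≤ G.m e ∧
      ((∀ t ∈ Set.Icc 0 (Γ.m e₀), Φ (G.edgePoint e (a + t)) = Γ.edgePoint e₀ t) ∨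
       (∀ t ∈ Set.Icc 0 (Γ.m e₀), Φ (G.edgePoint e (a + t)) = Γ.edgePoint e₀ (Γ.m e₀ - t)))) ∧
    (∀ x, Γ.pointGenus (Φ x) = G.pointGenus x) ∧
    (∀ x, (∃ p, x = .vertex p) ↔ Γ.pointK (Φ x) ≠ 0)

variable [Fintype V] [Fintype E]

/-- The defining property of the admissible measure: a measure `μ` of total mass one such that
`g_μ(x, x) + g_μ(K, x)` is constant. -/
def IsAdmissibleMeasure (μ : Measure G.Point) : Prop :=
  IsProbabilityMeasure μ ∧ ∃ g, G.IsGreenFunction μ g ∧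
    ∃ c : ℝ, ∀ x, g x x + ∑ p, (G.K p : ℝ) * g (.vertex p) x = c

/-- The admissible measure `μ`. -/
def admissibleMeasure : Measure G.Point := Classical.epsilon G.IsAdmissibleMeasure

/-- The admissible Green's function `g_μ`. -/
def admissibleGreen : G.Point → G.Point → ℝ :=
  Classical.epsilon (G.IsGreenFunction G.admissibleMeasure)

/-- The total length. -/
def δ : ℝ := ∑ e, G.m e

/-- The total length of the edges that are not bridges. -/
def δ₀ : ℝ := ∑ e, {e | ¬ IsBridge G.toGraph e}.indicator G.m e

/-- A bridge is of type `h` if the two components left after its removal have genera `h` and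
`g - h`. -/
def IsOfType (h : ℤ) (e : E) : Prop :=
  IsBridge G.toGraph e ∧ ∃ x y, G.toGraph.IsLink e x y ∧
    genusOf G.q (component (G.toGraph.deleteEdges {e}) x) = h ∧
    genusOf G.q (component (G.toGraph.deleteEdges {e}) y) = G.genus - h

/-- The total length of the edges of type `h`. -/
def δType (h : ℤ) : ℝ := ∑ e, {e | G.IsOfType h e}.indicator G.m e

/-- Zhang's `φ`-invariant. -/
def φ : ℝ :=
  -(1 / 4) * G.δ + (1 / 4) * ((10 * (G.genus : ℝ) + 2) *
      (∫ x, G.admissibleGreen x x ∂G.admissibleMeasure)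
    - ∑ p, (G.K p : ℝ) * G.admissibleGreen (.vertex p) (.vertex p))

/-- Zhang's `ε`-invariant. -/
def ε : ℝ :=
  (2 * (G.genus : ℝ) - 2) * (∫ x, G.admissibleGreen x x ∂G.admissibleMeasure)
    + ∑ p, (G.K p : ℝ) * G.admissibleGreen (.vertex p) (.vertex p)

/-- Zhang's `λ`-invariant. -/
def lambda : ℝ :=
  ((G.genus : ℝ) - 1) / (6 * (2 * (G.genus : ℝ) + 1)) * G.φ + (1 / 12) * (G.δ + G.ε)

/-- The slope. -/
def slope : ℝ :=
  (8 * (G.genus : ℝ) + 4) * G.lambda - (G.genus : ℝ) * G.δ₀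
    - ∑ h ∈ Finset.Icc 1 (G.genus / 2), 4 * (h : ℝ) * ((G.genus : ℝ) - (h : ℝ)) * G.δType h

end PolarizedGraph

end MetricGraph

end

/-!
The proof expresses the slope as a sum of non-negative contributions of the points in the support
of the canonical divisor, and finds the graphs for which all contributions vanish.

Fix a ground vertex `o` and let `g_o(x, y)` be the potential at `x` of a unit current from `y` to
`o`. Interpolating affinely along the edges and adding the Dirichlet Green's function of each edge
extends `g_o` to a function `j` on the metric graph with `Δ_x j(x, y) = δ_y - δ_o` (`pointGreen`,
`IsVertexGreen.laplacianPairing`). Every probability measure `μ` then has exactly one Green's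
function, obtained from `j` by subtracting the potentials of `μ` (`greenOf`, `eq_greenOf`). Zhang's
explicit measure, with masses `q(p)` at the vertices and density `F_e / m(e)` on the edges, divided
by the genus, is admissible; here `F_e = 1 - R_e / m(e)` is the Foster coefficient of the edge `e`
with effective resistance `R_e`. The potential of any admissible measure is
`(j(x, x) + ∑ K(p) j(p, x)) / 2g` (`potential_of_isAdmissible`). Hence all integrals in `φ`, `ε` and
`λ` are finite sums in `g_o` (`lambda_eq`). Averaging over `o` with the weights `K(o)` leaves
`(8g + 4) λ = g δ + ∑_o K(o) (∑_e t_e(o) + ∑_p q(p) g_o(p, p))` (`lambda_eq_sum`), where, for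
`e = (a, b)`, `t_e(o) = g_o(a, b) + (g_o(a, b)² - g_o(a, a) g_o(b, b)) / m(e)`.

A bridge `f` contributes to `g_o` the multiple `m(f)` of the product of the indicator functions of
its far side, as seen from `o`. Splitting off these contributions produces the terms `g δ_0` and
`4h(g - h) δ_h` of the slope exactly (`sum_minorTerm`, `sum_isOfType`). What remains is the sum of
the terms `K(o) (∑_e t_e(o) + ∑_p q(p) k_o(p, p))`, where `k_o` is the Green's function of the graph
with its bridges contracted and `e` runs through the other edges (`slope_eq`). Up to the positive
factor `F_e`, the term `t_e(o)` is the Green's function, between the end points of `e`, of the graph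
without `e`. By the minimum principle it is non-negative (`deleted_nonneg`). So the slope vanishes
if and only if every `o` with `K(o) ≠ 0` is tight (`TightAt`): vertices of positive genus are joined
to `o` by bridges, and there is no cycle that avoids the vertices joined to `o` by bridges.

The graph `Γ` is a subdivision of its minimal model `G`. Flows, bridges and tightness are compatible
with subdivisions, since increments along the segments of an edge telescope (`Subdivision.sum_sub`,
`Subdivision.tightAt_ι`). So the slope vanishes if and only if all vertices of `G` are tight. This
holds if all edges are loops or bridges, as all vertices are then joined by bridges. Otherwise some
edge `ab` is neither a loop nor a bridge (`banana_of_tightAt`). Then `a` and `b` are not joined by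
bridges, so `q = 0` and all valencies are at least two; therefore both sides of a bridge would carry
cycles, and there are no bridges. A loop would avoid some vertex, so there are none. Finally no
cycle avoids a vertex `o`, so at most `#V - 2` edges do. Counting pairs of a vertex and an edge
avoiding it gives `(#V - 2) #E ≤ #V (#V - 2)`, while `#E ≥ #V + 1` since `g ≥ 2`. Therefore `#V = 2`.
-/

open MeasureTheory Graph
open scoped Interval ContDiff

noncomputable section

namespace MetricGraph

/-! ### Dirichlet energy and the Green's function of the vertex set -/

namespace WeightedGraph

variable {V E : Type*} (G : WeightedGraph V E)

/-- The increment of a function on the vertices along an (oriented) edge. -/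
def diff (f : V → ℝ) (e : E) : ℝ := f (G.tgt e) - f (G.src e)

lemma diff_add (f h : V → ℝ) (e : E) : G.diff (fun x => f x + h x) e = G.diff f e + G.diff h e := by
  simp only [diff]; ring

lemma diff_sub (f h : V → ℝ) (e : E) : G.diff (fun x => f x - h x) e = G.diff f e - G.diff h e := by
  simp only [diff]; ring

lemma diff_smul (c : ℝ) (f : V → ℝ) (e : E) : G.diff (fun x => c * f x) e = c * G.diff f e := by
  simp only [diff]; ring

lemma diff_sum {ι : Type*} (s : Finset ι) (F : ι → V → ℝ) (e : E) :
    G.diff (fun x => ∑ i ∈ s, F i x) e = ∑ i ∈ s, G.diff (F i) e := by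
  simp only [diff, Finset.sum_sub_distrib]

/-- Connectedness in terms of potentials: a function without increments is constant. -/
def PotentialConnected : Prop :=
  ∀ f : V → ℝ, (∀ e, G.diff f e = 0) → ∀ x y, f x = f y

/-- The Dirichlet form, restricted to the edges in `s`. -/
def energyOn (s : Finset E) (f φ : V → ℝ) : ℝ := ∑ e ∈ s, G.diff f e * G.diff φ e / G.m e

lemma energyOn_comm (s : Finset E) (f φ : V → ℝ) : G.energyOn s f φ = G.energyOn s φ f := by
  simp only [energyOn, mul_comm]

lemma energyOn_add_left (s : Finset E) (f h φ : V → ℝ) :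
    G.energyOn s (fun x => f x + h x) φ = G.energyOn s f φ + G.energyOn s h φ := by
  simp only [energyOn, diff_add, add_mul, add_div, Finset.sum_add_distrib]

lemma energyOn_sub_left (s : Finset E) (f h φ : V → ℝ) :
    G.energyOn s (fun x => f x - h x) φ = G.energyOn s f φ - G.energyOn s h φ := by
  simp only [energyOn, diff_sub, sub_mul, sub_div, Finset.sum_sub_distrib]

lemma energyOn_smul_left (s : Finset E) (c : ℝ) (f φ : V → ℝ) :
    G.energyOn s (fun x => c * f x) φ = c * G.energyOn s f φ := by
  simp only [energyOn, diff_smul, Finset.mul_sum]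
  exact Finset.sum_congr rfl fun e _ => by ring

lemma energyOn_self_nonneg (s : Finset E) (f : V → ℝ) : 0 ≤ G.energyOn s f f :=
  Finset.sum_nonneg fun e _ => div_nonneg (mul_self_nonneg _) (G.m_pos e).le

lemma diff_eq_zero_of_energyOn_self {s : Finset E} {f : V → ℝ} (h : G.energyOn s f f = 0) :
    ∀ e ∈ s, G.diff f e = 0 := by
  intro e he
  have := (Finset.sum_eq_zero_iff_of_nonneg
    fun e _ => div_nonneg (mul_self_nonneg (G.diff f e)) (G.m_pos e).le).1 h e he
  simpa [(G.m_pos e).ne'] using this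

variable [Fintype E]

/-- `g` is the Green's function of the vertex set grounded at `o`: the potential `g · y` of a unit
current from `y` to `o`, normalized to vanish at `o`. -/
structure IsVertexGreen (o : V) (g : V → V → ℝ) : Prop where
  energy : ∀ y (φ : V → ℝ), G.energyOn Finset.univ (fun x => g x y) φ = φ y - φ o
  ground : ∀ y, g o y = 0

namespace IsVertexGreen

variable {G} {o : V} {g : V → V → ℝ} (hg : G.IsVertexGreen o g)
include hg

lemma symm (x y : V) : g x y = g y x := by
  have h1 := hg.energy x (fun z => g z y)
  have h2 := hg.energy y (fun z => g z x)
  rw [energyOn_comm] at h1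
  simp only [hg.ground, sub_zero] at h1 h2
  rw [← h1, ← h2]

lemma ground' (x : V) : g x o = 0 := by rw [hg.symm, hg.ground]

end IsVertexGreen

variable [Fintype V]

open Classical in
/-- Existence: the Dirichlet form plus the square of the value at `o` is positive definite. -/
lemma exists_isVertexGreen (hc : G.PotentialConnected) (o : V) : ∃ g, G.IsVertexGreen o g := by
  let A : (V → ℝ) →ₗ[ℝ] (V → ℝ) :=
    { toFun := fun f x => G.energyOn Finset.univ f (Pi.single x 1) + f o * (if x = o then 1 else 0)
      map_add' := fun f h => by
        ext x
        have := G.energyOn_add_left Finset.univ f h (Pi.single x 1)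
        simp only [Pi.add_apply]
        change G.energyOn Finset.univ (fun x => f x + h x) _ + _ = _
        rw [this]; ring
      map_smul' := fun c f => by
        ext x
        have := G.energyOn_smul_left Finset.univ c f (Pi.single x 1)
        simp only [Pi.smul_apply, smul_eq_mul, RingHom.id_apply]
        change G.energyOn Finset.univ (fun x => c * f x) _ + _ = _
        rw [this]; ring }
  have hA : ∀ f φ : V → ℝ, ∑ x, A f x * φ x = G.energyOn Finset.univ f φ + f o * φ o := by
    intro f φ
    have h1 : ∀ e, ∑ x, G.diff (Pi.single x 1) e * φ x = G.diff φ e := by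
      intro e
      simp only [diff, sub_mul, Finset.sum_sub_distrib, Pi.single_apply, ite_mul, one_mul, zero_mul,
        Finset.sum_ite_eq, Finset.mem_univ, if_true]
    simp only [A, LinearMap.coe_mk, AddHom.coe_mk, add_mul, Finset.sum_add_distrib]
    congr 1
    · simp only [energyOn, Finset.sum_mul]
      rw [Finset.sum_comm]
      refine Finset.sum_congr rfl fun e _ => ?_
      rw [← h1 e, Finset.mul_sum, Finset.sum_div]
      exact Finset.sum_congr rfl fun x _ => by ring
    · simp
  have hinj : Function.Injective A := by
    rw [← LinearMap.ker_eq_bot, LinearMap.ker_eq_bot']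
    intro f hf
    have h0 := hA f f
    simp only [hf, Pi.zero_apply, zero_mul, Finset.sum_const_zero] at h0
    have h1 := G.energyOn_self_nonneg Finset.univ f
    have h2 := mul_self_nonneg (f o)
    have h3 : G.energyOn Finset.univ f f = 0 := by linarith
    have h4 : f o = 0 := by
      have : f o * f o = 0 := by linarith
      simpa using this
    ext x
    rw [hc f (fun e => G.diff_eq_zero_of_energyOn_self h3 e (Finset.mem_univ e)) x o, h4]; rfl
  have hsurj := (LinearMap.injective_iff_surjective (f := A)).1 hinj
  choose f hf using fun y => hsurj (fun x => (if x = y then 1 else 0) - (if x = o then 1 else 0))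
  have key : ∀ y φ, G.energyOn Finset.univ (f y) φ + f y o * φ o = φ y - φ o := by
    intro y φ
    rw [← hA, hf]
    simp [sub_mul, Finset.sum_sub_distrib]
  have hzero : ∀ y, f y o = 0 := by
    intro y
    have := key y (fun _ => 1)
    simpa [energyOn, diff] using this
  refine ⟨fun x y => f y x, ⟨fun y φ => ?_, hzero⟩⟩
  have := key y φ
  rw [hzero] at this
  simpa using this

/-- The effective resistance between the end points of an edge. -/
def edgeRes (g : V → V → ℝ) (e : E) : ℝ :=
  g (G.src e) (G.src e) + g (G.tgt e) (G.tgt e) - 2 * g (G.src e) (G.tgt e)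

/-- Foster's coefficient of an edge. -/
def foster (g : V → V → ℝ) (e : E) : ℝ := 1 - G.edgeRes g e / G.m e

/-- The `2 × 2` minor expression of an edge with respect to a grounded Green's function. It is
the Green's function of the graph without `e`, between the end points of `e`, scaled by the Foster
coefficient. -/
def minorTerm (g : V → V → ℝ) (e : E) : ℝ :=
  g (G.src e) (G.tgt e) +
    (g (G.src e) (G.tgt e) ^ 2 - g (G.src e) (G.src e) * g (G.tgt e) (G.tgt e)) / G.m e

namespace IsVertexGreen

variable {G} {o : V} {g : V → V → ℝ} (hg : G.IsVertexGreen o g)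
include hg

/-- The strong form of the equation for `g · p`, weighted and summed over `p`. -/
lemma sum_slopes (w : V → ℝ) :
    ∑ e, (w (G.src e) * (g (G.src e) (G.src e) - g (G.src e) (G.tgt e)) / G.m e
      + w (G.tgt e) * (g (G.tgt e) (G.tgt e) - g (G.src e) (G.tgt e)) / G.m e)
      = ∑ p, w p - w o := by
  classical
  have h : ∀ p, G.energyOn Finset.univ (fun x => g x p) (Pi.single p 1) * w p
      = w p - (if p = o then w p else 0) := by
    intro p
    rw [hg.energy p, Pi.single_eq_same, Pi.single_apply]
    by_cases hp : p = o
    · simp [hp]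
    · simp [hp, Ne.symm hp]
  have h2 := Finset.sum_congr (s₁ := (Finset.univ : Finset V)) rfl fun p _ => h p
  rw [Finset.sum_sub_distrib, Finset.sum_ite_eq' , if_pos (Finset.mem_univ _)] at h2
  rw [← h2]
  simp only [energyOn, Finset.sum_mul]
  rw [Finset.sum_comm]
  refine Finset.sum_congr rfl fun e _ => ?_
  simp only [diff, Pi.single_apply, mul_sub, sub_mul, sub_div, Finset.sum_sub_distrib, mul_ite,
    mul_one, mul_zero, ite_mul, zero_mul, ite_div, zero_div, Finset.sum_ite_eq, Finset.mem_univ,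
    if_true]
  rw [hg.symm (G.tgt e) (G.src e)]
  ring

/-- The Dirichlet form of the diagonal of the Green's function. -/
lemma energy_diag (φ : V → ℝ) :
    G.energyOn Finset.univ (fun p => g p p) φ = 2 * ∑ p, φ p - 2 * φ o
      - ∑ e, G.edgeRes g e / G.m e * (φ (G.src e) + φ (G.tgt e)) := by
  have h := hg.sum_slopes φ
  have : G.energyOn Finset.univ (fun p => g p p) φ
      + ∑ e, G.edgeRes g e / G.m e * (φ (G.src e) + φ (G.tgt e))
      = 2 * ∑ e, (φ (G.src e) * (g (G.src e) (G.src e) - g (G.src e) (G.tgt e)) / G.m e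
      + φ (G.tgt e) * (g (G.tgt e) (G.tgt e) - g (G.src e) (G.tgt e)) / G.m e) := by
    rw [energyOn, ← Finset.sum_add_distrib, Finset.mul_sum]
    refine Finset.sum_congr rfl fun e _ => ?_
    simp only [diff, edgeRes]
    ring
  rw [h] at this
  linarith

/-- Foster's theorem. -/
lemma sum_foster : ∑ e, G.foster g e = (Fintype.card E : ℝ) - Fintype.card V + 1 := by
  have h := hg.energy_diag (fun _ => 1)
  have h0 : G.energyOn Finset.univ (fun p => g p p) (fun _ => 1) = 0 := by simp [energyOn, diff]
  rw [h0] at h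
  simp only [Finset.sum_const, Finset.card_univ, nsmul_eq_mul, mul_one, ← Finset.sum_mul] at h
  simp only [foster, Finset.sum_sub_distrib, Finset.sum_const, Finset.card_univ, nsmul_eq_mul,
    mul_one]
  linarith

/-- The diagonal of the Green's function as a superposition of Green's functions. -/
lemma diag_eq (p : V) :
    ∑ e, G.foster g e * (g (G.src e) p + g (G.tgt e) p)
      = g p p + ∑ e, (g (G.src e) p + g (G.tgt e) p) - 2 * ∑ x, g x p := by
  have h := hg.energy_diag (fun x => g x p)
  rw [energyOn_comm, hg.energy p] at h
  simp only [hg.ground, mul_zero, sub_zero] at h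
  simp only [foster, sub_mul, one_mul, Finset.sum_sub_distrib]
  linarith

omit [Fintype V] in
lemma edge_energy (e : E) (φ : V → ℝ) :
    G.energyOn Finset.univ (fun x => g x (G.src e) - g x (G.tgt e)) φ
      = φ (G.src e) - φ (G.tgt e) := by
  rw [energyOn_sub_left, hg.energy, hg.energy]; ring

omit [Fintype V] in
lemma diff_edge (e : E) :
    G.diff (fun x => g x (G.src e) - g x (G.tgt e)) e = - G.edgeRes g e := by
  simp only [diff, edgeRes]
  rw [hg.symm (G.tgt e) (G.src e)]; ring

omit [Fintype V] in
lemma edgeRes_eq_energy (e : E) : G.edgeRes g e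
    = G.energyOn Finset.univ (fun x => g x (G.src e) - g x (G.tgt e))
      (fun x => g x (G.src e) - g x (G.tgt e)) := by
  rw [hg.edge_energy]
  simp only [edgeRes]
  rw [hg.symm (G.tgt e) (G.src e)]; ring

omit [Fintype V] in
lemma edgeRes_nonneg (e : E) : 0 ≤ G.edgeRes g e := by
  rw [hg.edgeRes_eq_energy]; exact G.energyOn_self_nonneg _ _

omit hg [Fintype V] in
lemma energyOn_erase [DecidableEq E] (f φ : V → ℝ) (e : E) :
    G.energyOn (Finset.univ.erase e) f φ
      = G.energyOn Finset.univ f φ - G.diff f e * G.diff φ e / G.m e := by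
  rw [energyOn, energyOn, ← Finset.add_sum_erase Finset.univ _ (Finset.mem_univ e)]; ring

omit [Fintype V] in
lemma mul_foster (e : E) [DecidableEq E] : G.edgeRes g e * G.foster g e
    = G.energyOn (Finset.univ.erase e) (fun x => g x (G.src e) - g x (G.tgt e))
      (fun x => g x (G.src e) - g x (G.tgt e)) := by
  rw [energyOn_erase, ← hg.edgeRes_eq_energy, hg.diff_edge, foster]
  ring

omit [Fintype V] in
lemma foster_nonneg (e : E) : 0 ≤ G.foster g e := by
  classical
  by_contra hneg
  push Not at hneg
  have h := hg.mul_foster e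
  have h1 := G.energyOn_self_nonneg (Finset.univ.erase e)
    (fun x => g x (G.src e) - g x (G.tgt e))
  rw [← h] at h1
  have h2 := hg.edgeRes_nonneg e
  have h3 : G.edgeRes g e = 0 := by nlinarith
  simp [foster, h3] at hneg
  linarith

omit [Fintype V] in
/-- The Foster coefficient of an edge is positive if its end points are joined by other edges. -/
lemma foster_pos {e : E}
    (he : ∀ φ : V → ℝ, (∀ f, f ≠ e → G.diff φ f = 0) → G.diff φ e = 0) :
    0 < G.foster g e := by
  classical
  refine lt_of_le_of_ne (hg.foster_nonneg e) fun h0 => ?_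
  have h := hg.mul_foster e
  rw [← h0, mul_zero] at h
  have h1 := he _ fun f hf => G.diff_eq_zero_of_energyOn_self h.symm f (by simp [hf])
  rw [hg.diff_edge] at h1
  simp [foster, neg_eq_zero.1 h1] at h0

omit [Fintype V] in
/-- Effective resistances do not depend on the ground. -/
lemma change_ground {o' : V} {g' : V → V → ℝ} (hg' : G.IsVertexGreen o' g') (x y : V) :
    g x x + g y y - 2 * g x y = g' x x + g' y y - 2 * g' x y := by
  have key : ∀ {o₁ o₂ : V} {g₁ g₂ : V → V → ℝ}, G.IsVertexGreen o₁ g₁ → G.IsVertexGreen o₂ g₂ →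
      G.energyOn Finset.univ (fun z => g₁ z x - g₁ z y) (fun z => g₂ z x - g₂ z y)
        = g₂ x x + g₂ y y - 2 * g₂ x y := by
    intro o₁ o₂ g₁ g₂ h₁ h₂
    rw [energyOn_sub_left, h₁.energy, h₁.energy, h₂.symm y x]
    ring
  rw [← key hg' hg, energyOn_comm, key hg hg']

end IsVertexGreen

end WeightedGraph

/-! ### Bridges -/

namespace WeightedGraph

variable {V E : Type*} (G : WeightedGraph V E)

lemma toGraph_isLink {e : E} {x y : V} : G.toGraph.IsLink e x y ↔
    (x = G.src e ∧ y = G.tgt e) ∨ (x = G.tgt e ∧ y = G.src e) := Iff.rfl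

lemma isLink_src_tgt (e : E) : G.toGraph.IsLink e (G.src e) (G.tgt e) := Or.inl ⟨rfl, rfl⟩

lemma potentialConnected (h : Connected G.toGraph) : G.PotentialConnected := by
  intro f hf x y
  have := h.2 x (Set.mem_univ x) y (Set.mem_univ y)
  induction this with
  | refl => rfl
  | tail _ hl ih =>
    obtain ⟨e, he⟩ := hl
    have := hf e
    rw [diff, sub_eq_zero] at this
    rcases he with ⟨rfl, rfl⟩ | ⟨rfl, rfl⟩
    · rw [ih, this]
    · rw [ih, this]

lemma eq_of_reachable {f : E} {φ : V → ℝ} (hφ : ∀ e, e ≠ f → G.diff φ e = 0) {x y : V}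
    (h : Reachable (G.toGraph.deleteEdges {f}) x y) : φ x = φ y := by
  induction h with
  | refl => rfl
  | tail _ hl ih =>
    obtain ⟨e, he, hef⟩ := hl
    have := hφ e hef
    rw [diff, sub_eq_zero] at this
    rcases he with ⟨rfl, rfl⟩ | ⟨rfl, rfl⟩
    · rw [ih, this]
    · rw [ih, this]

lemma reachable_symm {H : Graph V E} {x y : V} (h : Reachable H x y) : Reachable H y x := by
  induction h with
  | refl => exact Relation.ReflTransGen.refl
  | tail _ hl ih =>
    obtain ⟨e, he⟩ := hl
    exact Relation.ReflTransGen.head ⟨e, he.symm⟩ ih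

lemma reachable_step {f e : E} (hef : e ≠ f) :
    Reachable (G.toGraph.deleteEdges {f}) (G.src e) (G.tgt e) :=
  Relation.ReflTransGen.single ⟨e, G.isLink_src_tgt e, hef⟩

/-- Across an edge that is not a bridge, a potential has no increment if it has no increments
across the other edges. -/
lemma diff_eq_zero_of_not_isBridge {f : E} (hf : ¬ IsBridge G.toGraph f) {φ : V → ℝ}
    (hφ : ∀ e, e ≠ f → G.diff φ e = 0) : G.diff φ f = 0 := by
  have : Reachable (G.toGraph.deleteEdges {f}) (G.src f) (G.tgt f) := by
    by_contra h
    exact hf ⟨_, _, G.isLink_src_tgt f, h⟩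
  rw [diff, G.eq_of_reachable hφ this, sub_self]

lemma isBridge_iff {f : E} : IsBridge G.toGraph f ↔
    ¬ Reachable (G.toGraph.deleteEdges {f}) (G.src f) (G.tgt f) := by
  constructor
  · rintro ⟨x, y, ⟨rfl, rfl⟩ | ⟨rfl, rfl⟩, h⟩
    · exact h
    · exact fun h' => h (reachable_symm h')
  · exact fun h => ⟨_, _, G.isLink_src_tgt f, h⟩

open Classical in
/-- The indicator function of the vertices that are separated from `o` by the removal of `f`. -/
def farInd (o : V) (f : E) (x : V) : ℝ :=
  if Reachable (G.toGraph.deleteEdges {f}) o x then 0 else 1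

lemma farInd_self (o : V) (f : E) : G.farInd o f o = 0 :=
  if_pos Relation.ReflTransGen.refl

lemma farInd_eq_zero_or (o : V) (f : E) (x : V) : G.farInd o f x = 0 ∨ G.farInd o f x = 1 := by
  unfold farInd; split_ifs <;> simp

lemma farInd_nonneg (o : V) (f : E) (x : V) : 0 ≤ G.farInd o f x := by
  rcases G.farInd_eq_zero_or o f x with h | h <;> simp [h]

lemma farInd_mul_self (o : V) (f : E) (x : V) :
    G.farInd o f x * G.farInd o f x = G.farInd o f x := by
  rcases G.farInd_eq_zero_or o f x with h | h <;> simp [h]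

lemma diff_farInd_of_ne (o : V) {f e : E} (hef : e ≠ f) : G.diff (G.farInd o f) e = 0 := by
  have h := G.reachable_step hef
  unfold diff farInd
  by_cases hr : Reachable (G.toGraph.deleteEdges {f}) o (G.src e)
  · rw [if_pos hr, if_pos (show Reachable _ o (G.tgt e) from hr.trans h), sub_self]
  · have hr' : ¬ Reachable (G.toGraph.deleteEdges {f}) o (G.tgt e) :=
      fun h' => hr (h'.trans (reachable_symm h))
    rw [if_neg hr, if_neg hr', sub_self]

variable {G}

/-- Exactly one end point of a bridge is separated from `o`. -/
lemma farInd_bridge (hc : G.PotentialConnected) (o : V) {f : E} (hf : IsBridge G.toGraph f) :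
    G.farInd o f (G.src f) + G.farInd o f (G.tgt f) = 1 := by
  have hne : G.diff (G.farInd o f) f ≠ 0 ∨ G.farInd o f (G.src f) = 0 := by
    by_contra h
    push Not at h
    refine h.2 ?_
    rw [hc (G.farInd o f) (fun e => ?_) (G.src f) o, farInd_self]
    by_cases he : e = f
    · rw [he]; exact h.1
    · exact G.diff_farInd_of_ne o he
  rw [isBridge_iff] at hf
  have hor : G.farInd o f (G.src f) = 1 ∨ G.farInd o f (G.tgt f) = 1 := by
    by_contra h
    push Not at h
    have h1 := (G.farInd_eq_zero_or o f (G.src f)).resolve_right h.1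
    have h2 := (G.farInd_eq_zero_or o f (G.tgt f)).resolve_right h.2
    simp only [farInd, ite_eq_left_iff, one_ne_zero, imp_false, not_not] at h1 h2
    exact hf ((reachable_symm h1).trans h2)
  have hs := G.farInd_eq_zero_or o f (G.src f)
  have ht := G.farInd_eq_zero_or o f (G.tgt f)
  rw [diff] at hne
  rcases hs with hs | hs <;> rcases ht with ht | ht <;> simp_all

lemma diff_farInd_mul_self (hc : G.PotentialConnected) (o : V) {f : E}
    (hf : IsBridge G.toGraph f) :
    G.diff (G.farInd o f) f * G.diff (G.farInd o f) f = 1 := by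
  have h := farInd_bridge hc o hf
  have hs := G.farInd_eq_zero_or o f (G.src f)
  rw [diff, eq_sub_of_add_eq' h]
  rcases hs with hs | hs <;> rw [hs] <;> norm_num

lemma eq_of_diff_eq_zero_of_ne (hc : G.PotentialConnected) {e : E} (he : ¬ IsBridge G.toGraph e)
    {φ : V → ℝ} (hφ : ∀ f, f ≠ e → G.diff φ f = 0) (x y : V) : φ x = φ y := by
  refine hc φ (fun f => ?_) x y
  by_cases h : f = e
  · exact h ▸ G.diff_eq_zero_of_not_isBridge he hφ
  · exact hφ f h

variable (G)

/-- Potentials that are constant along the bridges. -/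
def BridgeConstant (φ : V → ℝ) : Prop := ∀ f, IsBridge G.toGraph f → G.diff φ f = 0

/-- The vertices `p` and `o` are joined by bridges, in terms of potentials. -/
def BridgeEquiv (p o : V) : Prop := ∀ φ, G.BridgeConstant φ → φ p = φ o

lemma BridgeConstant.bridgeEquiv {f : E} (hf : IsBridge G.toGraph f) :
    G.BridgeEquiv (G.src f) (G.tgt f) := fun φ hφ => by
  have := hφ f hf
  rw [diff, sub_eq_zero] at this
  exact this.symm

variable {G} in
lemma BridgeEquiv.symm {p o : V} (h : G.BridgeEquiv p o) : G.BridgeEquiv o p :=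
  fun φ hφ => (h φ hφ).symm

variable {G} in
lemma BridgeEquiv.trans {p o r : V} (h : G.BridgeEquiv p o) (h' : G.BridgeEquiv o r) :
    G.BridgeEquiv p r :=
  fun φ hφ => (h φ hφ).trans (h' φ hφ)

/-- The edge `e` has an end point that is joined to `o` by bridges. -/
def TouchesClass (e : E) (o : V) : Prop := G.BridgeEquiv (G.src e) o ∨ G.BridgeEquiv (G.tgt e) o

/-- A function constant away from the class of `o` and zero on this class is constant along
bridges. -/
lemma bridgeConstant_of_vanish {o : V} {φ : V → ℝ} (h0 : ∀ x, G.BridgeEquiv x o → φ x = 0)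
    (h1 : ∀ f, IsBridge G.toGraph f → ¬ G.TouchesClass f o → G.diff φ f = 0) :
    G.BridgeConstant φ := by
  intro f hf
  by_cases ht : G.TouchesClass f o
  · have hs := BridgeConstant.bridgeEquiv G hf
    have h2 : G.BridgeEquiv (G.src f) o ∧ G.BridgeEquiv (G.tgt f) o := by
      rcases ht with h | h
      · exact ⟨h, hs.symm.trans h⟩
      · exact ⟨hs.trans h, h⟩
    rw [diff, h0 _ h2.1, h0 _ h2.2, sub_self]
  · exact h1 f hf ht

variable [Fintype E]

/-- Flows without sources and sinks, i.e. real 1-cycles. -/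
def IsFlow (c : E → ℝ) : Prop := ∀ φ : V → ℝ, ∑ e, c e * G.diff φ e = 0

variable {G} in
lemma IsFlow.eq_zero_of_isBridge (hc : G.PotentialConnected) {c : E → ℝ} (h : G.IsFlow c) {f : E}
    (hf : IsBridge G.toGraph f) : c f = 0 := by
  have h1 := h (G.farInd (G.src f) f)
  rw [Finset.sum_eq_single f (fun e _ he => by rw [G.diff_farInd_of_ne _ he, mul_zero])
    (by simp)] at h1
  have h2 := diff_farInd_mul_self hc (G.src f) hf
  rcases mul_eq_zero.1 h1 with h | h
  · exact h
  · simp [h] at h2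

/-- The condition on a vertex `o` for the vanishing of its contribution to the slope: positive
vertex genera occur only in the class of `o`, and every cycle meets this class. -/
def TightAt (q : V → ℕ) (o : V) : Prop :=
  (∀ p, q p ≠ 0 → G.BridgeEquiv p o) ∧
    ∀ c, G.IsFlow c → (∀ e, G.TouchesClass e o → c e = 0) → c = 0

open Classical in
/-- The edges that are not bridges. -/
def nonBridges : Finset E := Finset.univ.filter fun e => ¬ IsBridge G.toGraph e

lemma mem_nonBridges {e : E} : e ∈ G.nonBridges ↔ ¬ IsBridge G.toGraph e := by
  simp [nonBridges]

/-- The Green's function of the graph obtained by contracting the bridges, as a function on the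
vertices of the original graph. -/
structure IsReducedGreen (o : V) (k : V → V → ℝ) : Prop where
  const : ∀ y, G.BridgeConstant fun x => k x y
  energy : ∀ y φ, G.BridgeConstant φ →
    G.energyOn G.nonBridges (fun x => k x y) φ = φ y - φ o
  ground : ∀ y, k o y = 0
  foster_pos : ∀ e, ¬ IsBridge G.toGraph e → 0 < G.foster k e

namespace IsReducedGreen

variable {G} {o : V} {k : V → V → ℝ} (hk : G.IsReducedGreen o k)
include hk

lemma symm (x y : V) : k x y = k y x := by
  have h1 := hk.energy x _ (hk.const y)
  have h2 := hk.energy y _ (hk.const x)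
  rw [energyOn_comm] at h1
  simp only [hk.ground, sub_zero] at h1 h2
  rw [← h1, ← h2]

lemma diag_nonneg (p : V) : 0 ≤ k p p := by
  have h := hk.energy p _ (hk.const p)
  rw [hk.ground, sub_zero] at h
  rw [← h]
  exact G.energyOn_self_nonneg _ _

lemma eq_zero_of_bridgeEquiv {p : V} (h : G.BridgeEquiv p o) (x : V) : k p x = 0 := by
  rw [h _ (hk.const x), hk.ground]

lemma diag_eq_zero_iff (hc : G.PotentialConnected) (p : V) : k p p = 0 ↔ G.BridgeEquiv p o := by
  refine ⟨fun h0 => ?_, fun h => hk.eq_zero_of_bridgeEquiv h p⟩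
  have h := hk.energy p _ (hk.const p)
  rw [hk.ground, h0, sub_zero] at h
  have h1 := G.diff_eq_zero_of_energyOn_self h
  have h2 : ∀ x, k x p = 0 := fun x => by
    rw [hc (fun x => k x p) (fun e => ?_) x o, hk.ground]
    by_cases he : IsBridge G.toGraph e
    · exact hk.const p e he
    · exact h1 e (G.mem_nonBridges.2 he)
  intro φ hφ
  have h3 := hk.energy p φ hφ
  rw [energyOn] at h3
  simp only [h2, diff, sub_self, zero_mul, zero_div, Finset.sum_const_zero] at h3
  linarith

omit [Fintype E] hk in
variable (G k) in
/-- A multiple of the Green's function, with pole at the initial point of `e`, of the graph obtained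
by deleting the edge `e` and contracting the bridges. -/
def deleted (e : E) (x : V) : ℝ :=
  G.foster k e * k x (G.src e)
    + (k (G.src e) (G.src e) - k (G.src e) (G.tgt e)) / G.m e * (k x (G.src e) - k x (G.tgt e))

lemma deleted_tgt (e : E) : deleted G k e (G.tgt e) = G.minorTerm k e := by
  simp only [deleted, minorTerm, foster, edgeRes]
  rw [hk.symm (G.tgt e) (G.src e)]
  ring

omit [Fintype E] hk in
lemma deleted_src (e : E) : deleted G k e (G.src e) = G.foster k e * k (G.src e) (G.src e)
    + (k (G.src e) (G.src e) - k (G.src e) (G.tgt e)) ^ 2 / G.m e := by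
  simp only [deleted]; ring

lemma diff_deleted (e : E) :
    G.diff (deleted G k e) e = -(k (G.src e) (G.src e) - k (G.src e) (G.tgt e)) := by
  simp only [diff, deleted, foster, edgeRes]
  rw [hk.symm (G.tgt e) (G.src e)]
  ring

lemma deleted_const (e : E) : G.BridgeConstant (deleted G k e) := by
  intro f hf
  have h1 := hk.const (G.src e) f hf
  have h2 := hk.const (G.tgt e) f hf
  unfold deleted
  rw [diff_add, diff_smul, diff_smul, diff_sub, h1, h2]
  ring

lemma deleted_zero_of_bridgeEquiv (e : E) {x : V} (hx : G.BridgeEquiv x o) :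
    deleted G k e x = 0 := by
  simp [deleted, hk.eq_zero_of_bridgeEquiv hx]

lemma deleted_energy [DecidableEq E] {e : E} (he : ¬ IsBridge G.toGraph e) {φ : V → ℝ}
    (hφ : G.BridgeConstant φ) :
    G.energyOn (G.nonBridges.erase e) (deleted G k e) φ
      = G.foster k e * (φ (G.src e) - φ o) := by
  have h1 : G.energyOn (G.nonBridges.erase e) (deleted G k e) φ
      = G.energyOn G.nonBridges (deleted G k e) φ
        - G.diff (deleted G k e) e * G.diff φ e / G.m e := by
    rw [energyOn, energyOn, ← Finset.add_sum_erase _ _ (G.mem_nonBridges.2 he)]; ring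
  have h2 : G.energyOn G.nonBridges (deleted G k e) φ
      = G.foster k e * (φ (G.src e) - φ o)
      + (k (G.src e) (G.src e) - k (G.src e) (G.tgt e)) / G.m e
        * (φ (G.src e) - φ (G.tgt e)) := by
    unfold deleted
    rw [energyOn_add_left, energyOn_smul_left, energyOn_smul_left, energyOn_sub_left,
      hk.energy _ _ hφ, hk.energy _ _ hφ]
    ring
  rw [h1, h2, hk.diff_deleted]
  simp only [diff]
  ring

/-- The minimum principle. -/
lemma deleted_nonneg (hc : G.PotentialConnected) {e : E} (he : ¬ IsBridge G.toGraph e) (x : V) :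
    0 ≤ deleted G k e x := by
  classical
  set v := deleted G k e with hv
  let φ : V → ℝ := fun x => min (v x) 0
  have hφ : G.BridgeConstant φ := by
    intro f hf
    have := hk.deleted_const e f hf
    rw [diff, sub_eq_zero] at this
    simp only [φ, diff]
    rw [← hv] at this
    rw [this, sub_self]
  have h1 := hk.deleted_energy he hφ
  have hφo : φ o = 0 := by
    simp [φ, hv, hk.deleted_zero_of_bridgeEquiv e (fun _ _ => rfl : G.BridgeEquiv o o)]
  have h2 : G.energyOn (G.nonBridges.erase e) φ φ ≤ G.energyOn (G.nonBridges.erase e) v φ := by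
    refine Finset.sum_le_sum fun f _ => ?_
    refine div_le_div_of_nonneg_right ?_ (G.m_pos f).le
    simp only [diff, φ]
    rcases le_total (v (G.tgt f)) 0 with ha | ha <;>
      rcases le_total (v (G.src f)) 0 with hb | hb <;>
      simp only [min_eq_left, min_eq_right, ha, hb] <;> nlinarith
  have h3 : G.energyOn (G.nonBridges.erase e) φ φ = 0 := by
    refine le_antisymm ?_ (G.energyOn_self_nonneg _ _)
    rw [← hv, hφo, sub_zero] at h1
    have h4 : φ (G.src e) ≤ 0 := min_le_right _ _
    have h5 := hk.foster_pos e he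
    nlinarith
  have h4 := G.diff_eq_zero_of_energyOn_self h3
  have h5 : φ x = 0 := by
    rw [eq_of_diff_eq_zero_of_ne hc he (φ := φ) (fun f hf => ?_) x o, hφo]
    by_cases hb : IsBridge G.toGraph f
    · exact hφ f hb
    · exact h4 f (Finset.mem_erase.2 ⟨hf, G.mem_nonBridges.2 hb⟩)
  exact min_eq_right_iff.1 h5

lemma minorTerm_nonneg (hc : G.PotentialConnected) {e : E} (he : ¬ IsBridge G.toGraph e) :
    0 ≤ G.minorTerm k e := by
  rw [← hk.deleted_tgt]; exact hk.deleted_nonneg hc he _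

/-- If all minor terms vanish then every cycle meets the class of `o`: the zero set of the Green's
function of the graph without `e` separates the end points of `e`. -/
lemma flow_eq_zero_of_minorTerm (hc : G.PotentialConnected)
    (h0 : ∀ e, ¬ IsBridge G.toGraph e → G.minorTerm k e = 0) {c : E → ℝ} (hfl : G.IsFlow c)
    (hav : ∀ e, G.TouchesClass e o → c e = 0) : c = 0 := by
  classical
  ext e
  by_contra hce
  rw [Pi.zero_apply] at hce
  have he : ¬ IsBridge G.toGraph e := fun hb => hce (hfl.eq_zero_of_isBridge hc hb)
  have hte : ¬ G.TouchesClass e o := fun h => hce (hav e h)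
  set v := deleted G k e with hv
  have hvb : v (G.tgt e) = 0 := by rw [hv, hk.deleted_tgt, h0 e he]
  have hva : 0 < v (G.src e) := by
    rw [hv, deleted_src]
    have h1 : k (G.src e) (G.src e) ≠ 0 := fun h =>
      hte (Or.inl ((hk.diag_eq_zero_iff hc _).1 h))
    have h2 : 0 < k (G.src e) (G.src e) := lt_of_le_of_ne (hk.diag_nonneg _) h1.symm
    have h3 := hk.foster_pos e he
    have h4 : 0 ≤ (k (G.src e) (G.src e) - k (G.src e) (G.tgt e)) ^ 2 / G.m e :=
      div_nonneg (sq_nonneg _) (G.m_pos e).le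
    have := mul_pos h3 h2
    linarith
  -- the indicator function of the zero set of `v` outside the class of `o`
  let φ : V → ℝ := fun x => if v x = 0 ∧ ¬ G.BridgeEquiv x o then 1 else 0
  have hφ : G.BridgeConstant φ := by
    refine G.bridgeConstant_of_vanish (o := o) (fun x hx => by simp [φ, hx]) fun f hf ht => ?_
    have h1 := hk.deleted_const e f hf
    rw [diff, sub_eq_zero, ← hv] at h1
    have h2 : ¬ G.BridgeEquiv (G.src f) o := fun h => ht (Or.inl h)
    have h3 : ¬ G.BridgeEquiv (G.tgt f) o := fun h => ht (Or.inr h)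
    simp [diff, φ, h1, h2, h3]
  have hφa : φ (G.src e) = 0 := by simp [φ, hva.ne']
  have hφb : φ (G.tgt e) = 1 := by
    have : ¬ G.BridgeEquiv (G.tgt e) o := fun h => hte (Or.inr h)
    simp [φ, hvb, this]
  have hφo : φ o = 0 := by
    have : G.BridgeEquiv o o := fun _ _ => rfl
    simp [φ, this]
  have hen := hk.deleted_energy he hφ
  rw [hφa, hφo, sub_zero, mul_zero, energyOn, ← hv] at hen
  have hpos : ∀ x, 0 ≤ v x := hk.deleted_nonneg hc he
  have hterm : ∀ f ∈ G.nonBridges.erase e, G.diff v f * G.diff φ f / G.m f ≤ 0 := by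
    intro f _
    refine div_nonpos_of_nonpos_of_nonneg ?_ (G.m_pos f).le
    have hs := hpos (G.src f)
    have ht := hpos (G.tgt f)
    simp only [diff, φ]
    split_ifs with h1 h2 h2
    · simp
    · rw [h1.1]; linarith
    · rw [h2.1]; linarith
    · simp
  have hzero := (Finset.sum_eq_zero_iff_of_nonpos hterm).1 hen
  have hflow := hfl φ
  rw [Finset.sum_eq_single e ?_ (by simp)] at hflow
  · simp only [diff, hφa, hφb, sub_zero, mul_one] at hflow
    exact hce hflow
  · intro f _ hfe
    by_cases hfb : IsBridge G.toGraph f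
    · rw [hfl.eq_zero_of_isBridge hc hfb, zero_mul]
    have h1 := hzero f (Finset.mem_erase.2 ⟨hfe, G.mem_nonBridges.2 hfb⟩)
    have h2 : G.diff v f * G.diff φ f = 0 := by
      simpa [(G.m_pos f).ne'] using h1
    by_cases hd : G.diff φ f = 0
    · rw [hd, mul_zero]
    have h3 : v (G.tgt f) = v (G.src f) := by
      have := (mul_eq_zero.1 h2).resolve_right hd
      rwa [diff, sub_eq_zero] at this
    rw [hav f, zero_mul]
    by_contra ht
    refine hd ?_
    have h4 : ¬ G.BridgeEquiv (G.src f) o := fun h => ht (Or.inl h)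
    have h5 : ¬ G.BridgeEquiv (G.tgt f) o := fun h => ht (Or.inr h)
    simp [diff, φ, h3, h4, h5]

omit hk in
variable (G) in
/-- Duality of flows and potentials: an edge that carries no flow avoiding the
class of `o` is cut by a potential which is constant along the other edges avoiding the class. -/
lemma exists_cut [Fintype V] {e : E}
    (h : ∀ c, G.IsFlow c → (∀ e, G.TouchesClass e o → c e = 0) → c e = 0)
    (hte : ¬ G.TouchesClass e o) :
    ∃ φ : V → ℝ, G.diff φ e = 1 ∧ ∀ f, f ≠ e → ¬ G.TouchesClass f o → G.diff φ f = 0 := by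
  classical
  let L : V ⊕ {f : E // G.TouchesClass f o} → Module.Dual ℝ (E → ℝ) :=
    Sum.elim (fun x => ∑ f, G.diff (Pi.single x 1) f • LinearMap.proj f)
      (fun f => LinearMap.proj f.1)
  have hmem : (LinearMap.proj e : Module.Dual ℝ (E → ℝ)) ∈ Submodule.span ℝ (Set.range L) := by
    refine mem_span_of_iInf_ker_le_ker fun c hc => ?_
    simp only [Submodule.mem_iInf, LinearMap.mem_ker] at hc ⊢
    refine h c (fun φ => ?_) fun f hf => hc (Sum.inr ⟨f, hf⟩)
    have h1 : ∀ x, ∑ f, G.diff (Pi.single x 1) f * c f = 0 := by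
      intro x
      simpa [L] using hc (Sum.inl x)
    have h2 : ∀ f, G.diff φ f = ∑ x, φ x * G.diff (Pi.single x 1) f := by
      intro f
      simp [diff, mul_sub, Finset.sum_sub_distrib, Pi.single_apply]
    simp_rw [h2, Finset.mul_sum]
    rw [Finset.sum_comm]
    refine Finset.sum_eq_zero fun x _ => ?_
    rw [← mul_zero (φ x), ← h1 x, Finset.mul_sum]
    exact Finset.sum_congr rfl fun f _ => by ring
  obtain ⟨a, ha⟩ := (Submodule.mem_span_range_iff_exists_fun ℝ).1 hmem
  refine ⟨fun x => a (Sum.inl x), ?_⟩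
  have key : ∀ f, ¬ G.TouchesClass f o →
      G.diff (fun x => a (Sum.inl x)) f = if f = e then 1 else 0 := by
    intro f hf
    have h1 := congrArg (fun l : Module.Dual ℝ (E → ℝ) => l (Pi.single f 1)) ha
    simp only [Fintype.sum_sum_type, L, Sum.elim_inl, Sum.elim_inr, LinearMap.add_apply,
      LinearMap.sum_apply, LinearMap.smul_apply, LinearMap.proj_apply, smul_eq_mul,
      Pi.single_apply, mul_ite, mul_one, mul_zero] at h1
    have h2 : ∀ g : {f : E // G.TouchesClass f o}, g.1 ≠ f := fun g hg => hf (hg ▸ g.2)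
    simp only [h2, if_false, Finset.sum_const_zero, add_zero, Finset.sum_ite_eq',
      Finset.mem_univ, if_true] at h1
    simp only [eq_comm (a := f), ← h1]
    simp [diff, mul_sub, Finset.sum_sub_distrib, Pi.single_apply]
  exact ⟨by simpa using key e hte, fun f hf hft => by simpa [hf] using key f hft⟩

lemma minorTerm_eq_zero_of_flow [Fintype V] (hc : G.PotentialConnected)
    (h : ∀ c, G.IsFlow c → (∀ e, G.TouchesClass e o → c e = 0) → c = 0) {e : E}
    (he : ¬ IsBridge G.toGraph e) : G.minorTerm k e = 0 := by
  classical
  rw [← hk.deleted_tgt]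
  by_cases hte : G.TouchesClass e o
  · rcases hte with h1 | h1
    · simp [deleted, hk.symm _ (G.src e), hk.eq_zero_of_bridgeEquiv h1]
    · exact hk.deleted_zero_of_bridgeEquiv e h1
  obtain ⟨φ, hφe, hφ⟩ := exists_cut G (fun c h1 h2 => congrFun (h c h1 h2) e) hte
  set v := deleted G k e with hv
  -- cut off the Green's function outside the side of the end point of `e`
  let w : V → ℝ := fun x => if φ x = φ (G.tgt e) then v x else 0
  have hv0 : ∀ x, G.BridgeEquiv x o → v x = 0 := fun x hx => hk.deleted_zero_of_bridgeEquiv e hx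
  have hw0 : ∀ x, G.BridgeEquiv x o → w x = 0 := fun x hx => by simp [w, hv0 x hx]
  have hw : G.BridgeConstant w := by
    refine G.bridgeConstant_of_vanish hw0 fun f hf ht => ?_
    have h1 := hk.deleted_const e f hf
    rw [diff, sub_eq_zero, ← hv] at h1
    have h2 := hφ f (fun hfe => he (hfe ▸ hf)) ht
    rw [diff, sub_eq_zero] at h2
    simp [diff, w, h1, h2]
  have hen := hk.deleted_energy he hw
  have hwa : w (G.src e) = 0 := by
    have : φ (G.src e) ≠ φ (G.tgt e) := fun h => by simp [diff, h] at hφe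
    simp [w, this]
  have hwo : w o = 0 := hw0 o fun _ _ => rfl
  rw [hwa, hwo, sub_zero, mul_zero, ← hv] at hen
  have h1 : G.energyOn (G.nonBridges.erase e) w w = 0 := by
    rw [← hen]
    refine Finset.sum_congr rfl fun f hf => ?_
    congr 1
    by_cases ht : G.TouchesClass f o
    · simp only [diff, w]
      rcases ht with h | h <;> rw [hv0 _ h] <;> split_ifs <;> ring
    · have h2 := hφ f (Finset.ne_of_mem_erase hf) ht
      rw [diff, sub_eq_zero] at h2
      simp only [diff, w, h2]
      split_ifs <;> ring
  have h2 := G.diff_eq_zero_of_energyOn_self h1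
  have h3 : w (G.tgt e) = w o := by
    refine eq_of_diff_eq_zero_of_ne hc he (fun f hf => ?_) _ _
    by_cases hb : IsBridge G.toGraph f
    · exact hw f hb
    · exact h2 f (Finset.mem_erase.2 ⟨hf, G.mem_nonBridges.2 hb⟩)
  simpa [w, hwo] using h3

/-- The contribution of the vertex `o` to the slope. -/
lemma contribution_eq_zero_iff [Fintype V] (hc : G.PotentialConnected) (q : V → ℕ) :
    ∑ e ∈ G.nonBridges, G.minorTerm k e + ∑ p, (q p : ℝ) * k p p = 0 ↔ G.TightAt q o := by
  have h1 : ∀ e ∈ G.nonBridges, 0 ≤ G.minorTerm k e := fun e he =>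
    hk.minorTerm_nonneg hc (G.mem_nonBridges.1 he)
  have h2 : ∀ p ∈ Finset.univ, 0 ≤ (q p : ℝ) * k p p := fun p _ =>
    mul_nonneg (Nat.cast_nonneg _) (hk.diag_nonneg p)
  rw [add_eq_zero_iff_of_nonneg (Finset.sum_nonneg h1) (Finset.sum_nonneg h2),
    Finset.sum_eq_zero_iff_of_nonneg h1, Finset.sum_eq_zero_iff_of_nonneg h2, TightAt, and_comm]
  refine and_congr ?_ ?_
  · refine forall_congr' fun p => ?_
    simp only [Finset.mem_univ, true_implies, mul_eq_zero, Nat.cast_eq_zero,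
      hk.diag_eq_zero_iff hc p]
    tauto
  · exact ⟨fun h c hfl hav => hk.flow_eq_zero_of_minorTerm hc
      (fun e he => h e (G.mem_nonBridges.2 he)) hfl hav,
      fun h e he => hk.minorTerm_eq_zero_of_flow hc h (G.mem_nonBridges.1 he)⟩

lemma contribution_nonneg [Fintype V] (hc : G.PotentialConnected) (q : V → ℕ) :
    0 ≤ ∑ e ∈ G.nonBridges, G.minorTerm k e + ∑ p, (q p : ℝ) * k p p :=
  add_nonneg
    (Finset.sum_nonneg fun _ he => hk.minorTerm_nonneg hc (G.mem_nonBridges.1 he))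
    (Finset.sum_nonneg fun p _ => mul_nonneg (Nat.cast_nonneg _) (hk.diag_nonneg p))

end IsReducedGreen

end WeightedGraph

/-! ### Splitting off the bridges -/

namespace WeightedGraph

variable {V E : Type*} (G : WeightedGraph V E) [Fintype E]

open Classical in
/-- The part of the Green's function grounded at `o` that is due to the bridges. -/
def bridgeForm (o x y : V) : ℝ :=
  ∑ f with IsBridge G.toGraph f, G.m f * (G.farInd o f x * G.farInd o f y)

open Classical in
/-- The genus of the part of the graph that is separated from `o` by the bridge `f`. -/
def farGenus [Fintype V] (q : V → ℕ) (o : V) (f : E) : ℝ :=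
  ∑ e ∈ Finset.univ.erase f, G.farInd o f (G.src e) - ∑ p, G.farInd o f p + 1
    + ∑ p, (q p : ℝ) * G.farInd o f p

variable {G} {o : V}

omit [Fintype E] in
lemma farInd_src_eq_tgt {f e : E} (h : e ≠ f) :
    G.farInd o f (G.tgt e) = G.farInd o f (G.src e) := by
  have := G.diff_farInd_of_ne o h
  rwa [diff, sub_eq_zero] at this

lemma diff_bridgeForm_of_not_isBridge {e : E} (he : ¬ IsBridge G.toGraph e) (y : V) :
    G.bridgeForm o (G.tgt e) y = G.bridgeForm o (G.src e) y := by
  classical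
  unfold bridgeForm
  refine Finset.sum_congr rfl fun f hf => ?_
  rw [farInd_src_eq_tgt]
  rintro rfl
  exact he (Finset.mem_filter.1 hf).2

lemma bridgeForm_symm (x y : V) : G.bridgeForm o x y = G.bridgeForm o y x := by
  simp only [bridgeForm, mul_comm]

lemma diff_bridgeForm (y : V) {f : E} (hf : IsBridge G.toGraph f) :
    G.diff (fun x => G.bridgeForm o x y) f
      = G.m f * (G.diff (G.farInd o f) f * G.farInd o f y) := by
  classical
  unfold bridgeForm
  rw [diff_sum, Finset.sum_eq_single f]
  · simp only [diff]; ring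
  · intro e _ hef
    have := farInd_src_eq_tgt (G := G) (o := o) hef.symm
    simp [diff, this]
  · intro h
    exact absurd (Finset.mem_filter.2 ⟨Finset.mem_univ f, hf⟩) h

namespace IsVertexGreen

variable {g : V → V → ℝ} (hg : G.IsVertexGreen o g)
include hg

lemma diff_bridge (hc : G.PotentialConnected) {f : E} (hf : IsBridge G.toGraph f) (y : V) :
    G.diff (fun x => g x y) f = G.m f * (G.diff (G.farInd o f) f * G.farInd o f y) := by
  have h := hg.energy y (G.farInd o f)
  rw [farInd_self, sub_zero, energyOn, Finset.sum_eq_single f] at h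
  · have h1 := diff_farInd_mul_self hc o hf
    rw [← h]
    have := (G.m_pos f).ne'
    field_simp
    rw [pow_two, h1, mul_one]
  · intro e _ hef
    rw [G.diff_farInd_of_ne o hef]; simp
  · simp

variable (G o g) in
omit hg in
/-- The Green's function without the contribution of the bridges. -/
def reduced (x y : V) : ℝ := g x y - G.bridgeForm o x y

omit hg in
lemma foster_reduced {e : E} (he : ¬ IsBridge G.toGraph e) :
    G.foster (reduced G o g) e = G.foster g e := by
  have h1 := diff_bridgeForm_of_not_isBridge (o := o) he (G.src e)
  have h2 := diff_bridgeForm_of_not_isBridge (o := o) he (G.tgt e)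
  have h3 := G.bridgeForm_symm (o := o) (G.src e) (G.tgt e)
  simp only [foster, edgeRes, reduced]
  rw [h2, h3, h1]
  ring

lemma isReducedGreen (hc : G.PotentialConnected) : G.IsReducedGreen o (reduced G o g) := by
  classical
  refine ⟨fun y f hf => ?_, fun y φ hφ => ?_, fun y => ?_, fun e he => ?_⟩
  · unfold reduced
    rw [diff_sub, hg.diff_bridge hc hf, diff_bridgeForm y hf, sub_self]
  · rw [← hg.energy y φ]
    refine Finset.sum_subset_zero_on_sdiff (Finset.subset_univ _) (fun e he => ?_) fun e he => ?_
    · have : IsBridge G.toGraph e := by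
        simpa [mem_nonBridges] using (Finset.mem_sdiff.1 he).2
      rw [hφ e this]; simp
    · have := diff_bridgeForm_of_not_isBridge (o := o) (G.mem_nonBridges.1 he) y
      simp only [diff, reduced, this]
      ring_nf
  · simp [reduced, hg.ground, bridgeForm, farInd_self]
  · rw [foster_reduced he]
    exact hg.foster_pos fun φ hφ => G.diff_eq_zero_of_not_isBridge he hφ

omit hg in
lemma minorTerm_of_not_isBridge {e : E} (he : ¬ IsBridge G.toGraph e) :
    G.minorTerm g e = G.minorTerm (reduced G o g) e
      + G.foster g e * G.bridgeForm o (G.src e) (G.src e) := by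
  have h1 := diff_bridgeForm_of_not_isBridge (o := o) he (G.src e)
  have h2 := diff_bridgeForm_of_not_isBridge (o := o) he (G.tgt e)
  have h3 := G.bridgeForm_symm (o := o) (G.src e) (G.tgt e)
  simp only [foster, edgeRes, reduced, minorTerm]
  rw [h2, h3, h1]
  ring

omit hg in
lemma bridgeForm_of_isBridge (hc : G.PotentialConnected) {f : E} (hf : IsBridge G.toGraph f) :
    G.bridgeForm o (G.src f) (G.src f) =
      G.bridgeForm o (G.src f) (G.tgt f) + G.m f * G.farInd o f (G.src f) ∧
    G.bridgeForm o (G.tgt f) (G.tgt f) =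
      G.bridgeForm o (G.src f) (G.tgt f) + G.m f * G.farInd o f (G.tgt f) := by
  have hd := fun y => diff_bridgeForm (o := o) y hf
  have h1 := hd (G.src f)
  have h2 := hd (G.tgt f)
  have h3 := G.bridgeForm_symm (o := o) (G.src f) (G.tgt f)
  have h4 := farInd_bridge hc o hf
  have h5 := G.farInd_mul_self o f (G.src f)
  have h6 := G.farInd_mul_self o f (G.tgt f)
  have h7 : G.farInd o f (G.src f) * G.farInd o f (G.tgt f) = 0 := by
    rw [eq_sub_of_add_eq' h4, mul_sub, h5]; ring
  simp only [diff] at h1 h2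
  constructor
  · have : (G.farInd o f (G.tgt f) - G.farInd o f (G.src f)) * G.farInd o f (G.src f)
        = - G.farInd o f (G.src f) := by linear_combination h7 - h5
    rw [this] at h1
    linarith
  · have : (G.farInd o f (G.tgt f) - G.farInd o f (G.src f)) * G.farInd o f (G.tgt f)
        = G.farInd o f (G.tgt f) := by linear_combination -h7 + h6
    rw [this] at h2
    linarith

lemma green_of_isBridge (hc : G.PotentialConnected) {f : E} (hf : IsBridge G.toGraph f) :
    g (G.src f) (G.src f) = g (G.src f) (G.tgt f) + G.m f * G.farInd o f (G.src f) ∧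
    g (G.tgt f) (G.tgt f) = g (G.src f) (G.tgt f) + G.m f * G.farInd o f (G.tgt f) := by
  have hk := hg.isReducedGreen hc
  have h1 := hk.const (G.src f) f hf
  have h2 := hk.const (G.tgt f) f hf
  have h3 := hk.symm (G.tgt f) (G.src f)
  obtain ⟨h4, h5⟩ := bridgeForm_of_isBridge (o := o) hc hf
  simp only [diff, reduced] at h1 h2 h3
  constructor <;> linarith

lemma minorTerm_of_isBridge (hc : G.PotentialConnected) {f : E} (hf : IsBridge G.toGraph f) :
    G.minorTerm g f = 0 := by
  obtain ⟨h1, h2⟩ := hg.green_of_isBridge hc hf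
  have h4 := farInd_bridge hc o hf
  have h5 := G.farInd_mul_self o f (G.src f)
  have h3 := (G.m_pos f).ne'
  rw [minorTerm, h1, h2, eq_sub_of_add_eq' h4]
  field_simp
  linear_combination G.m f ^ 2 * h5

lemma foster_of_isBridge (hc : G.PotentialConnected) {f : E} (hf : IsBridge G.toGraph f) :
    G.foster g f = 0 := by
  obtain ⟨h1, h2⟩ := hg.green_of_isBridge hc hf
  have h4 := farInd_bridge hc o hf
  have h3 := (G.m_pos f).ne'
  rw [foster, edgeRes, h1, h2, eq_sub_of_add_eq' h4]
  field_simp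
  ring

variable [Fintype V]

/-- Foster's theorem for the part of the graph separated from the ground by a bridge. -/
lemma sum_foster_far (hc : G.PotentialConnected) [DecidableEq E] {f : E}
    (hf : IsBridge G.toGraph f) :
    ∑ e, G.foster g e * G.farInd o f (G.src e)
      = ∑ e ∈ Finset.univ.erase f, G.farInd o f (G.src e) - ∑ p, G.farInd o f p + 1 := by
  have h := hg.energy_diag (G.farInd o f)
  have h1 : G.energyOn Finset.univ (fun p => g p p) (G.farInd o f) = 1 := by
    rw [energyOn, Finset.sum_eq_single f]
    · obtain ⟨h1, h2⟩ := hg.green_of_isBridge hc hf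
      have h3 := diff_farInd_mul_self hc o hf
      have h4 := (G.m_pos f).ne'
      simp only [diff] at h3 ⊢
      rw [h1, h2]
      field_simp
      linear_combination G.m f * h3
    · intro e _ hef
      rw [G.diff_farInd_of_ne o hef]; simp
    · simp
  have h2 : G.edgeRes g f / G.m f = 1 := by
    have := hg.foster_of_isBridge hc hf
    rw [foster] at this
    linarith
  have h3 : ∑ e ∈ Finset.univ.erase f,
      G.edgeRes g e / G.m e * (G.farInd o f (G.src e) + G.farInd o f (G.tgt e))
      = ∑ e ∈ Finset.univ.erase f, G.edgeRes g e / G.m e * (2 * G.farInd o f (G.src e)) := by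
    refine Finset.sum_congr rfl fun e he => ?_
    rw [farInd_src_eq_tgt (Finset.ne_of_mem_erase he), ← two_mul]
  rw [h1, farInd_self, ← Finset.add_sum_erase _ _ (Finset.mem_univ f), farInd_bridge hc o hf, h2,
    h3] at h
  rw [← Finset.add_sum_erase _ _ (Finset.mem_univ f), hg.foster_of_isBridge hc hf]
  have h5 : ∑ e ∈ Finset.univ.erase f, G.foster g e * G.farInd o f (G.src e)
      = ∑ e ∈ Finset.univ.erase f, G.farInd o f (G.src e) - (∑ e ∈ Finset.univ.erase f,
        G.edgeRes g e / G.m e * (2 * G.farInd o f (G.src e))) / 2 := by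
    rw [Finset.sum_div, ← Finset.sum_sub_distrib]
    refine Finset.sum_congr rfl fun e _ => ?_
    rw [foster]; ring
  rw [h5]
  linarith

open Classical in
/-- The contribution of the bridges to the sum of the minor terms. -/
lemma sum_minorTerm (hc : G.PotentialConnected) (q : V → ℕ) :
    ∑ e, G.minorTerm g e + ∑ p, (q p : ℝ) * g p p
      = (∑ e ∈ G.nonBridges, G.minorTerm (reduced G o g) e
          + ∑ p, (q p : ℝ) * reduced G o g p p)
        + ∑ f with IsBridge G.toGraph f, G.m f * G.farGenus q o f := by
  have h1 : ∑ e, G.minorTerm g e = ∑ e ∈ G.nonBridges, G.minorTerm (reduced G o g) e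
      + ∑ e, G.foster g e * G.bridgeForm o (G.src e) (G.src e) := by
    rw [nonBridges, Finset.sum_filter, ← Finset.sum_add_distrib]
    refine Finset.sum_congr rfl fun e _ => ?_
    by_cases he : IsBridge G.toGraph e
    · simp [he, hg.minorTerm_of_isBridge hc he, hg.foster_of_isBridge hc he]
    · simp [he, ← minorTerm_of_not_isBridge he]
  have h2 : ∑ e, G.foster g e * G.bridgeForm o (G.src e) (G.src e)
      = ∑ f with IsBridge G.toGraph f, G.m f * ∑ e, G.foster g e * G.farInd o f (G.src e) := by
    simp only [bridgeForm, farInd_mul_self, Finset.mul_sum]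
    rw [Finset.sum_comm]
    exact Finset.sum_congr rfl fun f _ => Finset.sum_congr rfl fun e _ => by ring
  have h3 : ∑ p, (q p : ℝ) * g p p = ∑ p, (q p : ℝ) * reduced G o g p p
      + ∑ f with IsBridge G.toGraph f, G.m f * ∑ p, (q p : ℝ) * G.farInd o f p := by
    have : ∑ f with IsBridge G.toGraph f, G.m f * ∑ p, (q p : ℝ) * G.farInd o f p
        = ∑ p, (q p : ℝ) * G.bridgeForm o p p := by
      simp only [bridgeForm, farInd_mul_self, Finset.mul_sum]
      rw [Finset.sum_comm]
      exact Finset.sum_congr rfl fun f _ => Finset.sum_congr rfl fun e _ => by ring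
    rw [this, ← Finset.sum_add_distrib]
    exact Finset.sum_congr rfl fun p _ => by rw [reduced]; ring
  have h4 : ∑ f with IsBridge G.toGraph f, G.m f * G.farGenus q o f
      = ∑ f with IsBridge G.toGraph f, G.m f * ∑ e, G.foster g e * G.farInd o f (G.src e)
        + ∑ f with IsBridge G.toGraph f, G.m f * ∑ p, (q p : ℝ) * G.farInd o f p := by
    rw [← Finset.sum_add_distrib]
    refine Finset.sum_congr rfl fun f hf => ?_
    rw [hg.sum_foster_far hc (Finset.mem_filter.1 hf).2, farGenus]
    ring
  rw [h1, h2, h3, h4]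
  ring

end IsVertexGreen

end WeightedGraph

/-! ### The canonical divisor and the types of bridges -/

namespace WeightedGraph

variable {V E : Type*} (G : WeightedGraph V E) [Fintype V] [Fintype E]

lemma sum_valency_mul (φ : V → ℝ) :
    ∑ p, (G.valency p : ℝ) * φ p = ∑ e, (φ (G.src e) + φ (G.tgt e)) := by
  classical
  have h : ∀ s : E → V, ∑ p, (({e | s e = p}.ncard : ℕ) : ℝ) * φ p = ∑ e, φ (s e) := by
    intro s
    rw [← Finset.sum_fiberwise Finset.univ s fun e => φ (s e)]
    refine Finset.sum_congr rfl fun p _ => ?_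
    rw [Finset.sum_congr rfl fun e he => by rw [(Finset.mem_filter.1 he).2], Finset.sum_const,
      nsmul_eq_mul, Set.ncard_eq_toFinset_card']
    congr 2
    simp
  simp only [valency, Nat.cast_add, add_mul, Finset.sum_add_distrib, h]

lemma genusOf_toGraph (q : V → ℕ) : (genusOf q G.toGraph : ℝ)
    = (Fintype.card E : ℝ) - Fintype.card V + 1 + ∑ p, (q p : ℝ) := by
  have h1 : E(G.toGraph) = Set.univ := rfl
  have h2 : V(G.toGraph) = Set.univ := rfl
  simp only [genusOf, h1, h2, Set.ncard_univ, Nat.card_eq_fintype_card]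
  rw [finsum_mem_univ, finsum_eq_sum_of_fintype]
  push_cast
  rfl

/-- The genus of a component after the removal of an edge. -/
lemma genusOf_component (q : V → ℕ) (f : E) (x : V) :
    (genusOf q (component (G.toGraph.deleteEdges {f}) x) : ℝ)
      = genusOf q G.toGraph - G.farGenus q x f := by
  classical
  let S : Set V := {y | Reachable (G.toGraph.deleteEdges {f}) x y}
  have hS : ∀ y, (if y ∈ S then (1 : ℝ) else 0) = 1 - G.farInd x f y := by
    intro y
    simp only [farInd, S, Set.mem_ofPred_eq]
    split_ifs <;> simp
  have hV : V(component (G.toGraph.deleteEdges {f}) x) = S := by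
    ext y
    exact ⟨fun h => h.2, fun h => ⟨Set.mem_univ y, h⟩⟩
  have hE : E(component (G.toGraph.deleteEdges {f}) x) = {e | e ≠ f ∧ G.src e ∈ S} := by
    ext e
    constructor
    · rintro ⟨u, v, ⟨hl, hef⟩, hu, hv⟩
      rcases hl with ⟨rfl, rfl⟩ | ⟨rfl, rfl⟩
      · exact ⟨hef, hu.2⟩
      · exact ⟨hef, hv.2⟩
    · rintro ⟨hef, hs⟩
      exact ⟨_, _, ⟨G.isLink_src_tgt e, hef⟩, ⟨Set.mem_univ _, hs⟩, ⟨Set.mem_univ _,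
        Relation.ReflTransGen.trans hs (G.reachable_step hef)⟩⟩
  have hq : ∑ᶠ p ∈ V(component (G.toGraph.deleteEdges {f}) x), (q p : ℤ)
      = ∑ p, if p ∈ S then (q p : ℤ) else 0 := by
    rw [hV, finsum_mem_def, finsum_eq_sum_of_fintype]
    refine Finset.sum_congr rfl fun p _ => ?_
    simp [Set.indicator_apply]
  have hcV : ((S.ncard : ℕ) : ℝ) = ∑ p, (1 - G.farInd x f p) := by
    simp_rw [← hS]
    rw [Set.ncard_eq_toFinset_card']
    simp
  have hcE : (({e | e ≠ f ∧ G.src e ∈ S}.ncard : ℕ) : ℝ)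
      = ∑ e ∈ Finset.univ.erase f, (1 - G.farInd x f (G.src e)) := by
    simp_rw [← hS]
    rw [Set.ncard_eq_toFinset_card', Finset.sum_boole]
    congr 2
    ext e
    simp
  rw [genusOf, hq, hV, hE]
  push_cast
  rw [hcV, hcE, genusOf_toGraph, farGenus, ← Finset.card_univ, ← Finset.card_univ (α := V),
    ← Finset.card_erase_add_one (Finset.mem_univ f)]
  have h3 : ∑ p, (if p ∈ S then (q p : ℝ) else 0) = ∑ p, (q p : ℝ) * (1 - G.farInd x f p) := by
    refine Finset.sum_congr rfl fun p _ => ?_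
    rw [← hS]; simp
  rw [h3]
  simp only [Finset.sum_sub_distrib, mul_sub, mul_one, Finset.sum_const, nsmul_eq_mul]
  push_cast
  ring

omit [Fintype V] [Fintype E] in
lemma farInd_change (hc : G.PotentialConnected) {f : E} (hf : IsBridge G.toGraph f) (o x : V) :
    G.farInd o f x = G.farInd (G.src f) f x
      + G.farInd (G.src f) f o * (1 - 2 * G.farInd (G.src f) f x) := by
  classical
  have key : ∀ y, G.farInd (G.src f) f y = if Reachable (G.toGraph.deleteEdges {f}) (G.src f) y
    then 0 else 1 := fun y => rfl
  have key' : ∀ y, ¬ Reachable (G.toGraph.deleteEdges {f}) (G.src f) y →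
      Reachable (G.toGraph.deleteEdges {f}) (G.tgt f) y := by
    intro y hy
    by_contra hy'
    have h := farInd_bridge hc y hf
    have h1 : ¬ Reachable (G.toGraph.deleteEdges {f}) y (G.src f) :=
      fun h => hy (reachable_symm h)
    have h2 : ¬ Reachable (G.toGraph.deleteEdges {f}) y (G.tgt f) :=
      fun h => hy' (reachable_symm h)
    rw [farInd, farInd, if_neg h1, if_neg h2] at h
    norm_num at h
  rw [key x, key o, farInd]
  by_cases ho : Reachable (G.toGraph.deleteEdges {f}) (G.src f) o
  · have : Reachable (G.toGraph.deleteEdges {f}) o x ↔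
        Reachable (G.toGraph.deleteEdges {f}) (G.src f) x :=
      ⟨fun h => ho.trans h, fun h => (reachable_symm ho).trans h⟩
    by_cases hx : Reachable (G.toGraph.deleteEdges {f}) (G.src f) x
    · rw [if_pos (this.2 hx), if_pos hx, if_pos ho]; norm_num
    · rw [if_neg (mt this.1 hx), if_neg hx, if_pos ho]; norm_num
  · have ho' := key' o ho
    by_cases hx : Reachable (G.toGraph.deleteEdges {f}) (G.src f) x
    · have : ¬ Reachable (G.toGraph.deleteEdges {f}) o x :=
        fun h => ho (Relation.ReflTransGen.trans hx (reachable_symm h))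
      rw [if_neg this, if_pos hx, if_neg ho]; norm_num
    · have : Reachable (G.toGraph.deleteEdges {f}) o x :=
        (reachable_symm ho').trans (key' x hx)
      rw [if_pos this, if_neg hx, if_neg ho]; norm_num

lemma farGenus_change (hc : G.PotentialConnected) (q : V → ℕ) {f : E}
    (hf : IsBridge G.toGraph f) (o : V) :
    G.farGenus q o f = G.farGenus q (G.src f) f
      + G.farInd (G.src f) f o * (genusOf q G.toGraph - 2 * G.farGenus q (G.src f) f) := by
  classical
  have h := G.farInd_change hc hf o
  rw [genusOf_toGraph, ← Finset.card_univ, ← Finset.card_univ (α := V),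
    ← Finset.card_erase_add_one (Finset.mem_univ f), farGenus]
  simp only [h]
  simp only [farGenus, Finset.sum_add_distrib, mul_add, ← Finset.mul_sum,
    Finset.sum_sub_distrib, Finset.sum_const, nsmul_eq_mul, mul_one]
  have h2 : ∑ p, (q p : ℝ) * (G.farInd (G.src f) f o * (1 - 2 * G.farInd (G.src f) f p))
      = G.farInd (G.src f) f o * (∑ p, (q p : ℝ)
        - 2 * ∑ p, (q p : ℝ) * G.farInd (G.src f) f p) := by
    rw [Finset.mul_sum, ← Finset.sum_sub_distrib, Finset.mul_sum]
    exact Finset.sum_congr rfl fun p _ => by ring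
  rw [h2]
  push_cast
  ring

end WeightedGraph

namespace PolarizedGraph

variable {V E : Type*} (G : PolarizedGraph V E) [Fintype V] [Fintype E]

lemma genus_eq : (G.genus : ℝ)
    = (Fintype.card E : ℝ) - Fintype.card V + 1 + ∑ p, (G.q p : ℝ) :=
  G.genusOf_toGraph G.q

lemma sum_K_mul (φ : V → ℝ) : ∑ p, (G.K p : ℝ) * φ p
    = ∑ e, (φ (G.src e) + φ (G.tgt e)) - 2 * ∑ p, φ p + 2 * ∑ p, (G.q p : ℝ) * φ p := by
  rw [← G.sum_valency_mul, Finset.mul_sum, Finset.mul_sum, ← Finset.sum_sub_distrib,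
    ← Finset.sum_add_distrib]
  refine Finset.sum_congr rfl fun p _ => ?_
  simp only [K]
  push_cast
  ring

lemma sum_K : ∑ p, (G.K p : ℝ) = 2 * G.genus - 2 := by
  have h := G.sum_K_mul fun _ => 1
  simp only [mul_one, Finset.sum_const, nsmul_eq_mul, Finset.card_univ] at h
  rw [h, genus_eq]
  ring

omit [Fintype V] [Fintype E] in
lemma K_nonneg (p : V) : (0 : ℝ) ≤ G.K p := by
  exact_mod_cast G.polarization p

lemma sum_K_far (hc : G.PotentialConnected) (o : V) {f : E} (hf : IsBridge G.toGraph f) :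
    ∑ p, (G.K p : ℝ) * G.farInd o f p = 2 * G.farGenus G.q o f - 1 := by
  classical
  rw [sum_K_mul, ← Finset.add_sum_erase _ _ (Finset.mem_univ f),
    WeightedGraph.farInd_bridge hc o hf, WeightedGraph.farGenus]
  have h : ∑ e ∈ Finset.univ.erase f, (G.farInd o f (G.src e) + G.farInd o f (G.tgt e))
      = ∑ e ∈ Finset.univ.erase f, (G.farInd o f (G.src e) + G.farInd o f (G.src e)) := by
    refine Finset.sum_congr rfl fun e he => ?_
    rw [WeightedGraph.farInd_src_eq_tgt (Finset.ne_of_mem_erase he)]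
  rw [h, Finset.sum_add_distrib]
  ring

lemma farGenus_pos (hc : G.PotentialConnected) (o : V) {f : E} (hf : IsBridge G.toGraph f) :
    0 < G.farGenus G.q o f := by
  have h := G.sum_K_far hc o hf
  have h1 : 0 ≤ ∑ p, (G.K p : ℝ) * G.farInd o f p :=
    Finset.sum_nonneg fun p _ => mul_nonneg (G.K_nonneg p) (G.farInd_nonneg o f p)
  linarith

/-- The average of the genera of the far sides of a bridge. -/
lemma sum_K_farGenus (hc : G.PotentialConnected) {f : E} (hf : IsBridge G.toGraph f) :
    ∑ o, (G.K o : ℝ) * G.farGenus G.q o f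
      = 4 * G.farGenus G.q (G.src f) f * (G.genus - G.farGenus G.q (G.src f) f) - G.genus := by
  have h1 : ∀ o, (G.K o : ℝ) * G.farGenus G.q o f
      = G.K o * G.farGenus G.q (G.src f) f + (G.K o * G.farInd (G.src f) f o)
        * (G.genus - 2 * G.farGenus G.q (G.src f) f) := by
    intro o
    rw [G.farGenus_change hc G.q hf o, genus]; ring
  simp only [h1, Finset.sum_add_distrib, ← Finset.sum_mul]
  rw [G.sum_K_far hc _ hf, G.sum_K]
  ring

open Classical in
/-- A bridge occurs with the weight `4 h (g - h)` in the slope. -/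
lemma sum_isOfType (hc : G.PotentialConnected) (f : E) :
    ∑ h ∈ Finset.Icc 1 (G.genus / 2), 4 * (h : ℝ) * ((G.genus : ℝ) - (h : ℝ))
        * {e | G.IsOfType h e}.indicator G.m f
      = if IsBridge G.toGraph f then
          G.m f * (4 * G.farGenus G.q (G.src f) f * (G.genus - G.farGenus G.q (G.src f) f))
        else 0 := by
  split_ifs with hf
  swap
  · refine Finset.sum_eq_zero fun h _ => ?_
    rw [Set.indicator_of_notMem fun h' => hf h'.1, mul_zero]
  set a := genusOf G.q (component (G.toGraph.deleteEdges {f}) (G.src f)) with ha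
  set b := genusOf G.q (component (G.toGraph.deleteEdges {f}) (G.tgt f)) with hb
  have hfar : G.farInd (G.src f) f (G.tgt f) = 1 := by
    have := WeightedGraph.farInd_bridge hc (G.src f) hf
    rwa [WeightedGraph.farInd_self, zero_add] at this
  have ha' : (a : ℝ) = G.genus - G.farGenus G.q (G.src f) f := G.genusOf_component G.q f _
  have hb' : (b : ℝ) = G.farGenus G.q (G.src f) f := by
    have := G.genusOf_component G.q f (G.tgt f)
    rw [← hb, G.farGenus_change hc G.q hf (G.tgt f), hfar] at this
    rw [this]; ring
  have hb1 : 1 ≤ b := by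
    have := G.farGenus_pos hc (G.src f) hf
    rw [← hb'] at this
    exact_mod_cast this
  have ha1 : 1 ≤ a := by
    have := G.farGenus_pos hc (G.tgt f) hf
    rw [G.farGenus_change hc G.q hf (G.tgt f), hfar] at this
    have h2 : (0 : ℝ) < a := by
      rw [ha']
      have h3 : (genusOf G.q G.toGraph : ℝ) = G.genus := rfl
      rw [h3] at this
      linarith
    exact_mod_cast h2
  have hab : a + b = G.genus := by
    have : (a : ℝ) + b = G.genus := by rw [ha', hb']; ring
    exact_mod_cast this
  have htype : ∀ h : ℤ, G.IsOfType h f ↔ h = a ∨ h = b := by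
    intro h
    constructor
    · rintro ⟨_, x, y, ⟨rfl, rfl⟩ | ⟨rfl, rfl⟩, h1, h2⟩
      · exact Or.inl (by rw [ha, ← h1])
      · exact Or.inr (by rw [hb, ← h1])
    · rintro (rfl | rfl)
      · exact ⟨hf, _, _, G.isLink_src_tgt f, rfl, by rw [← hb]; omega⟩
      · exact ⟨hf, _, _, (G.isLink_src_tgt f).symm, rfl, by rw [← ha]; omega⟩
  rw [← hb', ← hab]
  have hmem : ∀ h ∈ Finset.Icc (1 : ℤ) ((a + b) / 2), h ≠ min a b →
      4 * (h : ℝ) * (((a + b : ℤ) : ℝ) - (h : ℝ)) * {e | G.IsOfType h e}.indicator G.m f = 0 := by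
    intro h hh hne
    rw [Set.indicator_of_notMem, mul_zero]
    intro h'
    rw [Finset.mem_Icc] at hh
    rcases (htype h).1 h' with h1 | h1 <;> omega
  rw [Finset.sum_eq_single (min a b) hmem (fun h => absurd (Finset.mem_Icc.2 (by omega)) h)]
  have hin : f ∈ {e | G.IsOfType (min a b) e} := (htype _).2 (by omega)
  rw [Set.indicator_of_mem hin]
  rcases le_total a b with h | h
  · rw [min_eq_left h]; push_cast; ring
  · rw [min_eq_right h]; push_cast; ring

/-- The slope as a sum of non-negative local contributions, given the evaluation of `λ`. -/
lemma slope_eq (hc : G.PotentialConnected) {g : V → V → V → ℝ}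
    (hg : ∀ o, G.IsVertexGreen o (g o))
    (hl : (8 * (G.genus : ℝ) + 4) * G.lambda = G.genus * G.δ
      + ∑ o, (G.K o : ℝ) * (∑ e, G.minorTerm (g o) e + ∑ p, (G.q p : ℝ) * g o p p)) :
    G.slope = ∑ o, (G.K o : ℝ) *
      (∑ e ∈ G.nonBridges, G.minorTerm (WeightedGraph.IsVertexGreen.reduced G.toWeightedGraph o
          (g o)) e
        + ∑ p, (G.q p : ℝ) *
          WeightedGraph.IsVertexGreen.reduced G.toWeightedGraph o (g o) p p) := by
  classical
  have h1 : ∑ h ∈ Finset.Icc 1 (G.genus / 2), 4 * (h : ℝ) * ((G.genus : ℝ) - (h : ℝ)) * G.δType h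
      = ∑ f with IsBridge G.toGraph f,
        G.m f * (4 * G.farGenus G.q (G.src f) f * (G.genus - G.farGenus G.q (G.src f) f)) := by
    simp only [δType, Finset.mul_sum]
    rw [Finset.sum_comm, Finset.sum_filter]
    exact Finset.sum_congr rfl fun f _ => G.sum_isOfType hc f
  have h2 : G.δ = G.δ₀ + ∑ f with IsBridge G.toGraph f, G.m f := by
    rw [δ, δ₀, Finset.sum_filter, ← Finset.sum_add_distrib]
    refine Finset.sum_congr rfl fun e _ => ?_
    by_cases he : IsBridge G.toGraph e <;> simp [he]
  have h3 : ∑ o, (G.K o : ℝ) * ∑ f with IsBridge G.toGraph f, G.m f * G.farGenus G.q o f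
      = ∑ f with IsBridge G.toGraph f, G.m f *
        (4 * G.farGenus G.q (G.src f) f * (G.genus - G.farGenus G.q (G.src f) f) - G.genus) := by
    simp only [Finset.mul_sum]
    rw [Finset.sum_comm]
    refine Finset.sum_congr rfl fun f hf => ?_
    rw [← G.sum_K_farGenus hc (Finset.mem_filter.1 hf).2, Finset.mul_sum]
    exact Finset.sum_congr rfl fun o _ => by ring
  rw [slope, hl, h1]
  simp only [fun o => (hg o).sum_minorTerm hc G.q, mul_add, Finset.sum_add_distrib]
  rw [h3, h2]
  simp only [mul_sub, Finset.sum_sub_distrib, ← Finset.sum_mul]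
  ring

/-- The vanishing of the slope, given the evaluation of `λ`. -/
lemma slope_eq_zero_iff (hc : G.PotentialConnected) {g : V → V → V → ℝ}
    (hg : ∀ o, G.IsVertexGreen o (g o))
    (hl : (8 * (G.genus : ℝ) + 4) * G.lambda = G.genus * G.δ
      + ∑ o, (G.K o : ℝ) * (∑ e, G.minorTerm (g o) e + ∑ p, (G.q p : ℝ) * g o p p)) :
    G.slope = 0 ↔ ∀ o, G.K o ≠ 0 → G.TightAt G.q o := by
  have hr := fun o => (hg o).isReducedGreen hc
  rw [G.slope_eq hc hg hl, Finset.sum_eq_zero_iff_of_nonneg fun o _ =>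
    mul_nonneg (G.K_nonneg o) ((hr o).contribution_nonneg hc G.q)]
  refine forall_congr' fun o => ?_
  rw [mul_eq_zero, (hr o).contribution_eq_zero_iff hc]
  simp only [Finset.mem_univ, true_implies, Int.cast_eq_zero]
  tauto

end PolarizedGraph

/-! ### The metric graph and its resistance Green's function -/

namespace WeightedGraph

variable {V E : Type*} (G : WeightedGraph V E)

lemma edgePoint_of_nonpos {e : E} {t : ℝ} (ht : t ≤ 0) : G.edgePoint e t = .vertex (G.src e) := by
  rw [edgePoint, dif_neg (fun h => absurd h.1 ht.not_gt), if_pos ht]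

lemma edgePoint_of_ge {e : E} {t : ℝ} (ht : G.m e ≤ t) :
    G.edgePoint e t = .vertex (G.tgt e) := by
  rw [edgePoint, dif_neg (fun h => absurd h.2 ht.not_gt),
    if_neg (not_le.2 ((G.m_pos e).trans_le ht))]

lemma edgePoint_of_mem {e : E} {t : ℝ} (ht : t ∈ Set.Ioo 0 (G.m e)) :
    G.edgePoint e t = .inner e ⟨t, ht⟩ := dif_pos ht

@[simp] lemma edgePoint_zero (e : E) : G.edgePoint e 0 = .vertex (G.src e) :=
  G.edgePoint_of_nonpos le_rfl

@[simp] lemma edgePoint_m (e : E) : G.edgePoint e (G.m e) = .vertex (G.tgt e) :=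
  G.edgePoint_of_ge le_rfl

/-- Points of a closed edge are its end points or inner points. -/
lemma edgePoint_cases {e : E} {P : ℝ → Prop} (h0 : P 0) (h1 : P (G.m e))
    (h : ∀ t, t ∈ Set.Ioo 0 (G.m e) → P t) : ∀ t ∈ Set.Icc 0 (G.m e), P t := by
  rintro t ⟨ht0, ht1⟩
  rcases ht0.eq_or_lt with rfl | ht0
  · exact h0
  rcases ht1.eq_or_lt with rfl | ht1
  · exact h1
  exact h t ⟨ht0, ht1⟩

lemma continuous_edgePoint (e : E) : Continuous (G.edgePoint e) := by
  rw [continuous_iff_coinduced_le]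
  exact le_iSup (fun e : E => TopologicalSpace.coinduced (G.edgePoint e) inferInstance) e

lemma continuous_of_edges {X : Type*} [TopologicalSpace X] {f : G.Point → X}
    (h : ∀ e, Continuous fun t => f (G.edgePoint e t)) : Continuous f := by
  rw [continuous_iSup_dom]
  exact fun e => continuous_coinduced_dom.2 (h e)

lemma edgePoint_projIcc (e : E) (t : ℝ) :
    G.edgePoint e (Set.projIcc 0 (G.m e) (G.m_pos e).le t) = G.edgePoint e t := by
  rcases le_total t 0 with h | h
  · rw [Set.projIcc_of_le_left _ h]; simp [G.edgePoint_of_nonpos h]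
  rcases le_total t (G.m e) with h' | h'
  · rw [Set.projIcc_of_mem _ ⟨h, h'⟩]
  · rw [Set.projIcc_of_right_le _ h']; simp [G.edgePoint_of_ge h']

lemma continuous_of_edges_Icc {X : Type*} [TopologicalSpace X] {f : G.Point → X}
    (h : ∀ e, ContinuousOn (fun t => f (G.edgePoint e t)) (Set.Icc 0 (G.m e))) :
    Continuous f := by
  refine G.continuous_of_edges fun e => ?_
  have := (continuousOn_iff_continuous_domRestrict.1 (h e)).comp
    (continuous_projIcc (h := (G.m_pos e).le))
  refine this.congr fun t => ?_
  simp [edgePoint_projIcc]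

/-- The extension of a function on the vertices that is affine on the edges. -/
def interp (φ : V → ℝ) : G.Point → ℝ
  | .vertex p => φ p
  | .inner e t => φ (G.src e) + t / G.m e * G.diff φ e

lemma interp_edgePoint (φ : V → ℝ) (e : E) : ∀ t ∈ Set.Icc 0 (G.m e),
    G.interp φ (G.edgePoint e t) = φ (G.src e) + t / G.m e * G.diff φ e := by
  have hm := (G.m_pos e).ne'
  refine G.edgePoint_cases ?_ ?_ fun t ht => ?_
  · simp [interp]
  · simp [interp, diff, hm]
  · rw [G.edgePoint_of_mem ht]; rfl

open Classical in
/-- The Green's function of the edges with Dirichlet boundary conditions. -/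
def kink : G.Point → G.Point → ℝ
  | .inner e s, .inner e' t => if e = e' then min (s : ℝ) t - s * t / G.m e else 0
  | .inner _ _, .vertex _ => 0
  | .vertex _, _ => 0

lemma kink_symm (x y : G.Point) : G.kink x y = G.kink y x := by
  rcases x with p | ⟨e, s⟩ <;> rcases y with p' | ⟨e', t⟩ <;> simp only [kink]
  by_cases h : e = e'
  · subst h
    simp [min_comm, mul_comm]
  · simp [h, Ne.symm h]

lemma kink_vertex (x : G.Point) (p : V) : G.kink x (.vertex p) = 0 := by
  cases x <;> rfl

open Classical in
lemma kink_edgePoint (e e' : E) (s : Set.Ioo 0 (G.m e')) : ∀ t ∈ Set.Icc 0 (G.m e),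
    G.kink (G.edgePoint e t) (.inner e' s)
      = if e = e' then min t (s : ℝ) - t * s / G.m e else 0 := by
  have hm := (G.m_pos e).ne'
  refine G.edgePoint_cases ?_ ?_ fun t ht => ?_
  · have := s.2.1.le
    simp [kink, this]
  · by_cases h : e = e'
    · subst h
      have := s.2.2.le
      simp [kink, this, hm]
    · simp [kink, h]
  · rw [G.edgePoint_of_mem ht]; rfl

/-- The extension of a Green's function of the vertex set to all pairs of points. -/
def pointGreen (g : V → V → ℝ) (x y : G.Point) : ℝ :=
  G.interp (fun a => G.interp (fun b => g a b) y) x + G.kink x y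

variable {G} in
lemma pointGreen_symm {g : V → V → ℝ} (hs : ∀ a b, g a b = g b a) (x y : G.Point) :
    G.pointGreen g x y = G.pointGreen g y x := by
  rw [pointGreen, pointGreen, kink_symm]
  congr 1
  rcases x with p | ⟨e, s⟩ <;> rcases y with p' | ⟨e', t⟩ <;> simp only [interp, diff]
  · rw [hs]
  · rw [hs p, hs p]
  · rw [hs _ p', hs _ p']
  · rw [hs (G.src e), hs (G.src e), hs (G.tgt e), hs (G.tgt e)]; ring

lemma pointGreen_vertex (g : V → V → ℝ) (x : G.Point) (p : V) :
    G.pointGreen g x (.vertex p) = G.interp (fun a => g a p) x := by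
  rw [pointGreen, kink_vertex, add_zero]; rfl

lemma continuous_interp (φ : V → ℝ) : Continuous (G.interp φ) := by
  refine G.continuous_of_edges_Icc fun e => ?_
  refine ContinuousOn.congr (f := fun t => φ (G.src e) + t / G.m e * G.diff φ e) ?_
    fun t ht => G.interp_edgePoint φ e t ht
  fun_prop

lemma continuous_kink (y : G.Point) : Continuous fun x => G.kink x y := by
  classical
  refine G.continuous_of_edges_Icc fun e => ?_
  rcases y with p | ⟨e', s⟩
  · simp only [kink_vertex]; fun_prop
  · refine ContinuousOn.congr
      (f := fun t => if e = e' then min t (s : ℝ) - t * s / G.m e else 0) ?_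
      fun t ht => G.kink_edgePoint e e' s t ht
    split_ifs <;> fun_prop

lemma continuous_pointGreen (g : V → V → ℝ) (y : G.Point) :
    Continuous fun x => G.pointGreen g x y :=
  (G.continuous_interp _).add (G.continuous_kink y)

lemma abs_interp_le [Fintype V] (φ : V → ℝ) (x : G.Point) : |G.interp φ x| ≤ ∑ p, |φ p| := by
  have hp : ∀ p, |φ p| ≤ ∑ p, |φ p| := fun p =>
    Finset.single_le_sum (f := fun p => |φ p|) (fun _ _ => abs_nonneg _) (Finset.mem_univ p)
  rcases x with p | ⟨e, t⟩
  · exact hp p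
  · have hm := G.m_pos e
    have h0 : 0 ≤ t / G.m e := div_nonneg t.2.1.le hm.le
    have h1 : t / G.m e ≤ 1 := (div_le_one hm).2 t.2.2.le
    have h2 := abs_le.1 (hp (G.src e))
    have h3 := abs_le.1 (hp (G.tgt e))
    rw [interp, diff, abs_le]
    constructor <;> nlinarith

lemma abs_kink_le [Fintype E] (x y : G.Point) : |G.kink x y| ≤ ∑ e, G.m e := by
  have h0 : 0 ≤ ∑ e, G.m e := Finset.sum_nonneg fun e _ => (G.m_pos e).le
  rcases x with p | ⟨e, s⟩ <;> rcases y with p' | ⟨e', t⟩ <;> simp only [kink, abs_zero, h0]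
  split_ifs with h
  · subst h
    have hm := G.m_pos e
    have hle : G.m e ≤ ∑ e, G.m e :=
      Finset.single_le_sum (fun e _ => (G.m_pos e).le) (Finset.mem_univ e)
    obtain ⟨hs0, hs1⟩ := s.2
    obtain ⟨ht0, ht1⟩ := t.2
    have h3 : (s : ℝ) * t / G.m e ≤ G.m e := by
      rw [div_le_iff₀ hm]; nlinarith
    have h4 : 0 ≤ (s : ℝ) * t / G.m e := by positivity
    have h5 : 0 ≤ min (s : ℝ) t := le_min hs0.le ht0.le
    have h6 : min (s : ℝ) t ≤ G.m e := (min_le_left _ _).trans hs1.le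
    rw [abs_le]
    constructor <;> linarith
  · simpa using h0

lemma exists_bound_pointGreen [Fintype V] [Fintype E] (g : V → V → ℝ) :
    ∃ C, ∀ x y, |G.pointGreen g x y| ≤ C := by
  refine ⟨∑ a, ∑ b, |g a b| + ∑ e, G.m e, fun x y => (abs_add_le _ _).trans ?_⟩
  refine add_le_add ((G.abs_interp_le _ x).trans ?_) (G.abs_kink_le x y)
  exact Finset.sum_le_sum fun a _ => G.abs_interp_le _ y

/-! ### The distributional Laplacian -/

/-- The contribution of an edge of length `m` to the pairing with a Laplacian. -/
def edgePairing (m : ℝ) (f ψ : ℝ → ℝ) : ℝ :=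
  -(∫ t in (0 : ℝ)..m, f t * deriv (deriv ψ) t) - f 0 * deriv ψ 0 + f m * deriv ψ m

lemma laplacianPairing_eq [Fintype E] (f : G.Point → ℝ) (ψ : E → ℝ → ℝ) :
    G.laplacianPairing f ψ
      = ∑ e, edgePairing (G.m e) (fun t => f (G.edgePoint e t)) (ψ e) := by
  simp only [laplacianPairing, edgePairing, edgePoint_zero, edgePoint_m]

section EdgePairing

variable {m : ℝ} {ψ : ℝ → ℝ}

lemma edgePairing_congr (hm : 0 ≤ m) {f h : ℝ → ℝ} (hfh : ∀ t ∈ Set.Icc 0 m, f t = h t) :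
    edgePairing m f ψ = edgePairing m h ψ := by
  unfold edgePairing
  rw [hfh 0 ⟨le_rfl, hm⟩, hfh m ⟨hm, le_rfl⟩, intervalIntegral.integral_congr]
  intro t ht
  rw [Set.uIcc_of_le hm] at ht
  simp only [hfh t ht]

variable (hψ : ContDiff ℝ ∞ ψ)
include hψ

lemma hasDerivAt_test (t : ℝ) : HasDerivAt ψ (deriv ψ t) t :=
  (hψ.differentiable (by simp)).differentiableAt.hasDerivAt

lemma contDiff_deriv_test : ContDiff ℝ ∞ (deriv ψ) :=
  (contDiff_infty_iff_deriv.1 hψ).2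

lemma continuous_deriv_deriv_test : Continuous (deriv (deriv ψ)) :=
  (contDiff_deriv_test (contDiff_deriv_test hψ)).continuous

lemma edgePairing_add (hm : 0 ≤ m) {f h : ℝ → ℝ} (hf : ContinuousOn f (Set.Icc 0 m))
    (hh : ContinuousOn h (Set.Icc 0 m)) :
    edgePairing m (fun t => f t + h t) ψ = edgePairing m f ψ + edgePairing m h ψ := by
  have hc := continuous_deriv_deriv_test hψ
  unfold edgePairing
  simp only [add_mul]
  rw [intervalIntegral.integral_add]
  · ring
  · refine ContinuousOn.intervalIntegrable ?_
    rw [Set.uIcc_of_le hm]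
    exact hf.mul hc.continuousOn
  · refine ContinuousOn.intervalIntegrable ?_
    rw [Set.uIcc_of_le hm]
    exact hh.mul hc.continuousOn

omit hψ in
lemma edgePairing_smul (c : ℝ) (f : ℝ → ℝ) :
    edgePairing m (fun t => c * f t) ψ = c * edgePairing m f ψ := by
  unfold edgePairing
  simp only [mul_assoc, intervalIntegral.integral_const_mul]
  ring

lemma integral_affine_mul (α β a b : ℝ) :
    ∫ t in a..b, (α + β * t) * deriv (deriv ψ) t
      = ((α + β * b) * deriv ψ b - β * ψ b) - ((α + β * a) * deriv ψ a - β * ψ a) := by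
  have hc := continuous_deriv_deriv_test hψ
  refine intervalIntegral.integral_eq_sub_of_hasDerivAt
    (f := fun t => (α + β * t) * deriv ψ t - β * ψ t) (fun t _ => ?_) ?_
  · have h1 := hasDerivAt_test hψ t
    have h2 := hasDerivAt_test (contDiff_deriv_test hψ) t
    have h3 : HasDerivAt (fun t => α + β * t) β t := by
      simpa using ((hasDerivAt_id t).const_mul β).const_add α
    refine ((h3.mul h2).sub (h1.const_mul β)).congr_deriv ?_
    ring
  · exact (Continuous.mul (by fun_prop) hc).intervalIntegrable _ _

lemma edgePairing_affine (α β : ℝ) :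
    edgePairing m (fun t => α + β * t) ψ = β * (ψ m - ψ 0) := by
  rw [edgePairing, integral_affine_mul hψ]
  ring

lemma edgePairing_min {s : ℝ} (hs : s ∈ Set.Icc 0 m) :
    edgePairing m (fun t => min t s) ψ = ψ s - ψ 0 := by
  have hc := continuous_deriv_deriv_test hψ
  have h1 : ∫ t in (0 : ℝ)..s, min t s * deriv (deriv ψ) t
      = ∫ t in (0 : ℝ)..s, (0 + 1 * t) * deriv (deriv ψ) t := by
    refine intervalIntegral.integral_congr fun t ht => ?_
    rw [Set.uIcc_of_le hs.1] at ht
    simp [ht.2]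
  have h2 : ∫ t in s..m, min t s * deriv (deriv ψ) t
      = ∫ t in s..m, (s + 0 * t) * deriv (deriv ψ) t := by
    refine intervalIntegral.integral_congr fun t ht => ?_
    rw [Set.uIcc_of_le hs.2] at ht
    simp [ht.1]
  have hi : ∀ a b, IntervalIntegrable (fun t => min t s * deriv (deriv ψ) t) volume a b :=
    fun a b => (Continuous.mul (by fun_prop) hc).intervalIntegrable _ _
  rw [edgePairing, ← intervalIntegral.integral_add_adjacent_intervals (hi 0 s) (hi s m), h1, h2,
    integral_affine_mul hψ, integral_affine_mul hψ, min_eq_left hs.1, min_eq_right hs.2]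
  ring

lemma edgePairing_kink {s : ℝ} (hs : s ∈ Set.Icc 0 m) :
    edgePairing m (fun t => min t s - t * s / m) ψ = ψ s - ψ 0 - s / m * (ψ m - ψ 0) := by
  have : (fun t : ℝ => min t s - t * s / m) = fun t => min t s + (0 + (-(s / m)) * t) := by
    ext t; ring
  rw [this, edgePairing_add hψ (hs.1.trans hs.2) (by fun_prop) (by fun_prop),
    edgePairing_min hψ hs, edgePairing_affine hψ]
  ring

end EdgePairing

variable {G} in
lemma IsTestFunction.edge [Fintype E] {φ : G.Point → ℝ} {ψ : E → ℝ → ℝ}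
    (h : G.IsTestFunction φ ψ) (e : E) :
    ψ e 0 = φ (.vertex (G.src e)) ∧ ψ e (G.m e) = φ (.vertex (G.tgt e)) := by
  have hm := (G.m_pos e).le
  constructor
  · rw [← (h e).2 0 ⟨le_rfl, hm⟩, edgePoint_zero]
  · rw [← (h e).2 _ ⟨hm, le_rfl⟩, edgePoint_m]

variable {G} in
lemma IsTestFunction.continuous [Fintype E] {φ : G.Point → ℝ} {ψ : E → ℝ → ℝ}
    (h : G.IsTestFunction φ ψ) : Continuous φ := by
  refine G.continuous_of_edges_Icc fun e => ?_
  exact (h e).1.continuous.continuousOn.congr (h e).2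

lemma laplacianPairing_add [Fintype E] {ψ : E → ℝ → ℝ} (hψ : ∀ e, ContDiff ℝ ∞ (ψ e))
    {f h : G.Point → ℝ} (hf : Continuous f) (hh : Continuous h) :
    G.laplacianPairing (fun x => f x + h x) ψ
      = G.laplacianPairing f ψ + G.laplacianPairing h ψ := by
  simp only [laplacianPairing_eq, ← Finset.sum_add_distrib]
  exact Finset.sum_congr rfl fun e _ => edgePairing_add (hψ e) (G.m_pos e).le
    (hf.comp (G.continuous_edgePoint e)).continuousOn
    (hh.comp (G.continuous_edgePoint e)).continuousOn

lemma laplacianPairing_smul [Fintype E] (ψ : E → ℝ → ℝ) (c : ℝ) (f : G.Point → ℝ) :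
    G.laplacianPairing (fun x => c * f x) ψ = c * G.laplacianPairing f ψ := by
  simp only [laplacianPairing_eq, Finset.mul_sum]
  exact Finset.sum_congr rfl fun e _ => edgePairing_smul c _

lemma laplacianPairing_interp [Fintype E] {φ : G.Point → ℝ} {ψ : E → ℝ → ℝ}
    (h : G.IsTestFunction φ ψ) (f : V → ℝ) :
    G.laplacianPairing (G.interp f) ψ
      = G.energyOn Finset.univ f (fun p => φ (.vertex p)) := by
  rw [laplacianPairing_eq, energyOn]
  refine Finset.sum_congr rfl fun e _ => ?_
  rw [edgePairing_congr (G.m_pos e).le (h := fun t => f (G.src e) + (G.diff f e / G.m e) * t)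
    fun t ht => by rw [G.interp_edgePoint f e t ht]; ring, edgePairing_affine (h e).1,
    (h.edge e).1, (h.edge e).2]
  simp only [diff]
  ring

lemma laplacianPairing_kink [Fintype E] {φ : G.Point → ℝ} {ψ : E → ℝ → ℝ}
    (h : G.IsTestFunction φ ψ) (y : G.Point) :
    G.laplacianPairing (fun x => G.kink x y) ψ = φ y - G.interp (fun p => φ (.vertex p)) y := by
  classical
  rw [laplacianPairing_eq]
  rcases y with p | ⟨e', s⟩
  · simp [kink_vertex, edgePairing, interp]
  rw [Finset.sum_eq_single e']
  · rw [edgePairing_congr (G.m_pos e').le (h := fun t => min t (s : ℝ) - t * s / G.m e')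
      fun t ht => by rw [G.kink_edgePoint e' e' s t ht, if_pos rfl],
      edgePairing_kink (h e').1 ⟨s.2.1.le, s.2.2.le⟩, (h.edge e').1, (h.edge e').2,
      ← (h e').2 s ⟨s.2.1.le, s.2.2.le⟩, G.edgePoint_of_mem s.2]
    simp only [interp, diff]
    ring
  · intro e _ he
    rw [edgePairing_congr (G.m_pos e).le (h := fun t => 0 + 0 * t)
      fun t ht => by rw [G.kink_edgePoint e e' s t ht, if_neg he]; ring,
      edgePairing_affine (h e).1]
    ring
  · simp

variable {G} in
/-- The extended Green's function solves `Δ_x j(x, y) = δ_y - δ_o`. -/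
lemma IsVertexGreen.laplacianPairing [Fintype E] {o : V} {g : V → V → ℝ}
    (hg : G.IsVertexGreen o g) {φ : G.Point → ℝ} {ψ : E → ℝ → ℝ} (h : G.IsTestFunction φ ψ)
    (y : G.Point) :
    G.laplacianPairing (fun x => G.pointGreen g x y) ψ = φ y - φ (.vertex o) := by
  unfold pointGreen
  rw [G.laplacianPairing_add (fun e => (h e).1) (G.continuous_interp _) (G.continuous_kink y),
    laplacianPairing_interp G h, laplacianPairing_kink G h]
  have : G.energyOn Finset.univ (fun a => G.interp (fun b => g a b) y) (fun p => φ (.vertex p))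
      = G.interp (fun p => φ (.vertex p)) y - φ (.vertex o) := by
    rcases y with p | ⟨e, t⟩
    · exact hg.energy p _
    · simp only [interp, diff]
      rw [energyOn_add_left, energyOn_smul_left, energyOn_sub_left, hg.energy, hg.energy]
      ring
  rw [this]
  ring

end WeightedGraph

/-! ### Existence and uniqueness of the Green's function of a measure -/

namespace WeightedGraph

variable {V E : Type*} (G : WeightedGraph V E)

instance [Finite V] [Finite E] : CompactSpace G.Point := by
  constructor
  have h : (Set.univ : Set G.Point) = Set.range (fun p : V => (.vertex p : G.Point)) ∪
      ⋃ e, G.edgePoint e '' Set.Icc 0 (G.m e) := by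
    refine (Set.eq_univ_of_forall fun x => ?_).symm
    rcases x with p | ⟨e, t⟩
    · exact Or.inl ⟨p, rfl⟩
    · exact Or.inr (Set.mem_iUnion.2 ⟨e, t, ⟨t.2.1.le, t.2.2.le⟩, G.edgePoint_of_mem t.2⟩)
  rw [h]
  exact (Set.finite_range _).isCompact.union
    (isCompact_iUnion fun e => isCompact_Icc.image (G.continuous_edgePoint e))

lemma integrable_of_continuous [Finite V] [Finite E] (μ : Measure G.Point) [IsFiniteMeasure μ]
    {f : G.Point → ℝ} (hf : Continuous f) : Integrable f μ := by
  obtain ⟨C, hC⟩ := isCompact_univ.exists_bound_of_continuousOn hf.continuousOn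
  exact Integrable.of_bound hf.measurable.aestronglyMeasurable C
    (Filter.Eventually.of_forall fun x => hC x (Set.mem_univ x))

variable [Fintype E]

omit [Fintype E] in
/-- The test functions that are affine on the edges. -/
lemma isTestFunction_interp (φ : V → ℝ) :
    G.IsTestFunction (G.interp φ) fun e t => φ (G.src e) + (G.diff φ e / G.m e) * t := by
  refine fun e => ⟨by fun_prop, fun t ht => ?_⟩
  rw [G.interp_edgePoint φ e t ht]; ring

lemma laplacianPairing_affine (h : G.Point → ℝ) (φ : V → ℝ) :
    G.laplacianPairing h (fun e t => φ (G.src e) + (G.diff φ e / G.m e) * t)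
      = G.energyOn Finset.univ (fun p => h (.vertex p)) φ := by
  rw [laplacianPairing, energyOn]
  refine Finset.sum_congr rfl fun e _ => ?_
  have h1 : deriv (fun t => φ (G.src e) + (G.diff φ e / G.m e) * t)
      = fun _ => G.diff φ e / G.m e := by
    ext t
    simp
  rw [h1]
  simp only [deriv_const', mul_zero, intervalIntegral.integral_zero, diff]
  ring

/-- A smooth function with prescribed second derivative and vanishing at the end points. -/
lemma exists_deriv_deriv_eq {ρ : ℝ → ℝ} (hρ : ContDiff ℝ ∞ ρ) {m : ℝ} (hm : 0 < m) :
    ∃ ψ, ContDiff ℝ ∞ ψ ∧ deriv (deriv ψ) = ρ ∧ ψ 0 = 0 ∧ ψ m = 0 := by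
  have hprim : ∀ {r : ℝ → ℝ}, ContDiff ℝ ∞ r → ContDiff ℝ ∞ (fun t => ∫ s in (0 : ℝ)..t, r s) ∧
      deriv (fun t => ∫ s in (0 : ℝ)..t, r s) = r := by
    intro r hr
    have hd : ∀ t, HasDerivAt (fun t => ∫ s in (0 : ℝ)..t, r s) (r t) t := fun t =>
      intervalIntegral.integral_hasDerivAt_right (hr.continuous.intervalIntegrable _ _)
        (hr.continuous.stronglyMeasurableAtFilter _ _) hr.continuous.continuousAt
    have h2 : deriv (fun t => ∫ s in (0 : ℝ)..t, r s) = r := funext fun t => (hd t).deriv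
    exact ⟨contDiff_infty_iff_deriv.2
      ⟨fun t => (hd t).differentiableAt, by rw [h2]; exact hr⟩, h2⟩
  obtain ⟨h1, h2⟩ := hprim hρ
  obtain ⟨h3, h4⟩ := hprim h1
  set I₁ := fun t => ∫ s in (0 : ℝ)..t, ρ s
  set I₂ := fun t => ∫ s in (0 : ℝ)..t, I₁ s
  have h5 : deriv (fun t => I₂ t - I₂ m / m * t) = fun t => I₁ t - I₂ m / m := by
    ext t
    have : HasDerivAt I₂ (I₁ t) t := by
      rw [← h4]; exact ((h3.differentiable (by simp)) t).hasDerivAt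
    have h6 : HasDerivAt (fun t => I₂ t - I₂ m / m * t) (I₁ t - I₂ m / m * 1) t :=
      this.sub ((hasDerivAt_id t).const_mul (I₂ m / m))
    rw [h6.deriv, mul_one]
  refine ⟨fun t => I₂ t - I₂ m / m * t, by fun_prop, ?_, ?_, ?_⟩
  · rw [h5]
    ext t
    rw [deriv_sub_const, h2]
  · simp [I₂]
  · field_simp; ring

variable {G} in
/-- A continuous function with vanishing distributional Laplacian is constant. -/
lemma IsVertexGreen.eq_of_laplacianPairing_eq_zero {o : V} {g : V → V → ℝ}
    (hg : G.IsVertexGreen o g) {h : G.Point → ℝ} (hh : Continuous h)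
    (h0 : ∀ φ ψ, G.IsTestFunction φ ψ → G.laplacianPairing h ψ = 0) (x : G.Point) :
    h x = h (.vertex o) := by
  classical
  have hvert : ∀ p, h (.vertex p) = h (.vertex o) := by
    intro p
    have h1 := h0 _ _ (G.isTestFunction_interp fun a => g a p)
    rw [laplacianPairing_affine G h (fun a => g a p), energyOn_comm, hg.energy] at h1
    linarith
  rcases x with p | ⟨e, t⟩
  · exact hvert p
  set c := h (.vertex o)
  let u : ℝ → ℝ := fun t => h (G.edgePoint e t) - c
  have hu : Continuous u := (hh.comp (G.continuous_edgePoint e)).sub continuous_const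
  have hu0 : ∀ t, t ∉ Set.Ioc 0 (G.m e) → u t = 0 := by
    intro t ht
    simp only [u]
    rcases le_or_gt t 0 with h1 | h1
    · rw [G.edgePoint_of_nonpos h1, hvert, sub_self]
    · have h2 : G.m e ≤ t := by
        by_contra h3
        exact ht ⟨h1, (not_le.1 h3).le⟩
      rw [G.edgePoint_of_ge h2, hvert, sub_self]
  have hae : ∀ᵐ t ∂(volume : Measure ℝ), u t = 0 := by
    refine ae_eq_zero_of_integral_contDiff_smul_eq_zero hu.locallyIntegrable fun ρ hρ _ => ?_
    obtain ⟨ψ, hψ, hψ2, hψ0, hψm⟩ := exists_deriv_deriv_eq hρ (G.m_pos e)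
    let Ψ : E → ℝ → ℝ := fun e' => if e' = e then ψ else fun _ => 0
    let φ : G.Point → ℝ := fun x => match x with
      | .vertex _ => 0
      | .inner e' s => Ψ e' s
    have hΨ0 : ∀ e', Ψ e' 0 = 0 := fun e' => by
      by_cases he : e' = e <;> simp [Ψ, he, hψ0]
    have hΨm : ∀ e', Ψ e' (G.m e') = 0 := fun e' => by
      by_cases he : e' = e
      · subst he; simp [Ψ, hψm]
      · simp [Ψ, he]
    have htest : G.IsTestFunction φ Ψ := by
      refine fun e' => ⟨?_, ?_⟩
      · by_cases he : e' = e
        · simp only [Ψ, he, if_true]; exact hψ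
        · simp only [Ψ, he, if_false]; fun_prop
      · refine G.edgePoint_cases ?_ ?_ fun s hs => ?_
        · simp [φ, hΨ0]
        · simp [φ, hΨm]
        · rw [G.edgePoint_of_mem hs]
    have hp := h0 φ Ψ htest
    rw [laplacianPairing_eq, Finset.sum_eq_single e ?_ (by simp)] at hp
    · have hΨe : Ψ e = ψ := by simp [Ψ]
      have h1 : edgePairing (G.m e) (fun t => h (G.edgePoint e t)) ψ
          = -∫ t in (0 : ℝ)..G.m e, u t * ρ t := by
        have h2 := edgePairing_affine (m := G.m e) hψ c 0
        have h3 : (fun t => h (G.edgePoint e t)) = fun t => u t + (c + 0 * t) := by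
          ext t; simp [u]
        rw [h3, edgePairing_add hψ (G.m_pos e).le hu.continuousOn (by fun_prop), h2,
          edgePairing, hψ2]
        have h4 : u 0 = 0 := hu0 0 (by simp)
        have h5 : u (G.m e) = 0 := by simp [u, hvert]
        rw [h4, h5]
        ring
      rw [hΨe, h1, neg_eq_zero, intervalIntegral.integral_of_le (G.m_pos e).le,
        setIntegral_eq_integral_of_forall_compl_eq_zero] at hp
      · simp only [smul_eq_mul, mul_comm (ρ _)]; exact hp
      · intro t ht; rw [hu0 t ht, zero_mul]
    · intro e' _ he
      have : Ψ e' = fun _ => 0 := by simp [Ψ, he]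
      rw [this, edgePairing]
      simp
  have hzero := (Continuous.ae_eq_iff_eq volume hu continuous_zero).1 hae
  have := congrFun hzero t
  simp only [u, G.edgePoint_of_mem t.2, Pi.zero_apply] at this
  linarith

/-! ### Potentials of measures -/

/-- The potential of a measure with respect to the extended Green's function. -/
def potential (g : V → V → ℝ) (μ : Measure G.Point) (y : G.Point) : ℝ :=
  ∫ x, G.pointGreen g x y ∂μ

variable [Fintype V] {G} {o : V} {g : V → V → ℝ} (μ : Measure G.Point) [IsProbabilityMeasure μ]

namespace IsVertexGreen

variable (hg : G.IsVertexGreen o g)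
include hg

omit [Fintype V] in
lemma continuous_pointGreen_right (x : G.Point) : Continuous fun y => G.pointGreen g x y := by
  simp_rw [pointGreen_symm hg.symm x]
  exact G.continuous_pointGreen g x

lemma continuous_potential : Continuous (G.potential g μ) := by
  refine G.continuous_of_edges fun e => ?_
  obtain ⟨C, hC⟩ := G.exists_bound_pointGreen g
  refine continuous_of_dominated (bound := fun _ => C) (fun t => ?_) (fun t => ?_)
    (integrable_const C) (Filter.Eventually.of_forall fun x => ?_)
  · exact (G.continuous_pointGreen g _).measurable.aestronglyMeasurable
  · exact Filter.Eventually.of_forall fun x => hC _ _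
  · exact (hg.continuous_pointGreen_right x).comp (G.continuous_edgePoint e)

/-- The potential of `μ` solves `Δ J = μ - δ_o`. -/
lemma laplacianPairing_potential {φ : G.Point → ℝ} {ψ : E → ℝ → ℝ}
    (h : G.IsTestFunction φ ψ) :
    G.laplacianPairing (G.potential g μ) ψ = ∫ x, φ x ∂μ - φ (.vertex o) := by
  obtain ⟨C, hC⟩ := G.exists_bound_pointGreen g
  have hint : ∀ y, Integrable (fun x => G.pointGreen g x y) μ := fun y =>
    G.integrable_of_continuous μ (G.continuous_pointGreen g y)
  have hprod : ∀ e, Integrable (Function.uncurry fun (t : ℝ) (x : G.Point) =>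
      G.pointGreen g x (G.edgePoint e t) * deriv (deriv (ψ e)) t)
      ((volume.restrict (Set.Ioc 0 (G.m e))).prod μ) := by
    intro e
    have hc := continuous_deriv_deriv_test (h e).1
    have h1 : Integrable (fun z : ℝ × G.Point => deriv (deriv (ψ e)) z.1)
        ((volume.restrict (Set.Ioc 0 (G.m e))).prod μ) := by
      have h2 : Integrable (deriv (deriv (ψ e))) (volume.restrict (Set.Ioc 0 (G.m e))) :=
        (hc.integrableOn_Icc).mono_set Set.Ioc_subset_Icc_self
      exact h2.comp_fst μ
    refine h1.bdd_mul (c := C) ?_ (Filter.Eventually.of_forall fun z => hC _ _)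
    exact (stronglyMeasurable_uncurry_of_continuous_of_stronglyMeasurable
      (u := fun (t : ℝ) (x : G.Point) => G.pointGreen g x (G.edgePoint e t))
      (fun x => (hg.continuous_pointGreen_right x).comp (G.continuous_edgePoint e))
      fun t => (G.continuous_pointGreen g _).measurable.stronglyMeasurable).aestronglyMeasurable
  have hswap : ∀ e, ∫ t in (0 : ℝ)..G.m e,
      G.potential g μ (G.edgePoint e t) * deriv (deriv (ψ e)) t
      = ∫ x, (∫ t in (0 : ℝ)..G.m e, G.pointGreen g x (G.edgePoint e t)
        * deriv (deriv (ψ e)) t) ∂μ := by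
    intro e
    simp only [intervalIntegral.integral_of_le (G.m_pos e).le, potential]
    rw [← integral_integral_swap (hprod e)]
    simp only [integral_mul_const]
  have hint2 : ∀ e, Integrable (fun x => ∫ t in (0 : ℝ)..G.m e,
      G.pointGreen g x (G.edgePoint e t) * deriv (deriv (ψ e)) t) μ := by
    intro e
    simp only [intervalIntegral.integral_of_le (G.m_pos e).le]
    exact (hprod e).integral_prod_right
  have hpt : ∀ x, G.laplacianPairing (fun y => G.pointGreen g x y) ψ
      = φ x - φ (.vertex o) := by
    intro x
    simp_rw [pointGreen_symm hg.symm x]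
    exact hg.laplacianPairing h x
  have hφ : Integrable φ μ := G.integrable_of_continuous μ h.continuous
  have h2 : ∫ x, φ x ∂μ - φ (.vertex o) = ∫ x, (φ x - φ (.vertex o)) ∂μ := by
    rw [integral_sub hφ (integrable_const _)]; simp
  rw [h2]
  simp_rw [← hpt]
  simp only [WeightedGraph.laplacianPairing]
  rw [integral_finsetSum]
  · refine Finset.sum_congr rfl fun e _ => ?_
    rw [integral_add, integral_sub, integral_neg, hswap]
    · simp only [integral_mul_const, potential]
    · exact (hint2 e).neg
    · exact (hint _).mul_const _
    · exact (hint2 e).neg.sub ((hint _).mul_const _)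
    · exact (hint _).mul_const _
  · exact fun e _ => ((hint2 e).neg.sub ((hint _).mul_const _)).add ((hint _).mul_const _)

variable (g) in
omit hg in
/-- The Green's function of the probability measure `μ`. -/
def greenOf (x y : G.Point) : ℝ :=
  G.pointGreen g x y - G.potential g μ x - G.potential g μ y + ∫ z, G.potential g μ z ∂μ

lemma integrable_potential : Integrable (G.potential g μ) μ :=
  G.integrable_of_continuous μ (hg.continuous_potential μ)

lemma isGreenFunction_greenOf : G.IsGreenFunction μ (greenOf g μ) := by
  have hJ := hg.continuous_potential μ
  refine ⟨fun y => ?_, fun y φ ψ h => ?_, fun y => ?_⟩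
  · exact (((G.continuous_pointGreen g y).sub hJ).sub continuous_const).add continuous_const
  · have h1 : (fun x => greenOf g μ x y) = fun x => G.pointGreen g x y
        + ((-1) * G.potential g μ x + (G.interp
          fun _ => -G.potential g μ y + ∫ z, G.potential g μ z ∂μ) x) := by
      ext x
      have h2 : (G.interp fun _ => -G.potential g μ y + ∫ z, G.potential g μ z ∂μ) x
          = -G.potential g μ y + ∫ z, G.potential g μ z ∂μ := by
        rcases x with p | ⟨e, t⟩ <;> simp [interp, diff]
      rw [h2, greenOf]; ring
    have hc1 : Continuous fun x => (-1) * G.potential g μ x := continuous_const.mul hJ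
    have hc2 := G.continuous_interp fun _ => -G.potential g μ y + ∫ z, G.potential g μ z ∂μ
    have hc3 : Continuous fun x => (-1) * G.potential g μ x + (G.interp
        fun _ => -G.potential g μ y + ∫ z, G.potential g μ z ∂μ) x := hc1.add hc2
    rw [h1, G.laplacianPairing_add (fun e => (h e).1) (G.continuous_pointGreen g y) hc3,
      G.laplacianPairing_add (fun e => (h e).1) hc1 hc2,
      hg.laplacianPairing h, laplacianPairing_smul, hg.laplacianPairing_potential μ h,
      laplacianPairing_interp G h,
      integral_dirac' _ _ h.continuous.measurable.stronglyMeasurable]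
    simp only [energyOn, diff, sub_self, zero_mul, zero_div, Finset.sum_const_zero]
    ring
  · have h1 := G.integrable_of_continuous μ (G.continuous_pointGreen g y)
    have h2 := hg.integrable_potential μ
    have h3 : ∫ x, greenOf g μ x y ∂μ = ∫ x, G.pointGreen g x y ∂μ - ∫ x, G.potential g μ x ∂μ
        - G.potential g μ y + ∫ z, G.potential g μ z ∂μ := by
      have h4 : Integrable (fun x => G.pointGreen g x y - G.potential g μ x) μ := h1.sub h2
      have h5 : Integrable (fun x => G.pointGreen g x y - G.potential g μ x
          - G.potential g μ y) μ := h4.sub (integrable_const _)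
      unfold greenOf
      rw [integral_add h5 (integrable_const _), integral_sub h4 (integrable_const _),
        integral_sub h1 h2]
      simp
    rw [h3]
    simp [potential]

/-- Uniqueness of the Green's function. -/
lemma eq_greenOf {γ : G.Point → G.Point → ℝ} (hγ : G.IsGreenFunction μ γ) :
    γ = greenOf g μ := by
  have hG := hg.isGreenFunction_greenOf μ
  funext x y
  let d : G.Point → ℝ := fun x => γ x y + (-1) * greenOf g μ x y
  have hc : Continuous fun x => (-1) * greenOf g μ x y := continuous_const.mul (hG.continuous y)
  have hd : Continuous d := (hγ.continuous y).add hc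
  have h0 : ∀ x, d x = d (.vertex o) := by
    refine hg.eq_of_laplacianPairing_eq_zero hd fun φ ψ h => ?_
    rw [G.laplacianPairing_add (fun e => (h e).1) (hγ.continuous y) hc, laplacianPairing_smul,
      hγ.laplacian y φ ψ h, hG.laplacian y φ ψ h]
    ring
  have h1 : ∫ x, d x ∂μ = 0 := by
    simp only [d]
    rw [integral_add (G.integrable_of_continuous μ (hγ.continuous y))
      ((G.integrable_of_continuous μ (hG.continuous y)).const_mul _), integral_const_mul,
      hγ.integral_eq_zero, hG.integral_eq_zero]
    simp
  simp only [h0, integral_const, probReal_univ, one_smul] at h1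
  have h2 := h0 x
  rw [h1] at h2
  simp only [d] at h2
  linarith

end IsVertexGreen

end WeightedGraph

namespace PolarizedGraph

open WeightedGraph

/-! ### The admissible measure -/

variable {V E : Type*} (G : PolarizedGraph V E) [Fintype V] [Fintype E]

/-- The functional `∑ q(p) f(p) + ½ ∑ F(e) (f(src e) + f(tgt e))`, that is, `g` times the integral
of the affine extension of `f` against the admissible measure. -/
def vertexIntegral (g : V → V → ℝ) (f : V → ℝ) : ℝ :=
  ∑ p, (G.q p : ℝ) * f p + 1 / 2 * ∑ e, G.foster g e * (f (G.src e) + f (G.tgt e))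

/-- Zhang's formula for the admissible measure, in terms of Foster coefficients. -/
def zhangMeasure (g : V → V → ℝ) : Measure G.Point :=
  ∑ p, ENNReal.ofReal (G.q p / G.genus) • Measure.dirac (.vertex p) +
  ∑ e, ENNReal.ofReal (G.foster g e / (G.genus * G.m e)) •
    (volume.restrict (Set.Ioc 0 (G.m e))).map (G.edgePoint e)

/-- The restriction to the vertices of the function `x ↦ j(x, x) + ∑ K(p) j(p, x)`. -/
def adjVertex (g : V → V → ℝ) (a : V) : ℝ := g a a + ∑ p, (G.K p : ℝ) * g p a

/-- The function `x ↦ j(x, x) + ∑ K(p) j(p, x)` on the metric graph. It is `2 g` times the potential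
of the admissible measure. -/
def adj (g : V → V → ℝ) (x : G.Point) : ℝ :=
  G.pointGreen g x x + ∑ p, (G.K p : ℝ) * G.pointGreen g (.vertex p) x

variable {G} {o : V} {g : V → V → ℝ} (hg : G.IsVertexGreen o g)

section
include hg

lemma vertexIntegral_green (a : V) : G.vertexIntegral g (fun p => g p a) = G.adjVertex g a / 2 := by
  rw [vertexIntegral, hg.diag_eq a, adjVertex, G.sum_K_mul]
  ring

lemma adjVertex_ground : G.adjVertex g o = 0 := by
  simp [adjVertex, hg.ground']

omit [Fintype V] in
lemma pointGreen_diag (e : E) : ∀ t ∈ Set.Icc 0 (G.m e),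
    G.pointGreen g (G.edgePoint e t) (G.edgePoint e t)
      = g (G.src e) (G.src e) + t / G.m e * G.diff (fun a => g a a) e
        + G.foster g e * (t - t ^ 2 / G.m e) := by
  have hm := (G.m_pos e).ne'
  refine G.edgePoint_cases ?_ ?_ fun t ht => ?_
  · rw [edgePoint_zero, pointGreen_vertex]
    simp [interp]
  · rw [edgePoint_m, pointGreen_vertex]
    simp only [interp, diff]
    field_simp
    ring
  · rw [G.edgePoint_of_mem ht]
    simp only [pointGreen, interp, kink, diff, foster, edgeRes, if_true, min_self]
    rw [hg.symm (G.tgt e) (G.src e)]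
    field_simp
    ring

lemma adj_edgePoint (e : E) : ∀ t ∈ Set.Icc 0 (G.m e),
    G.adj g (G.edgePoint e t) = G.adjVertex g (G.src e) + t / G.m e * G.diff (G.adjVertex g) e
        + G.foster g e * (t - t ^ 2 / G.m e) := by
  intro t ht
  rw [adj, pointGreen_diag hg e t ht]
  simp_rw [fun p => pointGreen_symm hg.symm (.vertex p) (G.edgePoint e t), pointGreen_vertex,
    G.interp_edgePoint _ e t ht]
  simp only [adjVertex, diff, mul_add, Finset.sum_add_distrib, mul_sub, Finset.sum_sub_distrib]
  simp_rw [fun p a => hg.symm p a]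
  have : ∀ c : ℝ, ∀ a, ∑ p, (G.K p : ℝ) * (c * g p a) = c * ∑ p, (G.K p : ℝ) * g p a := by
    intro c a
    rw [Finset.mul_sum]
    exact Finset.sum_congr rfl fun p _ => by ring
  rw [this, this]
  ring

omit [Fintype E] hg in
lemma adj_vertex (p : V) : G.adj g (.vertex p) = G.adjVertex g p := by
  simp only [adj, pointGreen_vertex]
  rfl

lemma isTestFunction_adj : G.IsTestFunction (G.adj g) fun e t =>
    G.adjVertex g (G.src e) + t / G.m e * G.diff (G.adjVertex g) e
        + G.foster g e * (t - t ^ 2 / G.m e) :=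
  fun e => ⟨by fun_prop, adj_edgePoint hg e⟩

end

lemma integral_affine_add_parabola (m a b c : ℝ) (hm : m ≠ 0) :
    ∫ t in (0 : ℝ)..m, (a + t / m * (b - a) + c * (t - t ^ 2 / m))
      = m * ((a + b) / 2) + c * m ^ 2 / 6 := by
  have h : ∀ t ∈ Set.uIcc 0 m, HasDerivAt
      (fun t => a * t + t ^ 2 / (2 * m) * (b - a) + c * (t ^ 2 / 2 - t ^ 3 / (3 * m)))
      (a + t / m * (b - a) + c * (t - t ^ 2 / m)) t := by
    intro t _
    have h1 := (hasDerivAt_id t).const_mul a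
    have h2 := ((hasDerivAt_pow 2 t).div_const (2 * m)).mul_const (b - a)
    have h3 := (((hasDerivAt_pow 2 t).div_const 2).sub
      ((hasDerivAt_pow 3 t).div_const (3 * m))).const_mul c
    refine ((h1.add h2).add h3).congr_deriv ?_
    push_cast
    field_simp
  rw [intervalIntegral.integral_eq_sub_of_hasDerivAt h
    (Continuous.intervalIntegrable (by fun_prop) _ _)]
  field_simp
  ring

section Measure

variable (hγ : 0 < G.genus)
include hγ

include hg in
lemma isProbabilityMeasure_zhangMeasure : IsProbabilityMeasure (G.zhangMeasure g) := by
  have h0 : (0 : ℝ) < G.genus := by exact_mod_cast hγ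
  constructor
  have h1 : ∀ e, ((volume.restrict (Set.Ioc 0 (G.m e))).map (G.edgePoint e)) Set.univ
      = ENNReal.ofReal (G.m e) := by
    intro e
    rw [Measure.map_apply (G.continuous_edgePoint e).measurable MeasurableSet.univ]
    simp
  have h2 : ∀ e, ENNReal.ofReal (G.foster g e / (G.genus * G.m e)) * ENNReal.ofReal (G.m e)
      = ENNReal.ofReal (G.foster g e / G.genus) := by
    intro e
    have hm := G.m_pos e
    rw [← ENNReal.ofReal_mul (div_nonneg (hg.foster_nonneg e) (by positivity))]
    congr 1
    field_simp
  simp only [zhangMeasure, Measure.coe_add, Measure.coe_finsetSum, Pi.add_apply,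
    Finset.sum_apply, Measure.smul_apply, smul_eq_mul, measure_univ, mul_one, h1, h2]
  rw [← ENNReal.ofReal_sum_of_nonneg fun p _ => by positivity,
    ← ENNReal.ofReal_sum_of_nonneg fun e _ => div_nonneg (hg.foster_nonneg e) h0.le,
    ← ENNReal.ofReal_add (Finset.sum_nonneg fun p _ => by positivity)
      (Finset.sum_nonneg fun e _ => div_nonneg (hg.foster_nonneg e) h0.le),
    ← Finset.sum_div, ← Finset.sum_div, ← add_div, hg.sum_foster, add_comm, ← G.genus_eq,
    div_self h0.ne', ENNReal.ofReal_one]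

include hg in
lemma integral_zhangMeasure {f : G.Point → ℝ} (hf : Continuous f) :
    ∫ x, f x ∂(G.zhangMeasure g) = (∑ p, (G.q p : ℝ) * f (.vertex p)
      + ∑ e, G.foster g e / G.m e * ∫ t in (0 : ℝ)..G.m e, f (G.edgePoint e t)) / G.genus := by
  have h0 : (0 : ℝ) < G.genus := by exact_mod_cast hγ
  have hi1 : ∀ p ∈ (Finset.univ : Finset V), Integrable f (ENNReal.ofReal (G.q p / G.genus) •
      (Measure.dirac (.vertex p) : Measure G.Point)) := fun p _ =>
    (G.integrable_of_continuous _ hf).smul_measure ENNReal.ofReal_ne_top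
  have hi2 : ∀ e ∈ (Finset.univ : Finset E), Integrable f
      (ENNReal.ofReal (G.foster g e / (G.genus * G.m e)) •
      (volume.restrict (Set.Ioc 0 (G.m e))).map (G.edgePoint e)) := fun e _ =>
    (G.integrable_of_continuous _ hf).smul_measure ENNReal.ofReal_ne_top
  rw [zhangMeasure, integral_add_measure (integrable_finsetSum_measure.2 hi1)
    (integrable_finsetSum_measure.2 hi2), integral_finsetSum_measure hi1,
    integral_finsetSum_measure hi2, add_div, Finset.sum_div, Finset.sum_div]
  congr 1
  · refine Finset.sum_congr rfl fun p _ => ?_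
    rw [integral_smul_measure, integral_dirac' _ _ hf.measurable.stronglyMeasurable,
      ENNReal.toReal_ofReal (by positivity), smul_eq_mul]
    ring
  · refine Finset.sum_congr rfl fun e _ => ?_
    have hm := G.m_pos e
    rw [integral_smul_measure, integral_map (G.continuous_edgePoint e).measurable.aemeasurable
      hf.measurable.aestronglyMeasurable,
      ENNReal.toReal_ofReal (div_nonneg (hg.foster_nonneg e) (by positivity)), smul_eq_mul,
      intervalIntegral.integral_of_le hm.le]
    field_simp

include hg in
lemma potential_zhangMeasure (y : G.Point) :
    G.potential g (G.zhangMeasure g) y = G.adj g y / (2 * G.genus) := by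
  have h0 : (0 : ℝ) < G.genus := by exact_mod_cast hγ
  have hint : ∀ (φ : V → ℝ) (e : E), ∫ t in (0 : ℝ)..G.m e, G.interp φ (G.edgePoint e t)
      = G.m e * ((φ (G.src e) + φ (G.tgt e)) / 2) := by
    intro φ e
    have h1 := integral_affine_add_parabola (G.m e) (φ (G.src e)) (φ (G.tgt e)) 0 (G.m_pos e).ne'
    rw [zero_mul, zero_div, add_zero] at h1
    rw [← h1]
    refine intervalIntegral.integral_congr fun t ht => ?_
    rw [Set.uIcc_of_le (G.m_pos e).le] at ht
    simp only [G.interp_edgePoint φ e t ht, diff]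
    ring
  have hvert : ∀ φ : V → ℝ, ∑ p, (G.q p : ℝ) * φ p
      + ∑ e, G.foster g e / G.m e * (G.m e * ((φ (G.src e) + φ (G.tgt e)) / 2))
      = G.vertexIntegral g φ := by
    intro φ
    rw [vertexIntegral, Finset.mul_sum]
    congr 1
    refine Finset.sum_congr rfl fun e _ => ?_
    have := (G.m_pos e).ne'
    field_simp
  rw [potential, integral_zhangMeasure hg hγ (G.continuous_pointGreen g y)]
  rcases y with b | ⟨e', s⟩
  · simp only [pointGreen_vertex, hint]
    simp only [interp]
    rw [hvert fun a => g a b, vertexIntegral_green hg, adj_vertex]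
    field_simp
  · set φ : V → ℝ := fun a => G.interp (fun b => g a b) (.inner e' s) with hφ
    have hs : (s : ℝ) ∈ Set.Icc 0 (G.m e') := ⟨s.2.1.le, s.2.2.le⟩
    have hm := (G.m_pos e').ne'
    have hk : ∀ e, ∫ t in (0 : ℝ)..G.m e, G.pointGreen g (G.edgePoint e t) (.inner e' s)
        = G.m e * ((φ (G.src e) + φ (G.tgt e)) / 2)
          + ∫ t in (0 : ℝ)..G.m e, G.kink (G.edgePoint e t) (.inner e' s) := by
      intro e
      rw [← hint, ← intervalIntegral.integral_add]
      · rfl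
      · exact ((G.continuous_interp _).comp (G.continuous_edgePoint e)).intervalIntegrable _ _
      · exact ((G.continuous_kink _).comp (G.continuous_edgePoint e)).intervalIntegrable _ _
    have hk0 : ∀ e, e ≠ e' →
        ∫ t in (0 : ℝ)..G.m e, G.kink (G.edgePoint e t) (.inner e' s) = 0 := by
      intro e he
      rw [intervalIntegral.integral_congr (g := fun _ => (0 : ℝ))]
      · simp
      · intro t ht
        rw [Set.uIcc_of_le (G.m_pos e).le] at ht
        simp only [G.kink_edgePoint e e' s t ht, he, if_false]
    have hk1 : ∫ t in (0 : ℝ)..G.m e', G.kink (G.edgePoint e' t) (.inner e' s)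
        = s * (G.m e' - s) / 2 := by
      have hψ : ContDiff ℝ ∞ fun t : ℝ => t ^ 2 / 2 := by fun_prop
      have hd : deriv (fun t : ℝ => t ^ 2 / 2) = fun t => t := by
        ext t; simp
      have h1 := edgePairing_kink (m := G.m e') hψ hs
      rw [edgePairing, hd] at h1
      simp only [deriv_id'', mul_one] at h1
      rw [intervalIntegral.integral_congr (g := fun t => min t (s : ℝ) - t * s / G.m e')]
      · have h2 : min (G.m e') (s : ℝ) - G.m e' * s / G.m e' = 0 := by
          rw [min_eq_right hs.2]; field_simp; ring
        rw [h2] at h1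
        generalize (∫ t in (0 : ℝ)..G.m e', (min t (s : ℝ) - t * s / G.m e')) = I at h1 ⊢
        have h3 : (s : ℝ) / G.m e' * (G.m e' ^ 2 / 2 - 0 ^ 2 / 2) = s * G.m e' / 2 := by
          field_simp; ring
        rw [h3] at h1
        linarith
      · intro t ht
        rw [Set.uIcc_of_le (G.m_pos e').le] at ht
        simp only [G.kink_edgePoint e' e' s t ht, if_true]
    have hsum : ∑ e, G.foster g e / G.m e *
        ∫ t in (0 : ℝ)..G.m e, G.pointGreen g (G.edgePoint e t) (.inner e' s)
        = ∑ e, G.foster g e / G.m e * (G.m e * ((φ (G.src e) + φ (G.tgt e)) / 2))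
          + G.foster g e' / G.m e' * (s * (G.m e' - s) / 2) := by
      simp only [hk, mul_add, Finset.sum_add_distrib]
      congr 1
      rw [Finset.sum_eq_single e' (fun e _ he => by rw [hk0 e he, mul_zero]) (by simp), hk1]
    have hlin : G.vertexIntegral g φ = G.vertexIntegral g (fun a => g a (G.src e'))
        + s / G.m e' * (G.vertexIntegral g (fun a => g a (G.tgt e'))
          - G.vertexIntegral g (fun a => g a (G.src e'))) := by
      simp only [vertexIntegral, hφ, interp, diff]
      have h1 : ∀ p, (G.q p : ℝ) * (g p (G.src e') + s / G.m e' * (g p (G.tgt e')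
          - g p (G.src e'))) = (G.q p : ℝ) * g p (G.src e')
          + s / G.m e' * ((G.q p : ℝ) * g p (G.tgt e') - (G.q p : ℝ) * g p (G.src e')) := by
        intro p; ring
      have h2 : ∀ e, G.foster g e * (g (G.src e) (G.src e') + s / G.m e' * (g (G.src e) (G.tgt e')
          - g (G.src e) (G.src e')) + (g (G.tgt e) (G.src e') + s / G.m e' * (g (G.tgt e) (G.tgt e')
          - g (G.tgt e) (G.src e'))))
          = G.foster g e * (g (G.src e) (G.src e') + g (G.tgt e) (G.src e'))
          + s / G.m e' * (G.foster g e * (g (G.src e) (G.tgt e') + g (G.tgt e) (G.tgt e'))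
            - G.foster g e * (g (G.src e) (G.src e') + g (G.tgt e) (G.src e'))) := by
        intro e; ring
      simp only [h1, h2, Finset.sum_add_distrib, ← Finset.mul_sum, Finset.sum_sub_distrib]
      ring
    have hv : (.inner e' s : G.Point) = G.edgePoint e' s := (G.edgePoint_of_mem s.2).symm
    have hφv : ∀ p, G.pointGreen g (.vertex p) (.inner e' s) = φ p := fun p => by
      simp only [pointGreen, interp, kink, add_zero, hφ]
    rw [hsum, ← add_assoc]
    simp only [hφv]
    rw [hvert, hlin, vertexIntegral_green hg, vertexIntegral_green hg, hv,
      adj_edgePoint hg e' s hs]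
    simp only [diff]
    field_simp

end Measure

end PolarizedGraph

namespace PolarizedGraph

open WeightedGraph WeightedGraph.IsVertexGreen

/-! ### Evaluation of the invariant `λ` -/

variable {V E : Type*} {G : PolarizedGraph V E} [Fintype V] [Fintype E]
  {o : V} {g : V → V → ℝ} (hg : G.IsVertexGreen o g)

lemma greenOf_add_sum (μ : Measure G.Point) (x : G.Point) :
    greenOf g μ x x + ∑ p, (G.K p : ℝ) * greenOf g μ (.vertex p) x
      = G.adj g x - 2 * G.genus * G.potential g μ x
        + ((2 * G.genus - 1) * ∫ z, G.potential g μ z ∂μ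
          - ∑ p, (G.K p : ℝ) * G.potential g μ (.vertex p)) := by
  simp only [greenOf, adj, mul_add, mul_sub, Finset.sum_add_distrib, Finset.sum_sub_distrib,
    ← Finset.sum_mul, G.sum_K]
  ring

section
include hg

lemma isAdmissibleMeasure_zhangMeasure (hγ : 0 < G.genus) :
    G.IsAdmissibleMeasure (G.zhangMeasure g) := by
  have h0 : (0 : ℝ) < G.genus := by exact_mod_cast hγ
  have := isProbabilityMeasure_zhangMeasure hg hγ
  refine ⟨this, greenOf g _, hg.isGreenFunction_greenOf _,
    (2 * G.genus - 1) * ∫ z, G.potential g (G.zhangMeasure g) z ∂(G.zhangMeasure g)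
      - ∑ p, (G.K p : ℝ) * G.potential g (G.zhangMeasure g) (.vertex p), fun x => ?_⟩
  rw [greenOf_add_sum, potential_zhangMeasure hg hγ]
  rw [mul_div_cancel₀ _ (by positivity), sub_self, zero_add]

lemma potential_of_isAdmissible (hγ : 0 < G.genus) {μ : Measure G.Point} [IsProbabilityMeasure μ]
    (hμ : G.IsAdmissibleMeasure μ) (x : G.Point) :
    G.potential g μ x = G.adj g x / (2 * G.genus) := by
  have h0 : (0 : ℝ) < G.genus := by exact_mod_cast hγ
  obtain ⟨-, γ, hγ, c, hc⟩ := hμ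
  rw [hg.eq_greenOf μ hγ] at hc
  have h1 := hc x
  have h2 := hc (.vertex o)
  rw [greenOf_add_sum] at h1 h2
  have h3 : G.potential g μ (.vertex o) = 0 := by
    have : ∀ x, G.pointGreen g x (.vertex o) = 0 := by
      intro x
      rw [pointGreen_vertex]
      rcases x with p | ⟨e, t⟩ <;> simp [interp, diff, hg.ground']
    simp [potential, this]
  rw [adj_vertex, adjVertex_ground hg, h3] at h2
  rw [eq_div_iff (by positivity)]
  linarith

lemma integral_of_isAdmissible (hγ : 0 < G.genus) {μ : Measure G.Point} [IsProbabilityMeasure μ]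
    (hμ : G.IsAdmissibleMeasure μ) {φ : G.Point → ℝ} {ψ : E → ℝ → ℝ}
    (h : G.IsTestFunction φ ψ) : ∫ x, φ x ∂μ = ∫ x, φ x ∂(G.zhangMeasure g) := by
  have := isProbabilityMeasure_zhangMeasure hg hγ
  have h1 := hg.laplacianPairing_potential μ h
  have h2 := hg.laplacianPairing_potential (G.zhangMeasure g) h
  have h3 : G.potential g μ = G.potential g (G.zhangMeasure g) := by
    funext x
    rw [potential_of_isAdmissible hg hγ hμ, potential_zhangMeasure hg hγ]
  rw [h3] at h1
  linarith

/-- The integral of the function `adj`, that is, essentially of the potential, against the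
admissible measure. -/
lemma integral_adj (hγ : 0 < G.genus) {μ : Measure G.Point} [IsProbabilityMeasure μ]
    (hμ : G.IsAdmissibleMeasure μ) : G.genus * ∫ x, G.adj g x ∂μ
      = G.vertexIntegral g (G.adjVertex g) + ∑ e, G.foster g e ^ 2 * G.m e / 6 := by
  have h0 : (0 : ℝ) < G.genus := by exact_mod_cast hγ
  rw [integral_of_isAdmissible hg hγ hμ (isTestFunction_adj hg),
    integral_zhangMeasure hg hγ (isTestFunction_adj hg).continuous, mul_div_cancel₀ _ h0.ne',
    vertexIntegral, Finset.mul_sum, add_assoc, ← Finset.sum_add_distrib]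
  simp only [adj_vertex]
  congr 1
  refine Finset.sum_congr rfl fun e _ => ?_
  have hm := (G.m_pos e).ne'
  rw [intervalIntegral.integral_congr (g := fun t => G.adjVertex g (G.src e) + t / G.m e *
    (G.adjVertex g (G.tgt e) - G.adjVertex g (G.src e)) + G.foster g e * (t - t ^ 2 / G.m e)),
    integral_affine_add_parabola _ _ _ _ hm]
  · field_simp
  · intro t ht
    rw [Set.uIcc_of_le (G.m_pos e).le] at ht
    exact adj_edgePoint hg e t ht

/-- The diagonal of the Green's function, summed over the canonical divisor. -/
lemma vertexIntegral_adjVertex : G.vertexIntegral g (G.adjVertex g)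
    = G.vertexIntegral g (fun p => g p p)
      + (∑ p, (G.K p : ℝ) * g p p + ∑ p, (G.K p : ℝ) * ∑ p', (G.K p' : ℝ) * g p' p) / 2 := by
  have h1 : G.vertexIntegral g (G.adjVertex g) = G.vertexIntegral g (fun p => g p p)
      + ∑ p, (G.K p : ℝ) * G.vertexIntegral g (fun x => g x p) := by
    have h2 : ∀ p, (G.K p : ℝ) * G.vertexIntegral g (fun x => g x p)
        = ∑ x, (G.q x : ℝ) * (G.K p * g p x) + 1 / 2 * ∑ e, G.foster g e *
          (G.K p * g p (G.src e) + G.K p * g p (G.tgt e)) := by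
      intro p
      rw [vertexIntegral, mul_add, Finset.mul_sum, mul_left_comm, Finset.mul_sum (a := (G.K p : ℝ))]
      congr 1
      · exact Finset.sum_congr rfl fun x _ => by rw [hg.symm x p]; ring
      · congr 1
        exact Finset.sum_congr rfl fun e _ => by
          rw [hg.symm _ p, hg.symm (G.tgt e) p]; ring
    simp only [h2]
    rw [Finset.sum_add_distrib, Finset.sum_comm, ← Finset.mul_sum,
      Finset.sum_comm (s := Finset.univ (α := V)) (t := Finset.univ (α := E))]
    simp only [vertexIntegral, adjVertex, mul_add, Finset.sum_add_distrib, Finset.mul_sum]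
    ring
  rw [h1]
  simp only [vertexIntegral_green hg, adjVertex]
  rw [← Finset.sum_add_distrib, Finset.sum_div]
  congr 1
  exact Finset.sum_congr rfl fun p _ => by ring

/-- The relation between the tau constant and the minor terms. -/
lemma three_mul_vertexIntegral_diag :
    3 * G.vertexIntegral g (fun p => g p p) + 1 / 2 * ∑ e, G.foster g e ^ 2 * G.m e
      = 2 * (∑ e, G.minorTerm g e + ∑ p, (G.q p : ℝ) * g p p)
        + 1 / 2 * ∑ p, (G.K p : ℝ) * g p p + 1 / 2 * G.δ := by
  have hs := hg.sum_slopes fun p => g p p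
  rw [hg.ground, sub_zero] at hs
  rw [G.sum_K_mul, ← hs, vertexIntegral, δ]
  have h : 3 * (1 / 2 * ∑ e, G.foster g e * (g (G.src e) (G.src e) + g (G.tgt e) (G.tgt e)))
      + 1 / 2 * ∑ e, G.foster g e ^ 2 * G.m e
      = 2 * ∑ e, G.minorTerm g e
        + 1 / 2 * (∑ e, (g (G.src e) (G.src e) + g (G.tgt e) (G.tgt e))
          - 2 * ∑ e, (g (G.src e) (G.src e) * (g (G.src e) (G.src e) - g (G.src e) (G.tgt e))
              / G.m e + g (G.tgt e) (G.tgt e) * (g (G.tgt e) (G.tgt e) - g (G.src e) (G.tgt e))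
              / G.m e))
        + 1 / 2 * ∑ e, G.m e := by
    simp only [Finset.mul_sum, ← Finset.sum_add_distrib, ← Finset.sum_sub_distrib]
    refine Finset.sum_congr rfl fun e _ => ?_
    have hm := (G.m_pos e).ne'
    simp only [foster, minorTerm, edgeRes]
    field_simp
    ring
  linarith

/-- The invariant `λ` in terms of the Green's function grounded at `o`. -/
lemma lambda_eq (hγ : 0 < G.genus) :
    (8 * (G.genus : ℝ) + 4) * G.lambda = G.genus * G.δ
      + 2 * (G.genus - 1) * (∑ e, G.minorTerm g e + ∑ p, (G.q p : ℝ) * g p p)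
      + (G.genus - 1) * ∑ p, (G.K p : ℝ) * g p p
      - ∑ p, (G.K p : ℝ) * ∑ p', (G.K p' : ℝ) * g p' p := by
  have h0 : (0 : ℝ) < G.genus := by exact_mod_cast hγ
  have hμ : G.IsAdmissibleMeasure G.admissibleMeasure :=
    Classical.epsilon_spec ⟨_, isAdmissibleMeasure_zhangMeasure hg hγ⟩
  have := hμ.1
  have hgr : G.IsGreenFunction G.admissibleMeasure G.admissibleGreen :=
    Classical.epsilon_spec (p := G.IsGreenFunction G.admissibleMeasure)
      ⟨_, hg.isGreenFunction_greenOf _⟩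
  have hgr' := hg.eq_greenOf _ hgr
  set μ := G.admissibleMeasure
  have hJ := potential_of_isAdmissible hg hγ hμ
  -- express everything by the energy `I` of `μ` and the sums `D`, `Θ`; `hA` then determines `I`
  set I := ∫ z, G.potential g μ z ∂μ with hI
  have hJint := hg.integrable_potential μ
  have hIadj : ∫ x, G.adj g x ∂μ = 2 * G.genus * I := by
    rw [hI, ← integral_const_mul]
    congr 1
    ext x
    rw [hJ]
    field_simp
  have hA := integral_adj hg hγ hμ
  rw [hIadj, vertexIntegral_adjVertex hg] at hA
  set D := ∑ p, (G.K p : ℝ) * g p p with hD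
  set Θ := ∑ p, (G.K p : ℝ) * ∑ p', (G.K p' : ℝ) * g p' p with hΘ
  have hP : ∑ p, (G.K p : ℝ) * G.potential g μ (.vertex p) = (D + Θ) / (2 * G.genus) := by
    rw [hD, hΘ, ← Finset.sum_add_distrib, Finset.sum_div]
    refine Finset.sum_congr rfl fun p _ => ?_
    rw [hJ, adj_vertex, adjVertex]
    ring
  have hdiag : ∫ x, G.pointGreen g x x ∂μ = 2 * G.genus * I - (D + Θ) / (2 * G.genus) := by
    have h1 : ∀ p, Integrable (fun x => (G.K p : ℝ) * G.pointGreen g (.vertex p) x) μ := fun p =>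
      (G.integrable_of_continuous μ (hg.continuous_pointGreen_right _)).const_mul _
    have h2 : ∀ x, G.pointGreen g x x
        = G.adj g x - ∑ p, (G.K p : ℝ) * G.pointGreen g (.vertex p) x := by
      intro x; rw [adj]; ring
    simp_rw [h2]
    rw [integral_sub (G.integrable_of_continuous μ (isTestFunction_adj hg).continuous)
      (integrable_finsetSum _ fun p _ => h1 p), integral_finsetSum _ fun p _ => h1 p, hIadj, ← hP]
    congr 1
    refine Finset.sum_congr rfl fun p _ => ?_
    rw [integral_const_mul, potential]
    simp_rw [fun x => pointGreen_symm hg.symm x (.vertex p)]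
  have hdint : Integrable (fun x => G.pointGreen g x x) μ := by
    have h2 : (fun x => G.pointGreen g x x)
        = fun x => G.adj g x - ∑ p, (G.K p : ℝ) * G.pointGreen g (.vertex p) x := by
      ext x; rw [adj]; ring
    rw [h2]
    exact G.integrable_of_continuous μ ((isTestFunction_adj hg).continuous.sub
      (continuous_finsetSum _ fun p _ => continuous_const.mul (hg.continuous_pointGreen_right _)))
  -- the integral and the sum over the canonical divisor of the diagonal of the Green's function
  have hX : ∫ x, G.admissibleGreen x x ∂μ = (2 * G.genus - 1) * I - (D + Θ) / (2 * G.genus) := by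
    have h1 : ∀ x, G.admissibleGreen x x = G.pointGreen g x x - 2 * G.potential g μ x + I := by
      intro x; rw [hgr', greenOf]; ring
    have h2 : Integrable (fun x => 2 * G.potential g μ x) μ := hJint.const_mul 2
    have h3 : Integrable (fun x => G.pointGreen g x x - 2 * G.potential g μ x) μ := hdint.sub h2
    simp_rw [h1]
    rw [integral_add h3 (integrable_const _), integral_sub hdint h2, hdiag, integral_const_mul,
      ← hI]
    simp only [integral_const, probReal_univ, one_smul]
    ring
  have hY : ∑ p, (G.K p : ℝ) * G.admissibleGreen (.vertex p) (.vertex p)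
      = D - (D + Θ) / G.genus + (2 * G.genus - 2) * I := by
    have h1 : ∀ p, (G.K p : ℝ) * G.admissibleGreen (.vertex p) (.vertex p) = (G.K p : ℝ) * g p p
        - 2 * ((G.K p : ℝ) * G.potential g μ (.vertex p)) + G.K p * I := by
      intro p
      rw [hgr', greenOf, pointGreen_vertex]
      simp only [interp]
      ring
    simp only [h1, Finset.sum_add_distrib, Finset.sum_sub_distrib, ← Finset.mul_sum, hP,
      ← Finset.sum_mul, G.sum_K]
    rw [← hD]
    field_simp
  have hT := three_mul_vertexIntegral_diag hg
  rw [← Finset.sum_div] at hA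
  rw [← hD] at hT
  rw [lambda, φ, ε, hX, hY]
  have h21 : (2 * (G.genus : ℝ) + 1) ≠ 0 := by positivity
  have hI' : I = (G.vertexIntegral g (fun p => g p p) + (D + Θ) / 2
      + (∑ e, G.foster g e ^ 2 * G.m e) / 6) / (2 * G.genus ^ 2) := by
    rw [← hA]; field_simp
  have hV : G.vertexIntegral g (fun p => g p p) = (2 * (∑ e, G.minorTerm g e
      + ∑ p, (G.q p : ℝ) * g p p) + 1 / 2 * D + 1 / 2 * G.δ
      - 1 / 2 * ∑ e, G.foster g e ^ 2 * G.m e) / 3 := by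
    rw [← hT]; ring
  rw [hI', hV]
  field_simp
  ring

end

/-- The invariant `λ` as a sum of local contributions: the average of `lambda_eq` over the canonical
divisor. -/
lemma lambda_eq_sum (hγ : 2 ≤ G.genus) {g : V → V → V → ℝ} (hg : ∀ o, G.IsVertexGreen o (g o)) :
    (8 * (G.genus : ℝ) + 4) * G.lambda = G.genus * G.δ
      + ∑ o, (G.K o : ℝ) * (∑ e, G.minorTerm (g o) e + ∑ p, (G.q p : ℝ) * g o p p) := by
  have h2 : (2 : ℝ) ≤ G.genus := by exact_mod_cast hγ
  have hl := fun o => lambda_eq (hg o) (by omega)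
  -- effective resistances between vertices
  have hr : ∀ o x, g o x x = g x o o := by
    intro o x
    have := (hg o).change_ground (hg x) x o
    simp only [(hg o).ground', (hg x).ground] at this
    linarith
  have hr' : ∀ o x y, 2 * g o x y = g o x x + g o y y - g x y y := by
    intro o x y
    have := (hg o).change_ground (hg x) x y
    simp only [(hg x).ground] at this
    linarith
  set θ := ∑ o, (G.K o : ℝ) * ∑ p, (G.K p : ℝ) * g o p p with hθ
  have hΘ : ∀ o, 2 * ∑ p, (G.K p : ℝ) * ∑ p', (G.K p' : ℝ) * g o p' p
      = 2 * (2 * G.genus - 2) * ∑ p, (G.K p : ℝ) * g o p p - θ := by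
    intro o
    have h1 : ∀ p p', 2 * ((G.K p : ℝ) * ((G.K p' : ℝ) * g o p' p))
        = (G.K p * (G.K p' * g o p' p') + G.K p' * (G.K p * g o p p))
          - G.K p * (G.K p' * g p p' p') := by
      intro p p'
      have := hr' o p' p
      rw [← hr p' p, mul_left_comm, mul_left_comm (2 : ℝ), this]
      ring
    simp only [Finset.mul_sum, h1, Finset.sum_add_distrib, Finset.sum_sub_distrib, hθ]
    simp only [← Finset.mul_sum, ← Finset.sum_mul, G.sum_K]
    ring
  -- average over `o`; the remaining sums cancel because the total mass of `K` is `2 g - 2`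
  have hsum : ∑ o, (G.K o : ℝ) * ((8 * (G.genus : ℝ) + 4) * G.lambda) = ∑ o, (G.K o : ℝ) *
      (G.genus * G.δ
      + 2 * (G.genus - 1) * (∑ e, G.minorTerm (g o) e + ∑ p, (G.q p : ℝ) * g o p p)
      + (- (G.genus - 1) * ∑ p, (G.K p : ℝ) * g o p p + θ / 2)) := by
    refine Finset.sum_congr rfl fun o _ => ?_
    rw [hl o]
    have := hΘ o
    congr 1
    linarith
  rw [← Finset.sum_mul, G.sum_K] at hsum
  simp only [mul_add (G.K _ : ℝ), Finset.sum_add_distrib, ← Finset.sum_mul, G.sum_K,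
    mul_left_comm (G.K _ : ℝ) (2 * ((G.genus : ℝ) - 1)), mul_left_comm (G.K _ : ℝ)
    (- ((G.genus : ℝ) - 1)), ← Finset.mul_sum] at hsum
  rw [← hθ] at hsum
  have h3 : (2 * (G.genus : ℝ) - 2) ≠ 0 := by linarith
  apply mul_left_cancel₀ h3
  rw [hsum]
  simp only [mul_add (G.K _ : ℝ), Finset.sum_add_distrib]
  ring

/-- The slope vanishes if and only if every vertex in the support of the canonical divisor is
tight. -/
theorem slope_eq_zero_iff_tightAt (hc : Connected G.toGraph) (hγ : 2 ≤ G.genus) :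
    G.slope = 0 ↔ ∀ o, G.K o ≠ 0 → G.TightAt G.q o := by
  have hp := G.potentialConnected hc
  choose g hg using G.exists_isVertexGreen hp
  exact G.slope_eq_zero_iff hp hg (lambda_eq_sum hγ hg)

end PolarizedGraph

/-! ### Graphs all of whose vertices are tight -/

namespace WeightedGraph

variable {V E : Type*} (G : WeightedGraph V E) [Fintype V] [Fintype E]

/-- A subgraph with at least as many edges as vertices carries a non-trivial flow. -/
lemma exists_flow_of_card_le (F : Finset E) (S : Finset V) (hS : S.Nonempty)
    (hF : ∀ e ∈ F, G.src e ∈ S ∧ G.tgt e ∈ S) (hcard : S.card ≤ F.card) :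
    ∃ c, G.IsFlow c ∧ c ≠ 0 ∧ ∀ e, e ∉ F → c e = 0 := by
  classical
  obtain ⟨s, hs⟩ := hS
  let L : (F → ℝ) →ₗ[ℝ] ({x // x ∈ S.erase s} → ℝ) :=
    LinearMap.pi fun x => ∑ e : F, G.diff (Pi.single x.1 1) e.1 • LinearMap.proj e
  have hlt : Module.finrank ℝ ({x // x ∈ S.erase s} → ℝ) < Module.finrank ℝ (F → ℝ) := by
    rw [Module.finrank_fintype_fun_eq_card, Module.finrank_fintype_fun_eq_card,
      Fintype.card_coe, Fintype.card_coe]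
    exact lt_of_lt_of_le (Finset.card_erase_lt_of_mem hs) hcard
  obtain ⟨d, hd, hd0⟩ := (Submodule.ne_bot_iff _).1
    (LinearMap.ker_ne_bot_of_finrank_lt (f := L) hlt)
  let c : E → ℝ := fun e => if h : e ∈ F then d ⟨e, h⟩ else 0
  have hc0 : ∀ e, e ∉ F → c e = 0 := fun e he => dif_neg he
  have hcd : ∀ e : F, c e = d e := fun e => dif_pos e.2
  -- the boundary of `c`
  have hsum : ∀ φ : V → ℝ, ∑ e, c e * G.diff φ e = ∑ e : F, d e * G.diff φ e := by
    intro φ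
    rw [← Finset.sum_subset (Finset.subset_univ F) fun e _ he => by rw [hc0 e he, zero_mul],
      ← Finset.sum_coe_sort]
    exact Finset.sum_congr rfl fun e _ => by rw [hcd]
  have hb : ∀ x, x ≠ s → ∑ e, c e * G.diff (Pi.single x 1) e = 0 := by
    intro x hx
    by_cases hxS : x ∈ S
    · have h1 := congrFun hd ⟨x, Finset.mem_erase.2 ⟨hx, hxS⟩⟩
      simp only [L, LinearMap.pi_apply, LinearMap.sum_apply, LinearMap.smul_apply,
        LinearMap.proj_apply, smul_eq_mul, Pi.zero_apply] at h1
      rw [hsum, ← h1]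
      exact Finset.sum_congr rfl fun e _ => mul_comm _ _
    · refine Finset.sum_eq_zero fun e _ => ?_
      by_cases he : e ∈ F
      · have h1 : G.src e ≠ x := fun h => hxS (h ▸ (hF e he).1)
        have h2 : G.tgt e ≠ x := fun h => hxS (h ▸ (hF e he).2)
        simp [diff, h1, h2]
      · rw [hc0 e he, zero_mul]
  refine ⟨c, fun φ => ?_, fun h0 => hd0 ?_, hc0⟩
  · have h1 : ∀ e, G.diff φ e = ∑ x, (φ x - φ s) * G.diff (Pi.single x 1) e := by
      intro e
      simp [diff, mul_sub, Finset.sum_sub_distrib, Pi.single_apply]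
    simp_rw [h1, Finset.mul_sum]
    rw [Finset.sum_comm]
    refine Finset.sum_eq_zero fun x _ => ?_
    by_cases hx : x = s
    · simp [hx]
    · rw [← mul_zero (φ x - φ s), ← hb x hx, Finset.mul_sum]
      exact Finset.sum_congr rfl fun e _ => by ring
  · ext e
    rw [← hcd, h0]
    rfl

variable {G}

omit [Fintype V] in
/-- Distinct vertices that are not separated by a bridge are not joined by bridges. -/
lemma not_bridgeEquiv (hc : G.PotentialConnected) {x y : V} (hxy : x ≠ y)
    (h : ∀ f, IsBridge G.toGraph f → G.farInd x f y = 0) : ¬ G.BridgeEquiv x y := by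
  classical
  intro hs
  let φ : V → ℝ := Pi.single x 1
  -- correct the indicator function of `x` along the bridges
  have key := hs (fun z => φ z - ∑ f with IsBridge G.toGraph f,
    G.diff φ f * G.diff (G.farInd x f) f * G.farInd x f z) (fun f hf => by
      rw [diff_sub, diff_sum, Finset.sum_eq_single f]
      · rw [diff_smul, mul_assoc, diff_farInd_mul_self hc x hf, mul_one, sub_self]
      · intro e _ hef
        rw [diff_smul, G.diff_farInd_of_ne x hef.symm, mul_zero]
      · intro h'
        exact absurd (Finset.mem_filter.2 ⟨Finset.mem_univ f, hf⟩) h')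
  have h1 : ∑ f with IsBridge G.toGraph f,
      G.diff φ f * G.diff (G.farInd x f) f * G.farInd x f y = 0 :=
    Finset.sum_eq_zero fun f hf => by rw [h f (Finset.mem_filter.1 hf).2, mul_zero]
  simp only [farInd_self, mul_zero, Finset.sum_const_zero, h1, φ] at key
  simp [hxy.symm] at key

omit [Fintype V] [Fintype E] in
lemma bridgeEquiv_iff_of_no_bridge (hb : ∀ f, ¬ IsBridge G.toGraph f) {x y : V} :
    G.BridgeEquiv x y ↔ x = y := by
  classical
  refine ⟨fun h => ?_, fun h φ _ => by rw [h]⟩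
  by_contra hxy
  have := h (Pi.single x 1) fun f hf => absurd hf (hb f)
  simp [Ne.symm hxy] at this

omit [Fintype V] in
lemma tightAt_of_loops_and_bridges (hc : G.PotentialConnected)
    (h : ∀ e, G.src e = G.tgt e ∨ IsBridge G.toGraph e) (q : V → ℕ) (o : V) : G.TightAt q o := by
  have hs : ∀ x y, G.BridgeEquiv x y := by
    intro x y φ hφ
    refine hc φ (fun e => ?_) x y
    rcases h e with he | he
    · rw [diff, he, sub_self]
    · exact hφ e he
  exact ⟨fun p _ => hs p o, fun c _ hav => funext fun e => hav e (Or.inl (hs _ _))⟩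

/-- A flow that lives on one side of a bridge, provided that the valencies are at least two. -/
lemma exists_flow_far (hc : G.PotentialConnected) (hval : ∀ p, 2 ≤ G.valency p) (o : V) {f : E}
    (hf : IsBridge G.toGraph f) : ∃ c, G.IsFlow c ∧ c ≠ 0 ∧
      ∀ e, c e ≠ 0 → G.farInd o f (G.src e) = 1 ∧ G.farInd o f (G.tgt e) = 1 := by
  classical
  let S : Finset V := Finset.univ.filter fun x => G.farInd o f x = 1
  let F : Finset E := (Finset.univ.erase f).filter fun e => G.farInd o f (G.src e) = 1
  have hind : ∀ x, G.farInd o f x = if G.farInd o f x = 1 then 1 else 0 := by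
    intro x
    rcases G.farInd_eq_zero_or o f x with h | h <;> simp [h]
  have hScard : (S.card : ℝ) = ∑ x, G.farInd o f x := by
    rw [Finset.sum_congr rfl fun x _ => hind x]
    simp [S]
  have hFcard : (F.card : ℝ) = ∑ e ∈ Finset.univ.erase f, G.farInd o f (G.src e) := by
    rw [Finset.sum_congr rfl fun e _ => hind (G.src e), Finset.sum_boole]
  have hle : (S.card : ℝ) < F.card + 1 := by
    have h1 := G.sum_valency_mul (G.farInd o f)
    have h2 : ∑ p, 2 * G.farInd o f p ≤ ∑ p, (G.valency p : ℝ) * G.farInd o f p :=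
      Finset.sum_le_sum fun p _ => mul_le_mul_of_nonneg_right (by exact_mod_cast hval p)
        (G.farInd_nonneg o f p)
    have h3 : ∑ e ∈ Finset.univ.erase f, (G.farInd o f (G.src e) + G.farInd o f (G.tgt e))
        = ∑ e ∈ Finset.univ.erase f, (G.farInd o f (G.src e) + G.farInd o f (G.src e)) := by
      refine Finset.sum_congr rfl fun e he => ?_
      rw [farInd_src_eq_tgt (Finset.ne_of_mem_erase he)]
    rw [h1, ← Finset.add_sum_erase _ _ (Finset.mem_univ f), farInd_bridge hc o hf, h3,
      Finset.sum_add_distrib, ← hFcard, ← Finset.mul_sum, ← hScard] at h2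
    linarith
  have hle' : S.card ≤ F.card := by
    have : S.card < F.card + 1 := by exact_mod_cast hle
    omega
  have hSne : S.Nonempty := by
    have h1 := farInd_bridge hc o hf
    rcases G.farInd_eq_zero_or o f (G.src f) with h | h
    · exact ⟨G.tgt f, by simp only [S, Finset.mem_filter, Finset.mem_univ, true_and]; linarith⟩
    · exact ⟨G.src f, by simp only [S, Finset.mem_filter, Finset.mem_univ, true_and]; exact h⟩
  have hFe : ∀ e ∈ F, G.farInd o f (G.src e) = 1 ∧ G.farInd o f (G.tgt e) = 1 := by
    intro e he
    obtain ⟨h1, h2⟩ := Finset.mem_filter.1 he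
    exact ⟨h2, by rw [farInd_src_eq_tgt (Finset.ne_of_mem_erase h1), h2]⟩
  obtain ⟨c, h1, h2, h3⟩ := G.exists_flow_of_card_le F S hSne (fun e he => by
    simpa [S] using hFe e he) hle'
  exact ⟨c, h1, h2, fun e he => hFe e (by_contra fun h => he (h3 e h))⟩

/-- If all vertices are tight and some edge is neither a loop nor a bridge, then there are no vertex
genera, no bridges and no loops, and there are only two vertices. -/
lemma banana_of_tightAt (hc : G.PotentialConnected) {q : V → ℕ}
    (hK : ∀ p, 0 ≤ (G.valency p : ℤ) - 2 + 2 * (q p : ℤ))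
    (hgen : (2 : ℝ) ≤ Fintype.card E - Fintype.card V + 1 + ∑ p, (q p : ℝ))
    (ht : ∀ o, G.TightAt q o) {e₀ : E} (hloop : G.src e₀ ≠ G.tgt e₀)
    (hbr : ¬ IsBridge G.toGraph e₀) :
    (∀ p, q p = 0) ∧ (∀ e, G.src e ≠ G.tgt e) ∧
      ∀ x, x = G.src e₀ ∨ x = G.tgt e₀ := by
  classical
  have hne : ∀ f, IsBridge G.toGraph f → e₀ ≠ f := fun f hf h => hbr (h ▸ hf)
  have hab : ¬ G.BridgeEquiv (G.src e₀) (G.tgt e₀) :=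
    not_bridgeEquiv hc hloop fun f hf => by
      rw [farInd_src_eq_tgt (hne f hf), farInd_self]
  have hq : ∀ p, q p = 0 := fun p => by
    by_contra hp
    exact hab (((ht _).1 p hp).symm.trans ((ht _).1 p hp))
  have hval : ∀ p, 2 ≤ G.valency p := fun p => by
    have := hK p
    rw [hq p] at this
    omega
  have hnb : ∀ f, ¬ IsBridge G.toGraph f := by
    intro f hf
    set χ := G.farInd (G.src e₀) f with hχ
    obtain ⟨c, hfl, hc0, hsupp⟩ := exists_flow_far hc hval (G.src e₀) hf
    have hχa : χ (G.src e₀) = 0 := G.farInd_self _ _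
    have hχb : χ (G.tgt e₀) = 0 := by rw [hχ, farInd_src_eq_tgt (hne f hf), ← hχ, hχa]
    -- a class that meets both sides of the bridge contains its end points
    have key : ∀ o, χ o = 0 → ∀ φ, G.BridgeConstant φ → φ o = φ (G.src f) := by
      intro o ho φ hφ
      have h1 : ¬ ∀ e, G.TouchesClass e o → c e = 0 := fun h => hc0 ((ht o).2 c hfl h)
      push Not at h1
      obtain ⟨e, hte, hce⟩ := h1
      obtain ⟨x, hx1, hxo⟩ : ∃ x, χ x = 1 ∧ G.BridgeEquiv x o := by
        rcases hte with h | h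
        · exact ⟨_, (hsupp e hce).1, h⟩
        · exact ⟨_, (hsupp e hce).2, h⟩
      have h2 := hxo (fun z => if χ z = 1 then φ (G.src f) else φ z) fun f' hf' => by
        have h3 := hφ f' hf'
        by_cases hff : f' = f
        · subst hff
          rw [diff, sub_eq_zero] at h3
          simp only [diff, h3]
          split_ifs <;> simp
        · have h4 := farInd_src_eq_tgt (G := G) (o := G.src e₀) hff
          rw [← hχ] at h4
          simp only [diff, h4]
          split_ifs
          · simp
          · exact h3
      simpa [hx1, ho] using h2.symm
    exact hab fun φ hφ => by rw [key _ hχa φ hφ, key _ hχb φ hφ]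
  have hequiv : ∀ {x y : V}, G.BridgeEquiv x y ↔ x = y := bridgeEquiv_iff_of_no_bridge hnb
  have hnl : ∀ e, G.src e ≠ G.tgt e := by
    intro e he
    obtain ⟨o, ho⟩ : ∃ o, G.src e ≠ o := by
      by_contra h
      push Not at h
      exact hloop ((h _).symm.trans (h _))
    have h1 := (ht o).2 (Pi.single e 1) (fun φ => by
      rw [Finset.sum_eq_single e (fun f _ hf => by simp [hf]) (by simp), diff, he, sub_self,
        mul_zero]) fun f hf => by
      refine Pi.single_eq_of_ne (fun h => ?_) _
      subst h
      rcases hf with h | h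
      · exact ho (hequiv.1 h)
      · exact ho (he.trans (hequiv.1 h))
    have h2 := congrFun h1 e
    simp at h2
  refine ⟨hq, hnl, ?_⟩
  -- every vertex misses at most `#V - 2` edges; otherwise these edges would carry a flow
  let F : V → Finset E := fun o => Finset.univ.filter fun e => ¬ (G.src e = o ∨ G.tgt e = o)
  have hF : ∀ o, (F o).card + 2 ≤ Fintype.card V := by
    intro o
    by_contra hlt
    have hS : (Finset.univ.erase o).card = Fintype.card V - 1 := by
      rw [Finset.card_erase_of_mem (Finset.mem_univ o), Finset.card_univ]
    have hSne : (Finset.univ.erase o : Finset V).Nonempty := by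
      by_cases h : G.src e₀ = o
      · exact ⟨G.tgt e₀, by simp [← h, Ne.symm hloop]⟩
      · exact ⟨G.src e₀, by simp [h]⟩
    obtain ⟨c, h1, h2, h3⟩ := G.exists_flow_of_card_le (F o) (Finset.univ.erase o) hSne
      (fun e he => by simpa [F] using he) (by omega)
    refine h2 ((ht o).2 c h1 fun e he => h3 e fun hF => ?_)
    simp only [F, Finset.mem_filter, Finset.mem_univ, true_and] at hF
    exact hF (he.imp hequiv.1 hequiv.1)
  have hsum : ∑ o, (F o).card + 2 * Fintype.card E = Fintype.card V * Fintype.card E := by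
    have h1 : ∀ o, (F o).card + (Finset.univ.filter fun e => G.src e = o ∨ G.tgt e = o).card
        = Fintype.card E := by
      intro o
      rw [add_comm, Finset.card_filter_add_card_filter_not, Finset.card_univ]
    have h2 : ∑ o, (Finset.univ.filter fun e => G.src e = o ∨ G.tgt e = o).card
        = 2 * Fintype.card E := by
      simp only [Finset.card_filter]
      rw [Finset.sum_comm]
      have h3 : ∀ e, ∑ o, (if G.src e = o ∨ G.tgt e = o then 1 else 0) = 2 := by
        intro e
        rw [← Finset.card_filter, Finset.card_eq_two]
        refine ⟨_, _, hnl e, ?_⟩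
        ext o
        simp [eq_comm]
      simp only [h3, Finset.sum_const, Finset.card_univ, smul_eq_mul, mul_comm]
    rw [← h2, ← Finset.sum_add_distrib, Finset.sum_congr rfl fun o _ => h1 o]
    simp [Finset.card_univ]
  have hle : Fintype.card V * Fintype.card E
      ≤ 2 * Fintype.card E + Fintype.card V * (Fintype.card V - 2) := by
    have h1 : ∑ o, (F o).card ≤ ∑ _o : V, (Fintype.card V - 2) :=
      Finset.sum_le_sum fun o _ => by have := hF o; omega
    simp only [Finset.sum_const, Finset.card_univ, smul_eq_mul] at h1
    omega
  simp only [hq, Nat.cast_zero, Finset.sum_const_zero, add_zero] at hgen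
  have hgen' : Fintype.card V + 1 ≤ Fintype.card E := by
    have : ((Fintype.card V + 1 : ℕ) : ℝ) ≤ Fintype.card E := by push_cast; linarith
    exact_mod_cast this
  have hV2 : Fintype.card V ≤ 2 := by
    by_contra h
    push Not at h
    obtain ⟨n, hn⟩ : ∃ n, Fintype.card V = n + 2 := ⟨Fintype.card V - 2, by omega⟩
    rw [hn] at hle hgen' h
    simp only [Nat.add_sub_cancel] at hle
    nlinarith
  intro x
  by_contra hx
  push Not at hx
  have : ({x, G.src e₀, G.tgt e₀} : Finset V).card = 3 := by
    rw [Finset.card_eq_three]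
    exact ⟨_, _, _, hx.1, hx.2, hloop, rfl⟩
  have h3 := Finset.card_le_univ ({x, G.src e₀, G.tgt e₀} : Finset V)
  omega

/-- The number of loops is at most the first Betti number: each loop contributes `1` to the sum
of the Foster coefficients. -/
lemma card_loops_le [Nonempty V] (hc : G.PotentialConnected) :
    ({e | G.src e = G.tgt e}.ncard : ℝ) ≤ Fintype.card E - Fintype.card V + 1 := by
  classical
  obtain ⟨o⟩ := ‹Nonempty V›
  obtain ⟨g, hg⟩ := G.exists_isVertexGreen hc o
  rw [← hg.sum_foster]
  have h1 : ({e | G.src e = G.tgt e}.ncard : ℝ)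
      = ∑ e, if G.src e = G.tgt e then (1 : ℝ) else 0 := by
    rw [Set.ncard_eq_toFinset_card']
    simp
  rw [h1]
  refine Finset.sum_le_sum fun e _ => ?_
  split_ifs with h
  · simp only [foster, edgeRes, h]
    ring_nf
    rfl
  · exact hg.foster_nonneg e

end WeightedGraph

/-! ### Blocks -/

section Blocks

variable {V E : Type*}

lemma Reachable.mono {H H' : Graph V E} (h : H ≤ H') {x y : V} (hr : Reachable H x y) :
    Reachable H' x y :=
  Relation.ReflTransGen.mono (fun _ _ ⟨e, he⟩ => ⟨e, he.mono h⟩) _ _ hr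

lemma connected_of_reachable {H : Graph V E} {x : V} (hx : x ∈ V(H))
    (h : ∀ y ∈ V(H), Reachable H x y) : Connected H :=
  ⟨⟨x, hx⟩, fun y hy z hz => (WeightedGraph.reachable_symm (h y hy)).trans (h z hz)⟩

/-- A connected graph with a loop or bridge `e` at `x` has a separation with common vertex `x`,
provided that the part of the graph that remains attached to `x` after the removal of `e`
has an edge. The other side of the separation consists of `e` and of what it cuts off. -/
lemma exists_isSeparation {H : Graph V E} (hc : Connected H) {e f : E} {x y z w : V}
    (he : H.IsLink e x y) (hxy : x = y ∨ ¬ Reachable (H.deleteEdges {e}) x y)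
    (hf : H.IsLink f z w) (hfe : f ≠ e) (hz : Reachable (H.deleteEdges {e}) x z) :
    ∃ A B, IsSeparation H A B := by
  set D := H.deleteEdges {e} with hD
  have hDlink : ∀ {f z w}, D.IsLink f z w ↔ H.IsLink f z w ∧ f ≠ e := Iff.rfl
  let X : Set V := {v | v ∈ V(H) ∧ Reachable D x v}
  have hX : X ⊆ V(D) := fun v hv => hv.1
  have hstep : ∀ {f z w}, H.IsLink f z w → f ≠ e → z ∈ X → w ∈ X := fun h hne hzX =>
    ⟨h.right_mem, hzX.2.tail ⟨_, hDlink.2 ⟨h, hne⟩⟩⟩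
  have hxX : x ∈ X := ⟨he.left_mem, Relation.ReflTransGen.refl⟩
  let A := D.induce X
  have hAlink : ∀ {f z w}, A.IsLink f z w ↔ (H.IsLink f z w ∧ f ≠ e) ∧ z ∈ X ∧ w ∈ X := Iff.rfl
  have hAE : ∀ {f}, f ∈ E(A) ↔ ∃ z w, A.IsLink f z w := A.edge_mem_iff_exists_isLink _
  let Y : Set V := (V(H) \ X) ∪ {x}
  let B := (H.deleteEdges E(A)).induce Y
  have hBlink : ∀ {f z w}, B.IsLink f z w ↔ (H.IsLink f z w ∧ f ∉ E(A)) ∧ z ∈ Y ∧ w ∈ Y := Iff.rfl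
  have hBE : ∀ {f}, f ∈ E(B) ↔ ∃ z w, B.IsLink f z w := B.edge_mem_iff_exists_isLink _
  have hxY : x ∈ Y := Or.inr rfl
  have hY : Y ⊆ V(H) := Set.union_subset Set.sdiff_subset (Set.singleton_subset_iff.2 he.left_mem)
  have heA : e ∉ E(A) := fun h => by
    obtain ⟨_, _, h⟩ := hAE.1 h
    exact (hAlink.1 h).1.2 rfl
  have hyY : y ∈ Y := by
    rcases hxy with rfl | h
    · exact hxY
    · exact Or.inl ⟨he.right_mem, fun h' => h h'.2⟩
  have heB : B.IsLink e x y := hBlink.2 ⟨⟨he, heA⟩, hxY, hyY⟩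
  have hAH : A ≤ H := (induce_le hX).trans deleteEdges_le
  have hBH : B ≤ H := (induce_le (G := H.deleteEdges E(A)) hY).trans deleteEdges_le
  refine ⟨A, B, hAH, hBH, ?_, ?_, ?_, ?_, ⟨x, ?_⟩, ?_, ?_, ⟨e, heB.edge_mem⟩⟩
  · refine connected_of_reachable hxX fun v hv => ?_
    obtain ⟨_, hr⟩ : v ∈ X := hv
    induction hr with
    | refl => exact Relation.ReflTransGen.refl
    | tail hr hl ih =>
      obtain ⟨k, hk⟩ := hl
      exact (ih hk.left_mem).tail
        ⟨k, hAlink.2 ⟨hk, ⟨hk.left_mem, hr⟩, ⟨hk.right_mem, hr.tail ⟨k, hk⟩⟩⟩⟩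
  · refine connected_of_reachable hxY fun v hv => ?_
    have key : ∀ v, Reachable H x v → v ∈ X ∨ Reachable B x v := by
      intro v hr
      induction hr with
      | refl => exact Or.inl hxX
      | @tail u v _ hl ih =>
        obtain ⟨k, hk⟩ := hl
        by_cases hvX : v ∈ X
        · exact Or.inl hvX
        right
        by_cases hke : k = e
        · subst hke
          rcases he.eq_and_eq_or_eq_and_eq hk with ⟨rfl, rfl⟩ | ⟨rfl, rfl⟩
          · exact Relation.ReflTransGen.single ⟨_, heB⟩
          · exact absurd hxX hvX
        · have huX : u ∉ X := fun h => hvX (hstep hk hke h)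
          refine (ih.resolve_left huX).tail ⟨k, hBlink.2 ⟨⟨hk, fun hkA => ?_⟩,
            Or.inl ⟨hk.left_mem, huX⟩, Or.inl ⟨hk.right_mem, hvX⟩⟩⟩
          obtain ⟨a, b, hab⟩ := hAE.1 hkA
          have hab := hAlink.1 hab
          rcases hab.1.1.eq_and_eq_or_eq_and_eq hk with ⟨rfl, rfl⟩ | ⟨rfl, rfl⟩
          · exact huX hab.2.1
          · exact huX hab.2.2
    rcases key v (hc.2 x he.left_mem v (hY hv)) with h | h
    · rcases hv with hv | hv
      · exact absurd h hv.2
      · rw [Set.mem_singleton_iff.1 hv]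
        exact Relation.ReflTransGen.refl
    · exact h
  · refine Set.Subset.antisymm (Set.union_subset hX hY) fun v hv => ?_
    by_cases h : v ∈ X
    · exact Or.inl h
    · exact Or.inr (Or.inl ⟨hv, h⟩)
  · refine Set.Subset.antisymm (Set.union_subset hAH.edgeSet_mono hBH.edgeSet_mono) fun k hk => ?_
    obtain ⟨u, v, huv⟩ := exists_isLink_of_mem_edgeSet hk
    by_cases hke : k = e
    · exact Or.inr (hke ▸ heB.edge_mem)
    by_cases hkA : k ∈ E(A)
    · exact Or.inl hkA
    refine Or.inr (hBE.2 ⟨u, v, hBlink.2 ⟨⟨huv, hkA⟩, Or.inl ⟨huv.left_mem, fun h => hkA ?_⟩,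
      Or.inl ⟨huv.right_mem, fun h => hkA ?_⟩⟩⟩)
    · exact hAE.2 ⟨u, v, hAlink.2 ⟨⟨huv, hke⟩, h, hstep huv hke h⟩⟩
    · exact hAE.2 ⟨u, v, hAlink.2 ⟨⟨huv, hke⟩, hstep huv.symm hke h, h⟩⟩
  · ext v
    refine ⟨?_, fun h => ?_⟩
    · rintro ⟨hA, hB | hB⟩
      · exact absurd hA hB.2
      · exact hB
    · rw [Set.mem_singleton_iff.1 h]
      exact ⟨hxX, hxY⟩
  · rw [Set.disjoint_left]
    intro k hkA hkB
    obtain ⟨_, _, h⟩ := hBE.1 hkB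
    exact (hBlink.1 h).1.2 hkA
  · have hzX : z ∈ X := ⟨hf.left_mem, hz⟩
    exact ⟨f, hAE.2 ⟨z, w, hAlink.2 ⟨⟨hf, hfe⟩, hzX, hstep hf hfe hzX⟩⟩⟩

lemma edgeSet_eq_of_inseparable {H : Graph V E} (h : Inseparable H) {e : E} {x y : V}
    (he : H.IsLink e x y) (hxy : x = y ∨ ¬ Reachable (H.deleteEdges {e}) x y) : E(H) = {e} := by
  refine Set.Subset.antisymm (fun f hf => ?_) (Set.singleton_subset_iff.2 he.edge_mem)
  by_contra hfe
  obtain ⟨z, w, hzw⟩ := exists_isLink_of_mem_edgeSet hf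
  have key : ∀ v, Reachable H x v →
      Reachable (H.deleteEdges {e}) x v ∨ Reachable (H.deleteEdges {e}) y v := by
    intro v hr
    induction hr with
    | refl => exact Or.inl Relation.ReflTransGen.refl
    | @tail u v _ hl ih =>
      obtain ⟨k, hk⟩ := hl
      by_cases hke : k = e
      · subst hke
        rcases he.eq_and_eq_or_eq_and_eq hk with ⟨rfl, rfl⟩ | ⟨rfl, rfl⟩
        · exact Or.inr Relation.ReflTransGen.refl
        · exact Or.inl Relation.ReflTransGen.refl
      · exact ih.imp (fun h => h.tail ⟨k, hk, hke⟩) fun h => h.tail ⟨k, hk, hke⟩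
  rcases key z (h.1.2 x he.left_mem z hzw.left_mem) with hz | hz
  · exact h.2 (exists_isSeparation h.1 he hxy hzw hfe hz)
  · exact h.2 (exists_isSeparation h.1 he.symm
      (hxy.imp Eq.symm fun h h' => h (WeightedGraph.reachable_symm h')) hzw hfe hz)

lemma inseparable_single_edge {G : Graph V E} {e : E} {x y : V} (he : G.IsLink e x y) :
    Inseparable ((G.restrict {e}).induce {x, y}) := by
  set S := (G.restrict {e}).induce {x, y} with hS
  have hlink : S.IsLink e x y := ⟨⟨rfl, he⟩, Or.inl rfl, Or.inr rfl⟩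
  have hE : ∀ f ∈ E(S), f = e := fun f hf => by
    obtain ⟨_, _, h⟩ := exists_isLink_of_mem_edgeSet hf
    exact h.1.1
  refine ⟨connected_of_reachable (x := x) (Or.inl rfl) ?_, ?_⟩
  · rintro v (rfl | rfl)
    · exact Relation.ReflTransGen.refl
    · exact Relation.ReflTransGen.single ⟨e, hlink⟩
  · rintro ⟨A, B, h⟩
    obtain ⟨a, ha⟩ := h.left_nonempty
    obtain ⟨b, hb⟩ := h.right_nonempty
    have ha' := hE a (h.left_le.edgeSet_mono ha)
    have hb' := hE b (h.right_le.edgeSet_mono hb)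
    exact Set.disjoint_left.1 h.edge_disjoint ha (ha'.trans hb'.symm ▸ hb)

/-- In a finite graph, every inseparable subgraph is contained in a block. -/
lemma exists_isBlock_ge [Finite V] [Finite E] {G S : Graph V E} (hS : S ≤ G)
    (hi : Inseparable S) : ∃ H, S ≤ H ∧ IsBlock G H := by
  have hfin : {H : Graph V E | H ≤ G ∧ Inseparable H}.Finite := by
    refine Set.Finite.of_injOn (f := fun H : Graph V E => (V(H), E(H))) (t := Set.univ)
      (fun _ _ => Set.mem_univ _) ?_ Set.finite_univ
    intro H₁ h₁ H₂ h₂ h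
    exact Compatible.ext (Prod.ext_iff.1 h).1 (Prod.ext_iff.1 h).2 (Compatible.of_le_le h₁.1 h₂.1)
  exact hfin.exists_le_maximal ⟨hS, hi⟩

end Blocks

namespace WeightedGraph

variable {V E : Type*} (G : WeightedGraph V E)

lemma isLoopAt_iff {e : E} {x : V} :
    G.toGraph.IsLoopAt e x ↔ x = G.src e ∧ x = G.tgt e := by
  rw [← isLink_self_iff, toGraph_isLink, and_comm (a := x = G.tgt e), or_self]

lemma exists_isLoopAt_iff {e : E} : (∃ x, G.toGraph.IsLoopAt e x) ↔ G.src e = G.tgt e := by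
  simp only [isLoopAt_iff]
  exact ⟨fun ⟨x, h, h'⟩ => h.symm.trans h', fun h => ⟨_, rfl, h⟩⟩

/-- All blocks with edges are single loops or bridges if and only if all edges are loops or
bridges. -/
lemma blocksAreLoopsAndBridges_iff [Finite V] [Finite E] :
    BlocksAreLoopsAndBridges G.toGraph ↔ ∀ e, G.src e = G.tgt e ∨ IsBridge G.toGraph e := by
  constructor
  · intro h e
    obtain ⟨H, hSH, hH⟩ := exists_isBlock_ge
      ((induce_le (Set.subset_univ _)).trans restrict_le :
        (G.toGraph.restrict {e}).induce {G.src e, G.tgt e} ≤ G.toGraph)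
      (inseparable_single_edge (G.isLink_src_tgt e))
    have he : ((G.toGraph.restrict {e}).induce {G.src e, G.tgt e}).IsLink e (G.src e) (G.tgt e) :=
      ⟨⟨rfl, G.isLink_src_tgt e⟩, Or.inl rfl, Or.inr rfl⟩
    have heH : e ∈ E(H) := (he.mono hSH).edge_mem
    obtain ⟨f, hf, hf'⟩ := h H hH ⟨e, heH⟩
    rw [hf, Set.mem_singleton_iff] at heH
    subst heH
    rwa [exists_isLoopAt_iff] at hf'
  · rintro h H ⟨⟨hHG, hH⟩, _⟩ ⟨e, he⟩
    refine ⟨e, ?_, by rw [exists_isLoopAt_iff]; exact h e⟩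
    refine edgeSet_eq_of_inseparable hH ((hHG.isLink_iff he).2 (G.isLink_src_tgt e)) ?_
    refine (h e).imp id fun hb hr => ?_
    exact G.isBridge_iff.1 hb (Reachable.mono (deleteEdges_mono_left hHG {e}) hr)

end WeightedGraph

/-! ### Subdivisions -/

/-- The data exhibiting `Γ` as a subdivision of `G`: each vertex `v` of `Γ` has a position `pos v`
on the metric graph of `G`, each vertex `p` of `G` becomes the vertex `ι p` of `Γ`, and each edge
`e₀` of `Γ` is the segment `[l e₀, r e₀]` of the edge `π e₀` of `G`, traversed in the direction
given by the sign `σ e₀`. -/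
structure Subdivision {V E V₀ E₀ : Type*} (G : WeightedGraph V E) (Γ : WeightedGraph V₀ E₀) where
  pos : V₀ → G.Point
  ι : V → V₀
  π : E₀ → E
  l : E₀ → ℝ
  r : E₀ → ℝ
  σ : E₀ → ℝ
  pos_injective : Function.Injective pos
  pos_ι : ∀ p, pos (ι p) = .vertex p
  l_nonneg : ∀ e₀, 0 ≤ l e₀
  l_lt_r : ∀ e₀, l e₀ < r e₀
  r_le : ∀ e₀, r e₀ ≤ G.m (π e₀)
  ends : ∀ e₀, (σ e₀ = 1 ∧ pos (Γ.src e₀) = G.edgePoint (π e₀) (l e₀) ∧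
      pos (Γ.tgt e₀) = G.edgePoint (π e₀) (r e₀)) ∨
    (σ e₀ = -1 ∧ pos (Γ.tgt e₀) = G.edgePoint (π e₀) (l e₀) ∧
      pos (Γ.src e₀) = G.edgePoint (π e₀) (r e₀))
  eq_of_overlap : ∀ e₀ e₁, π e₀ = π e₁ → l e₀ < r e₁ → l e₁ < r e₀ → e₀ = e₁
  not_mem_Ioo : ∀ v e₀ t, pos v = G.edgePoint (π e₀) t → ¬ (l e₀ < t ∧ t < r e₀)
  cover : ∀ e t, 0 ≤ t → t ≤ G.m e →
    (∃ v, pos v = G.edgePoint e t) ∨ ∃ e₀, π e₀ = e ∧ l e₀ < t ∧ t < r e₀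

lemma WeightedGraph.edgePoint_inj {V E : Type*} {G : WeightedGraph V E} {e e' : E} {t t' : ℝ}
    (ht : t ∈ Set.Ioo 0 (G.m e)) (h : G.edgePoint e t = G.edgePoint e' t') : e = e' ∧ t = t' := by
  rw [G.edgePoint_of_mem ht] at h
  unfold WeightedGraph.edgePoint at h
  split_ifs at h
  cases h
  exact ⟨rfl, rfl⟩

namespace Subdivision

open WeightedGraph

variable {V E V₀ E₀ : Type*} {G : WeightedGraph V E} {Γ : WeightedGraph V₀ E₀}
  (S : Subdivision G Γ)

include S

lemma σ_mul_self (e₀ : E₀) : S.σ e₀ * S.σ e₀ = 1 := by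
  rcases S.ends e₀ with h | h <;> rw [h.1] <;> norm_num

lemma σ_ne_zero (e₀ : E₀) : S.σ e₀ ≠ 0 := fun h => by
  have := S.σ_mul_self e₀
  rw [h] at this
  norm_num at this

lemma σ_mul_diff (F : G.Point → ℝ) (e₀ : E₀) : S.σ e₀ * Γ.diff (fun v => F (S.pos v)) e₀
    = F (G.edgePoint (S.π e₀) (S.r e₀)) - F (G.edgePoint (S.π e₀) (S.l e₀)) := by
  rcases S.ends e₀ with ⟨h1, h2, h3⟩ | ⟨h1, h2, h3⟩
  · rw [diff, h1, h2, h3, one_mul]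
  · rw [diff, h1, h2, h3]; ring

lemma exists_pos_l (e₀ : E₀) : ∃ v, S.pos v = G.edgePoint (S.π e₀) (S.l e₀) := by
  rcases S.ends e₀ with h | h
  · exact ⟨_, h.2.1⟩
  · exact ⟨_, h.2.1⟩

lemma exists_pos_r (e₀ : E₀) : ∃ v, S.pos v = G.edgePoint (S.π e₀) (S.r e₀) := by
  rcases S.ends e₀ with h | h
  · exact ⟨_, h.2.2⟩
  · exact ⟨_, h.2.2⟩

lemma exists_eq_pos (φ : V₀ → ℝ) : ∃ F : G.Point → ℝ, ∀ v, F (S.pos v) = φ v :=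
  ⟨Function.extend S.pos φ 0, fun v => S.pos_injective.extend_apply φ 0 v⟩

/-- The subdivision points of the edge `e`. -/
def marks (e : E) : Set ℝ := {t | 0 ≤ t ∧ t ≤ G.m e ∧ ∃ v, S.pos v = G.edgePoint e t}

lemma zero_mem_marks (e : E) : 0 ∈ S.marks e :=
  ⟨le_rfl, (G.m_pos e).le, S.ι (G.src e), by rw [S.pos_ι, edgePoint_zero]⟩

lemma m_mem_marks (e : E) : G.m e ∈ S.marks e :=
  ⟨(G.m_pos e).le, le_rfl, S.ι (G.tgt e), by rw [S.pos_ι, edgePoint_m]⟩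

lemma l_mem_marks (e₀ : E₀) : S.l e₀ ∈ S.marks (S.π e₀) :=
  ⟨S.l_nonneg e₀, (S.l_lt_r e₀).le.trans (S.r_le e₀), S.exists_pos_l e₀⟩

lemma r_mem_marks (e₀ : E₀) : S.r e₀ ∈ S.marks (S.π e₀) :=
  ⟨(S.l_nonneg e₀).trans (S.l_lt_r e₀).le, S.r_le e₀, S.exists_pos_r e₀⟩

lemma finite_marks [Finite V₀] (e : E) : (S.marks e).Finite := by
  have h1 : (S.marks e ∩ Set.Ioo 0 (G.m e)).Finite := by
    refine Set.Finite.of_injOn (f := G.edgePoint e) (t := Set.range S.pos) ?_ ?_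
      (Set.finite_range _)
    · rintro t ⟨⟨_, _, v, hv⟩, _⟩
      exact ⟨v, hv⟩
    · rintro s ⟨_, hs⟩ t ⟨_, ht⟩ h
      rw [G.edgePoint_of_mem hs, G.edgePoint_of_mem ht] at h
      simpa using h
  refine (h1.union (Set.toFinite {0, G.m e})).subset fun t ht => ?_
  rcases ht.1.eq_or_lt with h | h
  · exact Or.inr (Or.inl h.symm)
  rcases ht.2.1.eq_or_lt with h' | h'
  · exact Or.inr (Or.inr h')
  · exact Or.inl ⟨ht, h, h'⟩

/-- Between consecutive subdivision points there is an edge of the subdivision. -/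
lemma exists_edge_of_gap {e : E} {s t : ℝ} (hs : s ∈ S.marks e) (ht : t ∈ S.marks e) (hst : s < t)
    (hgap : ∀ u ∈ S.marks e, u ≤ s ∨ t ≤ u) : ∃ e₀, S.π e₀ = e ∧ S.l e₀ = s ∧ S.r e₀ = t := by
  have h0 : 0 ≤ (s + t) / 2 := by linarith [hs.1, ht.1]
  have h1 : (s + t) / 2 ≤ G.m e := by linarith [hs.2.1, ht.2.1]
  rcases S.cover e _ h0 h1 with h | ⟨e₀, rfl, hl, hr⟩
  · rcases hgap _ ⟨h0, h1, h⟩ with h | h <;> linarith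
  · refine ⟨e₀, rfl, ?_, ?_⟩
    · refine le_antisymm ((hgap _ (S.l_mem_marks e₀)).resolve_right (by linarith)) ?_
      by_contra h
      obtain ⟨_, _, v, hv⟩ := hs
      exact S.not_mem_Ioo v e₀ s hv ⟨not_le.1 h, by linarith⟩
    · refine le_antisymm ?_ ((hgap _ (S.r_mem_marks e₀)).resolve_left (by linarith))
      by_contra h
      obtain ⟨_, _, v, hv⟩ := ht
      exact S.not_mem_Ioo v e₀ t hv ⟨by linarith, not_le.1 h⟩

lemma exists_l_eq [Finite V₀] {e : E} {s : ℝ} (hs : s ∈ S.marks e) (hsm : s < G.m e) :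
    ∃ e₀, S.π e₀ = e ∧ S.l e₀ = s := by
  obtain ⟨t, ht, hmin⟩ := Set.exists_min_image (S.marks e ∩ Set.Ioi s) id
    ((S.finite_marks e).subset Set.inter_subset_left) ⟨_, S.m_mem_marks e, hsm⟩
  obtain ⟨e₀, h1, h2, _⟩ := S.exists_edge_of_gap hs ht.1 ht.2 fun u hu => by
    by_contra! h
    exact absurd (hmin u ⟨hu, h.1⟩) (not_le.2 h.2)
  exact ⟨e₀, h1, h2⟩

lemma exists_r_eq [Finite V₀] {e : E} {t : ℝ} (ht : t ∈ S.marks e) (ht0 : 0 < t) :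
    ∃ e₀, S.π e₀ = e ∧ S.r e₀ = t := by
  obtain ⟨s, hs, hmax⟩ := Set.exists_max_image (S.marks e ∩ Set.Iio t) id
    ((S.finite_marks e).subset Set.inter_subset_left) ⟨_, S.zero_mem_marks e, ht0⟩
  obtain ⟨e₀, h1, _, h2⟩ := S.exists_edge_of_gap hs.1 ht hs.2 fun u hu => by
    by_contra! h
    exact absurd (hmax u ⟨hu, h.2⟩) (not_le.2 h.1)
  exact ⟨e₀, h1, h2⟩

lemma π_surjective [Finite V₀] : Function.Surjective S.π := fun e => by
  obtain ⟨e₀, h, _⟩ := S.exists_l_eq (S.zero_mem_marks e) (G.m_pos e)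
  exact ⟨e₀, h⟩

lemma eq_of_l_eq {e₀ e₁ : E₀} (hπ : S.π e₀ = S.π e₁) (h : S.l e₀ = S.l e₁) : e₀ = e₁ :=
  S.eq_of_overlap _ _ hπ (h ▸ S.l_lt_r e₁) (h ▸ S.l_lt_r e₀)

lemma eq_of_r_eq {e₀ e₁ : E₀} (hπ : S.π e₀ = S.π e₁) (h : S.r e₀ = S.r e₁) : e₀ = e₁ :=
  S.eq_of_overlap _ _ hπ (h ▸ S.l_lt_r e₀) (h ▸ S.l_lt_r e₁)

section Telescope

variable [Fintype V₀] [Fintype E₀] [DecidableEq E]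

/-- Increments along the segments of an edge telescope. -/
lemma sum_sub (ψ : ℝ → ℝ) (e : E) :
    ∑ e₀ with S.π e₀ = e, (ψ (S.r e₀) - ψ (S.l e₀)) = ψ (G.m e) - ψ 0 := by
  classical
  have hfin := S.finite_marks e
  have hl : ∑ e₀ with S.π e₀ = e, ψ (S.l e₀) = ∑ t ∈ hfin.toFinset.erase (G.m e), ψ t := by
    refine Finset.sum_nbij S.l ?_ ?_ ?_ fun _ _ => rfl
    · intro e₀ he₀
      obtain rfl := (Finset.mem_filter.1 he₀).2
      exact Finset.mem_erase.2 ⟨((S.l_lt_r e₀).trans_le (S.r_le e₀)).ne,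
        hfin.mem_toFinset.2 (S.l_mem_marks e₀)⟩
    · intro e₀ h₀ e₁ h₁ h
      exact S.eq_of_l_eq (((Finset.mem_filter.1 h₀).2).trans (Finset.mem_filter.1 h₁).2.symm) h
    · intro t ht
      obtain ⟨hne, ht⟩ := Finset.mem_erase.1 ht
      have ht := hfin.mem_toFinset.1 ht
      obtain ⟨e₀, h1, h2⟩ := S.exists_l_eq ht (lt_of_le_of_ne ht.2.1 hne)
      exact ⟨e₀, by simpa using h1, h2⟩
  have hr : ∑ e₀ with S.π e₀ = e, ψ (S.r e₀) = ∑ t ∈ hfin.toFinset.erase 0, ψ t := by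
    refine Finset.sum_nbij S.r ?_ ?_ ?_ fun _ _ => rfl
    · intro e₀ he₀
      obtain rfl := (Finset.mem_filter.1 he₀).2
      exact Finset.mem_erase.2 ⟨((S.l_nonneg e₀).trans_lt (S.l_lt_r e₀)).ne',
        hfin.mem_toFinset.2 (S.r_mem_marks e₀)⟩
    · intro e₀ h₀ e₁ h₁ h
      exact S.eq_of_r_eq (((Finset.mem_filter.1 h₀).2).trans (Finset.mem_filter.1 h₁).2.symm) h
    · intro t ht
      obtain ⟨hne, ht⟩ := Finset.mem_erase.1 ht
      have ht := hfin.mem_toFinset.1 ht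
      obtain ⟨e₀, h1, h2⟩ := S.exists_r_eq ht (lt_of_le_of_ne ht.1 (Ne.symm hne))
      exact ⟨e₀, by simpa using h1, h2⟩
  rw [Finset.sum_sub_distrib, hl, hr,
    Finset.sum_erase_eq_sub (hfin.mem_toFinset.2 (S.m_mem_marks e)),
    Finset.sum_erase_eq_sub (hfin.mem_toFinset.2 (S.zero_mem_marks e))]
  ring

/-- The increment of a potential along an edge is the sum of its increments along the segments. -/
lemma sum_σ_mul_diff (φ : V₀ → ℝ) (e : E) :
    ∑ e₀ with S.π e₀ = e, S.σ e₀ * Γ.diff φ e₀ = G.diff (fun p => φ (S.ι p)) e := by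
  obtain ⟨F, hF⟩ := S.exists_eq_pos φ
  obtain rfl : (fun v => F (S.pos v)) = φ := funext hF
  have h := S.sum_sub (fun t => F (G.edgePoint e t)) e
  rw [edgePoint_zero, edgePoint_m, ← S.pos_ι, ← S.pos_ι] at h
  rw [diff, ← h]
  refine Finset.sum_congr rfl fun e₀ he₀ => ?_
  obtain rfl := (Finset.mem_filter.1 he₀).2
  rw [S.σ_mul_diff]

/-- Subdividing does not change the Euler characteristic. -/
lemma card_sub_card [Fintype V] [Fintype E] :
    (Fintype.card E₀ : ℝ) - Fintype.card V₀ = Fintype.card E - Fintype.card V := by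
  classical
  have h1 : ∀ e, ∑ e₀ with S.π e₀ = e, (if S.l e₀ = 0 then (1 : ℝ) else 0) = 1 := by
    intro e
    have h := S.sum_sub (fun t => if t = 0 then 1 else 0) e
    simp only [if_neg (G.m_pos e).ne', if_true] at h
    rw [Finset.sum_congr rfl fun e₀ _ => show _ = -(if S.l e₀ = 0 then (1 : ℝ) else 0) by
      rw [if_neg ((S.l_nonneg e₀).trans_lt (S.l_lt_r e₀)).ne', zero_sub],
      Finset.sum_neg_distrib] at h
    linarith
  have h2 : (Fintype.card {e₀ // S.l e₀ = 0} : ℝ) = Fintype.card E := by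
    have : ∑ e₀, (if S.l e₀ = 0 then (1 : ℝ) else 0) = Fintype.card E := by
      rw [← Finset.sum_fiberwise Finset.univ S.π, Finset.sum_congr rfl fun e _ => h1 e]
      simp [Finset.card_univ]
    rw [← this, Finset.sum_boole, Fintype.card_subtype]
  choose s hs using S.exists_pos_l
  have h3 : Fintype.card V₀ = Fintype.card V + Fintype.card {e₀ // ¬ S.l e₀ = 0} := by
    rw [← Fintype.card_sum]
    symm
    refine Fintype.card_of_bijective
      (f := Sum.elim S.ι fun e₀ : {e₀ // ¬ S.l e₀ = 0} => s e₀.1) ⟨?_, ?_⟩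
    · have hin : ∀ e₀ : {e₀ // ¬ S.l e₀ = 0}, S.l e₀.1 ∈ Set.Ioo 0 (G.m (S.π e₀.1)) := fun e₀ =>
        ⟨lt_of_le_of_ne (S.l_nonneg _) (Ne.symm e₀.2), (S.l_lt_r _).trans_le (S.r_le _)⟩
      rintro (p | e₀) (p' | e₁) h <;> simp only [Sum.elim_inl, Sum.elim_inr] at h <;>
        have h := congrArg S.pos h
      · rw [S.pos_ι, S.pos_ι] at h
        simpa using h
      · rw [S.pos_ι, hs, G.edgePoint_of_mem (hin e₁)] at h
        simp at h
      · rw [S.pos_ι, hs, G.edgePoint_of_mem (hin e₀)] at h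
        simp at h
      · rw [hs, hs] at h
        obtain ⟨h1, h2⟩ := edgePoint_inj (hin e₀) h
        rw [Subtype.ext (S.eq_of_l_eq h1 h2)]
    · intro v
      rcases hv : S.pos v with p | ⟨e, t⟩
      · exact ⟨Sum.inl p, S.pos_injective ((S.pos_ι p).trans hv.symm)⟩
      · have ht : S.pos v = G.edgePoint e t := by rw [hv, G.edgePoint_of_mem t.2]
        obtain ⟨e₀, rfl, h⟩ := S.exists_l_eq (s := t) ⟨t.2.1.le, t.2.2.le, v, ht⟩ t.2.2
        refine ⟨Sum.inr ⟨e₀, by rw [h]; exact t.2.1.ne'⟩, S.pos_injective ?_⟩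
        rw [Sum.elim_inr, hs, ht]
        exact congrArg _ h
  have h4 := Fintype.card_subtype_compl fun e₀ => S.l e₀ = 0
  have h5 := Fintype.card_subtype_le fun e₀ => S.l e₀ = 0
  have h6 : (Fintype.card {e₀ // ¬ S.l e₀ = 0} : ℝ)
      = Fintype.card E₀ - Fintype.card {e₀ // S.l e₀ = 0} := by
    rw [h4, Nat.cast_sub h5]
  rw [h3, Nat.cast_add, h6, h2]
  ring

end Telescope

/-! ### Flows, bridges and tightness on subdivisions -/

variable [Fintype V₀] [Fintype E₀]

omit [Fintype V₀] [Fintype E₀] in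
lemma potentialConnected (hc : Γ.PotentialConnected) : G.PotentialConnected := by
  intro f hf x y
  let F : G.Point → ℝ
    | .vertex p => f p
    | .inner e _ => f (G.src e)
  have hF : ∀ e t, F (G.edgePoint e t) = f (G.src e) := by
    intro e t
    have := hf e
    rw [diff, sub_eq_zero] at this
    unfold edgePoint
    split_ifs
    · rfl
    · rfl
    · exact this
  have h := hc (fun v => F (S.pos v)) (fun e₀ => by
    have := S.σ_mul_diff F e₀
    rw [hF, hF, sub_self] at this
    exact (mul_eq_zero.1 this).resolve_left (S.σ_ne_zero e₀)) (S.ι x) (S.ι y)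
  simpa only [S.pos_ι] using h

omit [Fintype V₀] in
/-- Flows of a subdivision are constant along the edges of the original graph: test with the
indicator functions of segments. -/
lemma flow_const {c : E₀ → ℝ} (hc : Γ.IsFlow c) {e₁ e₂ : E₀} (h : S.π e₁ = S.π e₂) :
    S.σ e₁ * c e₁ = S.σ e₂ * c e₂ := by
  classical
  let u : E₀ → ℝ → ℝ := fun k t => if S.r k ≤ t then 1 else 0
  let F : G.Point → ℝ
    | .vertex _ => 0
    | .inner e t => if e = S.π e₁ then u e₁ t - u e₂ t else 0
  have hu : ∀ k e₀, S.π e₀ = S.π k →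
      u k (S.r e₀) - u k (S.l e₀) = if e₀ = k then 1 else 0 := by
    intro k e₀ hπ
    simp only [u]
    by_cases hk : e₀ = k
    · subst hk
      rw [if_pos le_rfl, if_neg (not_le.2 (S.l_lt_r _)), if_pos rfl, sub_zero]
    · rw [if_neg hk]
      have : ¬ (S.l e₀ < S.r k ∧ S.r k ≤ S.r e₀) := fun h' =>
        hk (S.eq_of_overlap _ _ hπ h'.1 ((S.l_lt_r k).trans_le h'.2))
      have h3 := S.l_lt_r e₀
      split_ifs with h1 h2 h2
      · simp
      · exact absurd ⟨not_le.1 h2, h1⟩ this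
      · exact absurd (h2.trans h3.le) h1
      · simp
  have hF : ∀ t ∈ Set.Icc 0 (G.m (S.π e₁)), F (G.edgePoint (S.π e₁) t) = u e₁ t - u e₂ t := by
    refine G.edgePoint_cases ?_ ?_ fun t ht => ?_
    · simp only [edgePoint_zero, F, u]
      rw [if_neg (not_le.2 ((S.l_nonneg e₁).trans_lt (S.l_lt_r e₁))),
        if_neg (not_le.2 ((S.l_nonneg e₂).trans_lt (S.l_lt_r e₂))), sub_self]
    · simp only [edgePoint_m, F, u]
      rw [if_pos (S.r_le e₁), if_pos (h ▸ S.r_le e₂), sub_self]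
    · simp only [G.edgePoint_of_mem ht, F, if_true]
  have hF' : ∀ e t, e ≠ S.π e₁ → F (G.edgePoint e t) = 0 := by
    intro e t he
    unfold edgePoint
    split_ifs
    · exact if_neg he
    · rfl
    · rfl
  have hd : ∀ e₀, S.σ e₀ * Γ.diff (fun v => F (S.pos v)) e₀
      = (if e₀ = e₁ then 1 else 0) - (if e₀ = e₂ then 1 else 0) := by
    intro e₀
    rw [S.σ_mul_diff]
    by_cases hπ : S.π e₀ = S.π e₁
    · have h1 := hu e₁ e₀ hπ
      have h2 := hu e₂ e₀ (hπ.trans h)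
      have h3 := (S.l_lt_r e₀).le
      rw [hπ, hF _ ⟨(S.l_nonneg e₀).trans h3, hπ ▸ S.r_le e₀⟩,
        hF _ ⟨S.l_nonneg e₀, hπ ▸ h3.trans (S.r_le e₀)⟩, ← h1, ← h2]
      ring
    · rw [hF' _ _ hπ, hF' _ _ hπ, if_neg fun h' => hπ (by rw [h']),
        if_neg fun h' => hπ (by rw [h', h])]
  have key := hc fun v => F (S.pos v)
  have h1 : ∀ e₀, c e₀ * Γ.diff (fun v => F (S.pos v)) e₀
      = (S.σ e₀ * c e₀) * ((if e₀ = e₁ then 1 else 0) - (if e₀ = e₂ then 1 else 0)) := by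
    intro e₀
    rw [← hd]
    linear_combination -(c e₀ * Γ.diff (fun v => F (S.pos v)) e₀) * S.σ_mul_self e₀
  simp only [h1, mul_sub, Finset.sum_sub_distrib, mul_ite, mul_one, mul_zero, Finset.sum_ite_eq',
    Finset.mem_univ, if_true] at key
  linarith

lemma sum_σ_mul_π [Fintype E] (c : E → ℝ) (φ : V₀ → ℝ) :
    ∑ e₀, (S.σ e₀ * c (S.π e₀)) * Γ.diff φ e₀ = ∑ e, c e * G.diff (fun p => φ (S.ι p)) e := by
  classical
  rw [← Finset.sum_fiberwise Finset.univ S.π]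
  refine Finset.sum_congr rfl fun e _ => ?_
  rw [← S.sum_σ_mul_diff, Finset.mul_sum]
  refine Finset.sum_congr rfl fun e₀ he₀ => ?_
  rw [(Finset.mem_filter.1 he₀).2]
  ring

lemma isFlow_pull [Fintype E] {c : E → ℝ} (hc : G.IsFlow c) :
    Γ.IsFlow fun e₀ => S.σ e₀ * c (S.π e₀) := fun φ => by
  rw [S.sum_σ_mul_π]
  exact hc _

omit [Fintype V₀] [Fintype E₀] in
lemma ι_injective : Function.Injective S.ι := fun p p' h => by
  have := congrArg S.pos h
  rw [S.pos_ι, S.pos_ι] at this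
  simpa using this

/-- Every flow of a subdivision comes from a flow of the original graph. -/
lemma exists_flow [Fintype E] {c₀ : E₀ → ℝ} (hc : Γ.IsFlow c₀) :
    ∃ c, G.IsFlow c ∧ ∀ e₀, c₀ e₀ = S.σ e₀ * c (S.π e₀) := by
  choose k hk using S.π_surjective
  let c : E → ℝ := fun e => S.σ (k e) * c₀ (k e)
  have h1 : ∀ e₀, c₀ e₀ = S.σ e₀ * c (S.π e₀) := by
    intro e₀
    simp only [c]
    rw [S.flow_const hc (hk (S.π e₀)), ← mul_assoc, S.σ_mul_self, one_mul]
  refine ⟨c, fun f => ?_, h1⟩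
  have h2 : (fun p => Function.extend S.ι f 0 (S.ι p)) = f :=
    funext fun p => S.ι_injective.extend_apply f 0 p
  have h3 := hc (Function.extend S.ι f 0)
  rw [Finset.sum_congr rfl fun e₀ _ => by rw [h1 e₀], S.sum_σ_mul_π, h2] at h3
  exact h3

omit S [Fintype V₀] [Fintype E₀] in
/-- Bridges in terms of potentials. -/
lemma _root_.MetricGraph.WeightedGraph.isBridge_iff_exists_diff (hc : G.PotentialConnected)
    {e : E} : IsBridge G.toGraph e ↔ ∃ φ, G.diff φ e ≠ 0 ∧ ∀ e', e' ≠ e → G.diff φ e' = 0 := by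
  constructor
  · intro h
    refine ⟨G.farInd (G.src e) e, fun h0 => ?_, fun e' he' => G.diff_farInd_of_ne _ he'⟩
    have := diff_farInd_mul_self hc (G.src e) h
    rw [h0] at this
    norm_num at this
  · rintro ⟨φ, h1, h2⟩
    by_contra h
    exact h1 (G.diff_eq_zero_of_not_isBridge h h2)

lemma isBridge_π (hc : Γ.PotentialConnected) {e₀ : E₀} :
    IsBridge G.toGraph (S.π e₀) ↔ IsBridge Γ.toGraph e₀ := by
  classical
  rw [isBridge_iff_exists_diff (S.potentialConnected hc), isBridge_iff_exists_diff hc]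
  constructor
  · rintro ⟨f, hf, hf0⟩
    let F : G.Point → ℝ
      | .vertex p => f p
      | .inner e t => if e = S.π e₀ ∧ S.l e₀ < t then f (G.tgt e) else f (G.src e)
    have hF : ∀ t ∈ Set.Icc 0 (G.m (S.π e₀)), F (G.edgePoint (S.π e₀) t)
        = if S.l e₀ < t then f (G.tgt (S.π e₀)) else f (G.src (S.π e₀)) := by
      refine G.edgePoint_cases ?_ ?_ fun t ht => ?_
      · simp only [edgePoint_zero, F]
        rw [if_neg (not_lt.2 (S.l_nonneg e₀))]
      · simp only [edgePoint_m, F]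
        rw [if_pos ((S.l_lt_r e₀).trans_le (S.r_le e₀))]
      · simp only [G.edgePoint_of_mem ht, F, true_and]
    have hF' : ∀ e t, e ≠ S.π e₀ → F (G.edgePoint e t) = f (G.src e) := by
      intro e t he
      have := hf0 e he
      rw [diff, sub_eq_zero] at this
      unfold edgePoint
      split_ifs
      · exact if_neg fun h => he h.1
      · rfl
      · exact this
    have hd : ∀ e₁, S.π e₁ = S.π e₀ → S.σ e₁ * Γ.diff (fun v => F (S.pos v)) e₁
        = (if S.l e₀ < S.r e₁ then f (G.tgt (S.π e₀)) else f (G.src (S.π e₀)))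
          - if S.l e₀ < S.l e₁ then f (G.tgt (S.π e₀)) else f (G.src (S.π e₀)) := by
      intro e₁ hπ
      have h3 := (S.l_lt_r e₁).le
      rw [S.σ_mul_diff, hπ, hF _ ⟨(S.l_nonneg e₁).trans h3, hπ ▸ S.r_le e₁⟩,
        hF _ ⟨S.l_nonneg e₁, hπ ▸ h3.trans (S.r_le e₁)⟩]
    refine ⟨fun v => F (S.pos v), fun h => ?_, fun e₁ hne => ?_⟩
    · have h1 := hd e₀ rfl
      rw [h, mul_zero, if_pos (S.l_lt_r e₀), if_neg (lt_irrefl _)] at h1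
      exact hf h1.symm
    · refine (mul_eq_zero.1 ?_).resolve_left (S.σ_ne_zero e₁)
      by_cases hπ : S.π e₁ = S.π e₀
      · rw [hd e₁ hπ]
        have h3 := S.l_lt_r e₁
        have : ¬ (S.l e₀ < S.r e₁ ∧ S.l e₁ ≤ S.l e₀) := fun h =>
          hne (S.eq_of_overlap _ _ hπ (h.2.trans_lt (S.l_lt_r e₀)) h.1)
        split_ifs with h1 h2 h2
        · simp
        · exact absurd ⟨h1, not_lt.1 h2⟩ this
        · exact absurd (h2.trans h3) h1
        · simp
      · rw [S.σ_mul_diff, hF' _ _ hπ, hF' _ _ hπ, sub_self]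
  · rintro ⟨φ, hφ, hφ0⟩
    have hz : ∀ e₁, e₁ ≠ e₀ → S.σ e₁ * Γ.diff φ e₁ = 0 := fun e₁ h => by rw [hφ0 e₁ h, mul_zero]
    refine ⟨fun p => φ (S.ι p), ?_, fun e he => ?_⟩
    · rw [← S.sum_σ_mul_diff φ (S.π e₀), Finset.sum_eq_single e₀ (fun e₁ _ h => hz e₁ h)
        (by simp)]
      exact mul_ne_zero (S.σ_ne_zero _) hφ
    · rw [← S.sum_σ_mul_diff]
      refine Finset.sum_eq_zero fun e₁ he₁ => hz e₁ fun h => he ?_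
      rw [← (Finset.mem_filter.1 he₁).2, h]

lemma bridgeEquiv_ι (hc : Γ.PotentialConnected) {p o : V} :
    Γ.BridgeEquiv (S.ι p) (S.ι o) ↔ G.BridgeEquiv p o := by
  classical
  constructor
  · intro h f hf
    let F : G.Point → ℝ
      | .vertex p => f p
      | .inner e _ => f (G.src e)
    have hF : ∀ e t, IsBridge G.toGraph e → F (G.edgePoint e t) = f (G.src e) := by
      intro e t he
      have := hf e he
      rw [diff, sub_eq_zero] at this
      unfold edgePoint
      split_ifs
      · rfl
      · rfl
      · exact this
    have := h (fun v => F (S.pos v)) fun e₀ he₀ => by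
      have hb := (S.isBridge_π hc).2 he₀
      have := S.σ_mul_diff F e₀
      rw [hF _ _ hb, hF _ _ hb, sub_self] at this
      exact (mul_eq_zero.1 this).resolve_left (S.σ_ne_zero e₀)
    simpa only [S.pos_ι] using this
  · intro h φ hφ
    refine h (fun p => φ (S.ι p)) fun e he => ?_
    rw [← S.sum_σ_mul_diff]
    refine Finset.sum_eq_zero fun e₀ he₀ => ?_
    obtain rfl := (Finset.mem_filter.1 he₀).2
    rw [hφ e₀ ((S.isBridge_π hc).1 he), mul_zero]

/-- A subdivision point inside an edge that is not a bridge is not joined by bridges to other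
vertices. -/
lemma eq_of_bridgeEquiv (hc : Γ.PotentialConnected) {e : E} (he : ¬ IsBridge G.toGraph e) {t : ℝ}
    (ht : t ∈ Set.Ioo 0 (G.m e)) {v w : V₀} (hv : S.pos v = G.edgePoint e t)
    (h : Γ.BridgeEquiv v w) : w = v := by
  classical
  have h1 := h (Pi.single v 1) fun e₀ he₀ => by
    have hne : ∀ s, S.pos v ≠ G.edgePoint (S.π e₀) s := fun s hs => by
      obtain ⟨rfl, _⟩ := edgePoint_inj ht (hv.symm.trans hs)
      exact he ((S.isBridge_π hc).2 he₀)
    have hs : Γ.src e₀ ≠ v ∧ Γ.tgt e₀ ≠ v := by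
      constructor <;> rintro rfl <;> rcases S.ends e₀ with ⟨_, h1, h2⟩ | ⟨_, h1, h2⟩
      · exact hne _ h1
      · exact hne _ h2
      · exact hne _ h2
      · exact hne _ h1
    rw [diff, Pi.single_eq_of_ne hs.1, Pi.single_eq_of_ne hs.2, sub_self]
  by_contra hwv
  rw [Pi.single_eq_same, Pi.single_eq_of_ne hwv] at h1
  exact one_ne_zero h1

lemma touchesClass_π (hc : Γ.PotentialConnected) {e₀ : E₀} {o : V}
    (hb : ¬ IsBridge G.toGraph (S.π e₀)) (h : Γ.TouchesClass e₀ (S.ι o)) :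
    G.TouchesClass (S.π e₀) o := by
  have key : ∀ v t, 0 ≤ t → t ≤ G.m (S.π e₀) → S.pos v = G.edgePoint (S.π e₀) t →
      Γ.BridgeEquiv v (S.ι o) → G.TouchesClass (S.π e₀) o := by
    intro v t h0 h1 hv hvo
    rcases h0.eq_or_lt with rfl | h0
    · rw [edgePoint_zero, ← S.pos_ι] at hv
      rw [S.pos_injective hv, S.bridgeEquiv_ι hc] at hvo
      exact Or.inl hvo
    rcases h1.eq_or_lt with rfl | h1
    · rw [edgePoint_m, ← S.pos_ι] at hv
      rw [S.pos_injective hv, S.bridgeEquiv_ι hc] at hvo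
      exact Or.inr hvo
    · obtain rfl := S.eq_of_bridgeEquiv hc hb ⟨h0, h1⟩ hv hvo
      rw [S.pos_ι, G.edgePoint_of_mem ⟨h0, h1⟩] at hv
      simp at hv
  have hl := S.l_mem_marks e₀
  have hr := S.r_mem_marks e₀
  rcases h with h | h <;> rcases S.ends e₀ with ⟨_, h1, h2⟩ | ⟨_, h1, h2⟩
  · exact key _ _ hl.1 hl.2.1 h1 h
  · exact key _ _ hr.1 hr.2.1 h2 h
  · exact key _ _ hr.1 hr.2.1 h2 h
  · exact key _ _ hl.1 hl.2.1 h1 h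

/-- An edge that touches a class has a segment that does so. -/
lemma exists_touchesClass (hc : Γ.PotentialConnected) {e : E} {o : V}
    (h : G.TouchesClass e o) : ∃ e₀, S.π e₀ = e ∧ Γ.TouchesClass e₀ (S.ι o) := by
  rcases h with h | h
  · obtain ⟨e₀, rfl, hl⟩ := S.exists_l_eq (S.zero_mem_marks e) (G.m_pos e)
    refine ⟨e₀, rfl, ?_⟩
    have := S.ends e₀
    rw [hl, edgePoint_zero, ← S.pos_ι] at this
    rw [← S.bridgeEquiv_ι hc] at h
    rcases this with ⟨_, h1, _⟩ | ⟨_, h1, _⟩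
    · exact Or.inl (by rwa [S.pos_injective h1])
    · exact Or.inr (by rwa [S.pos_injective h1])
  · obtain ⟨e₀, rfl, hr⟩ := S.exists_r_eq (S.m_mem_marks e) (G.m_pos e)
    refine ⟨e₀, rfl, ?_⟩
    have := S.ends e₀
    rw [hr, edgePoint_m, ← S.pos_ι] at this
    rw [← S.bridgeEquiv_ι hc] at h
    rcases this with ⟨_, _, h1⟩ | ⟨_, _, h1⟩
    · exact Or.inr (by rwa [S.pos_injective h1])
    · exact Or.inl (by rwa [S.pos_injective h1])

/-- Tightness is invariant under subdivision. -/
lemma tightAt_ι [Fintype E] (hc : Γ.PotentialConnected) {q : V → ℕ} {q₀ : V₀ → ℕ}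
    (hq : ∀ p, q₀ (S.ι p) = q p) (hq₀ : ∀ v, q₀ v ≠ 0 → ∃ p, S.ι p = v) (o : V) :
    Γ.TightAt q₀ (S.ι o) ↔ G.TightAt q o := by
  constructor
  · rintro ⟨h1, h2⟩
    refine ⟨fun p hp => (S.bridgeEquiv_ι hc).1 (h1 _ (by rwa [hq])), fun c hfl hav => ?_⟩
    have h3 := h2 _ (S.isFlow_pull hfl) fun e₀ he₀ => by
      by_cases hb : IsBridge G.toGraph (S.π e₀)
      · rw [hfl.eq_zero_of_isBridge (S.potentialConnected hc) hb, mul_zero]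
      · rw [hav _ (S.touchesClass_π hc hb he₀), mul_zero]
    funext e
    obtain ⟨e₀, rfl⟩ := S.π_surjective e
    exact (mul_eq_zero.1 (congrFun h3 e₀)).resolve_left (S.σ_ne_zero e₀)
  · rintro ⟨h1, h2⟩
    refine ⟨fun v hv => ?_, fun c₀ hfl hav => ?_⟩
    · obtain ⟨p, rfl⟩ := hq₀ v hv
      exact (S.bridgeEquiv_ι hc).2 (h1 p (by rwa [← hq]))
    · obtain ⟨c, hc', hcc⟩ := S.exists_flow hfl
      have h3 := h2 c hc' fun e he => by
        obtain ⟨e₀, rfl, h⟩ := S.exists_touchesClass hc he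
        have := hav e₀ h
        rw [hcc] at this
        exact (mul_eq_zero.1 this).resolve_left (S.σ_ne_zero e₀)
      funext e₀
      rw [hcc, h3]
      simp

end Subdivision

/-! ### Minimal models -/

namespace PolarizedGraph

variable {V E V₀ E₀ : Type*} {G : PolarizedGraph V E} {Γ : PolarizedGraph V₀ E₀}

/-- A polarized graph is a subdivision of its minimal model. -/
lemma IsMinimalModel.exists_subdivision (h : G.IsMinimalModel Γ) :
    ∃ S : Subdivision G.toWeightedGraph Γ.toWeightedGraph,
      (∀ p, Γ.q (S.ι p) = G.q p) ∧ (∀ v, Γ.q v ≠ 0 → ∃ p, S.ι p = v) ∧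
      ∀ v, Γ.K v ≠ 0 ↔ ∃ p, S.ι p = v := by
  obtain ⟨Φ, hE, hq, hK⟩ := h
  choose π a ha0 ham hor using hE
  have hι : ∀ p, ∃ v, Φ (.vertex p) = .vertex v := by
    intro p
    have h1 := (hK (.vertex p)).1 ⟨p, rfl⟩
    rcases hΦ : Φ (.vertex p) with v | ⟨e, t⟩
    · exact ⟨v, rfl⟩
    · rw [hΦ] at h1
      exact absurd rfl h1
  choose ι hι using hι
  -- inner points of an edge of `Γ` are inner points of the corresponding segment
  have hin : ∀ e₀ t, a e₀ < t → t < a e₀ + Γ.m e₀ →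
      ∃ s, Φ (G.edgePoint (π e₀) t) = .inner e₀ s := by
    intro e₀ t h1 h2
    rcases hor e₀ with h | h
    · have h3 := h (t - a e₀) ⟨by linarith, by linarith⟩
      rw [add_sub_cancel, Γ.edgePoint_of_mem ⟨by linarith, by linarith⟩] at h3
      exact ⟨_, h3⟩
    · have h3 := h (t - a e₀) ⟨by linarith, by linarith⟩
      rw [add_sub_cancel, Γ.edgePoint_of_mem ⟨by linarith, by linarith⟩] at h3
      exact ⟨_, h3⟩
  have hout : ∀ e₀ (s : Set.Ioo 0 (Γ.m e₀)), ∃ t, a e₀ < t ∧ t < a e₀ + Γ.m e₀ ∧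
      Φ (G.edgePoint (π e₀) t) = .inner e₀ s := by
    intro e₀ s
    obtain ⟨s, h1, h2⟩ := s
    rcases hor e₀ with h | h
    · refine ⟨a e₀ + s, by linarith, by linarith, ?_⟩
      rw [h s ⟨h1.le, h2.le⟩, Γ.edgePoint_of_mem ⟨h1, h2⟩]
    · refine ⟨a e₀ + (Γ.m e₀ - s), by linarith, by linarith, ?_⟩
      rw [h (Γ.m e₀ - s) ⟨by linarith, by linarith⟩, sub_sub_cancel,
        Γ.edgePoint_of_mem ⟨h1, h2⟩]
  let S : Subdivision G.toWeightedGraph Γ.toWeightedGraph :=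
  { pos := fun v => Φ.symm (.vertex v)
    ι := ι
    π := π
    l := a
    r := fun e₀ => a e₀ + Γ.m e₀
    σ := fun e₀ => open Classical in if ∀ t ∈ Set.Icc 0 (Γ.m e₀),
      Φ (G.edgePoint (π e₀) (a e₀ + t)) = Γ.edgePoint e₀ t then 1 else -1
    pos_injective := fun v w h => by simpa using Φ.symm.injective h
    pos_ι := fun p => by rw [← hι, Φ.symm_apply_apply]
    l_nonneg := ha0
    l_lt_r := fun e₀ => lt_add_of_pos_right _ (Γ.m_pos e₀)
    r_le := ham
    ends := fun e₀ => by
      have hm := (Γ.m_pos e₀).le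
      split_ifs with h
      · refine Or.inl ⟨rfl, ?_, ?_⟩
        · have := h 0 ⟨le_rfl, hm⟩
          rw [Γ.edgePoint_zero, add_zero] at this
          rw [← this, Φ.symm_apply_apply]
        · have := h _ ⟨hm, le_rfl⟩
          rw [Γ.edgePoint_m] at this
          rw [← this, Φ.symm_apply_apply]
      · have h := (hor e₀).resolve_left h
        refine Or.inr ⟨rfl, ?_, ?_⟩
        · have := h 0 ⟨le_rfl, hm⟩
          rw [sub_zero, Γ.edgePoint_m, add_zero] at this
          rw [← this, Φ.symm_apply_apply]
        · have := h _ ⟨hm, le_rfl⟩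
          rw [sub_self, Γ.edgePoint_zero] at this
          rw [← this, Φ.symm_apply_apply]
    eq_of_overlap := fun e₀ e₁ hπ h1 h2 => by
      obtain ⟨t, ht1, ht2⟩ := exists_between (show max (a e₀) (a e₁)
        < min (a e₀ + Γ.m e₀) (a e₁ + Γ.m e₁) from max_lt
          (lt_min (lt_add_of_pos_right _ (Γ.m_pos e₀)) h1)
          (lt_min h2 (lt_add_of_pos_right _ (Γ.m_pos e₁))))
      obtain ⟨s, hs⟩ := hin e₀ t ((le_max_left _ _).trans_lt ht1) (ht2.trans_le (min_le_left _ _))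
      obtain ⟨s', hs'⟩ := hin e₁ t ((le_max_right _ _).trans_lt ht1)
        (ht2.trans_le (min_le_right _ _))
      rw [hπ, hs'] at hs
      cases hs
      rfl
    not_mem_Ioo := fun v e₀ t hv ht => by
      obtain ⟨s, hs⟩ := hin e₀ t ht.1 ht.2
      rw [← hv, Φ.apply_symm_apply] at hs
      cases hs
    cover := fun e t h0 h1 => by
      rcases hΦ : Φ (G.edgePoint e t) with v | ⟨e₀, s⟩
      · exact Or.inl ⟨v, by rw [← hΦ, Φ.symm_apply_apply]⟩
      · obtain ⟨t', h2, h3, h4⟩ := hout e₀ s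
        have h5 := Φ.injective (h4.trans hΦ.symm)
        obtain ⟨h6, h7⟩ := WeightedGraph.edgePoint_inj
          ⟨(ha0 e₀).trans_lt h2, h3.trans_le (ham e₀)⟩ h5
        exact Or.inr ⟨e₀, h6, h7 ▸ h2, h7 ▸ h3⟩ }
  have hvert : ∀ v, (∃ p, ι p = v) ↔ ∃ p, Φ.symm (.vertex v) = .vertex p := fun v =>
    exists_congr fun p => by
      rw [Equiv.symm_apply_eq, hι]
      exact ⟨fun h => by rw [h], fun h => by cases h; rfl⟩
  refine ⟨S, fun p => ?_, fun v hv => ?_, fun v => ?_⟩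
  · have := hq (.vertex p)
    rwa [hι] at this
  · refine (hvert v).2 ?_
    have := hq (Φ.symm (.vertex v))
    rw [Φ.apply_symm_apply] at this
    rcases hx : Φ.symm (.vertex v) with p | ⟨e, t⟩
    · exact ⟨p, rfl⟩
    · rw [hx] at this
      exact absurd this hv
  · have := hK (Φ.symm (.vertex v))
    rw [Φ.apply_symm_apply] at this
    exact this.symm.trans (hvert v).symm

variable [Fintype V] [Fintype E] [Fintype V₀] [Fintype E₀]

/-- The genus in terms of the minimal model. -/
lemma genus_eq_of_subdivision (S : Subdivision G.toWeightedGraph Γ.toWeightedGraph)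
    (hq : ∀ p, Γ.q (S.ι p) = G.q p) (hq₀ : ∀ v, Γ.q v ≠ 0 → ∃ p, S.ι p = v) :
    Γ.genus = G.genus := by
  classical
  have h1 : ∑ v, (Γ.q v : ℝ) = ∑ p, (G.q p : ℝ) := by
    rw [← Finset.sum_subset (Finset.subset_univ (Finset.univ.image S.ι)) fun v _ hv => ?_,
      Finset.sum_image fun p _ p' _ h => S.ι_injective h]
    · exact Finset.sum_congr rfl fun p _ => by rw [hq]
    · by_contra h
      obtain ⟨p, hp⟩ := hq₀ v fun h0 => h (by rw [h0, Nat.cast_zero])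
      exact hv (Finset.mem_image.2 ⟨p, Finset.mem_univ _, hp⟩)
  have h2 : (Γ.genus : ℝ) = G.genus := by
    rw [genus_eq, genus_eq, h1, S.card_sub_card]
  exact_mod_cast h2

omit [Fintype V] in
/-- The slope vanishes if and only if all vertices of the minimal model are tight. -/
lemma slope_eq_zero_iff_of_subdivision (hconn : Connected Γ.toGraph) (hg : 2 ≤ Γ.genus)
    (S : Subdivision G.toWeightedGraph Γ.toWeightedGraph)
    (hq : ∀ p, Γ.q (S.ι p) = G.q p) (hq₀ : ∀ v, Γ.q v ≠ 0 → ∃ p, S.ι p = v)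
    (hK : ∀ v, Γ.K v ≠ 0 ↔ ∃ p, S.ι p = v) :
    Γ.slope = 0 ↔ ∀ o, G.TightAt G.q o := by
  rw [Γ.slope_eq_zero_iff_tightAt hconn hg]
  have hc := Γ.potentialConnected hconn
  constructor
  · exact fun h o => (S.tightAt_ι hc hq hq₀ o).1 (h _ ((hK _).2 ⟨o, rfl⟩))
  · intro h v hv
    obtain ⟨o, rfl⟩ := (hK v).1 hv
    exact (S.tightAt_ι hc hq hq₀ o).2 (h o)

end PolarizedGraph

namespace WeightedGraph

variable {V E : Type*} {G : WeightedGraph V E}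

lemma toGraph_eq_banana_iff {u v : V} : G.toGraph = Graph.banana u v Set.univ ↔
    (∀ x, x = u ∨ x = v) ∧
      ∀ e, (G.src e = u ∧ G.tgt e = v) ∨ (G.src e = v ∧ G.tgt e = u) := by
  constructor
  · intro h
    refine ⟨fun x => ?_, fun e => ?_⟩
    · have : x ∈ V(Graph.banana u v (Set.univ : Set E)) := h ▸ Set.mem_univ x
      simpa using this
    · have := G.isLink_src_tgt e
      rw [h] at this
      exact this.2
  · rintro ⟨h1, h2⟩
    refine Graph.ext (Set.eq_univ_of_forall fun x => ?_).symm fun e x y => ?_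
    · exact h1 x
    · rw [toGraph_isLink]
      simp only [Graph.banana_isLink, Set.mem_univ, true_and]
      rcases h2 e with ⟨h3, h4⟩ | ⟨h3, h4⟩ <;> rw [h3, h4]
      exact or_comm

lemma tightAt_of_banana [Fintype V] [Fintype E] {q : V → ℕ} (hq : ∀ p, q p = 0) {u v : V}
    (h : G.toGraph = Graph.banana u v Set.univ) (o : V) : G.TightAt q o := by
  obtain ⟨h1, h2⟩ := toGraph_eq_banana_iff.1 h
  refine ⟨fun p hp => absurd (hq p) hp, fun c _ hav => funext fun e => hav e ?_⟩
  have hrefl : ∀ x, x = o → G.BridgeEquiv x o := fun x hx φ _ => by rw [hx]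
  rcases h1 o with ho | ho <;> rcases h2 e with ⟨h3, h4⟩ | ⟨h3, h4⟩
  · exact Or.inl (hrefl _ (h3.trans ho.symm))
  · exact Or.inr (hrefl _ (h4.trans ho.symm))
  · exact Or.inr (hrefl _ (h4.trans ho.symm))
  · exact Or.inl (hrefl _ (h3.trans ho.symm))

end WeightedGraph

end MetricGraph

end

theorem theorem3p2 {V₀ E₀ V E : Type*} [Fintype V₀] [Fintype E₀] [Fintype V] [Fintype E]
    (Γ : MetricGraph.PolarizedGraph V₀ E₀) (hconn : MetricGraph.Connected Γ.toGraph)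
    (hg : 2 ≤ Γ.genus)
    (G : MetricGraph.PolarizedGraph V E) (hG : G.IsMinimalModel Γ) :
    Γ.slope = 0 ↔
      (((∀ p, G.q p = 0) ∧
          ∃ u v : V, u ≠ v ∧ G.toGraph = Graph.banana u v Set.univ ∧
            (Fintype.card E : ℤ) = Γ.genus + 1) ∨
        (MetricGraph.BlocksAreLoopsAndBridges G.toGraph ∧
          ({e : E | ∃ p, G.toGraph.IsLoopAt e p}.ncard : ℤ) ≤ Γ.genus)) := by
  classical
  obtain ⟨S, hq, hq₀, hK⟩ := hG.exists_subdivision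
  rw [MetricGraph.PolarizedGraph.slope_eq_zero_iff_of_subdivision hconn hg S hq hq₀ hK]
  have hc := S.potentialConnected (Γ.potentialConnected hconn)
  have hgen : (Γ.genus : ℝ) = Fintype.card E - Fintype.card V + 1 + ∑ p, (G.q p : ℝ) := by
    rw [MetricGraph.PolarizedGraph.genus_eq_of_subdivision S hq hq₀, G.genus_eq]
  simp only [G.exists_isLoopAt_iff, G.blocksAreLoopsAndBridges_iff]
  constructor
  · intro ht
    by_cases hlb : ∀ e, G.src e = G.tgt e ∨ MetricGraph.IsBridge G.toGraph e
    · refine Or.inr ⟨hlb, ?_⟩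
      -- without vertices the formula for the genus would give one
      have : Nonempty V := by
        by_contra hV
        rw [not_nonempty_iff] at hV
        have : IsEmpty E := ⟨fun e => hV.false (G.src e)⟩
        rw [Fintype.card_eq_zero, Fintype.card_eq_zero, Finset.univ_eq_empty,
          Finset.sum_empty] at hgen
        norm_num at hgen
        omega
      have h1 := MetricGraph.WeightedGraph.card_loops_le hc
      have h2 : (0 : ℝ) ≤ ∑ p, (G.q p : ℝ) := Finset.sum_nonneg fun p _ => Nat.cast_nonneg _
      have h3 : (({e | G.src e = G.tgt e}.ncard : ℤ) : ℝ) ≤ Γ.genus := by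
        rw [hgen, Int.cast_natCast]
        linarith
      exact_mod_cast h3
    · push Not at hlb
      obtain ⟨e₀, hloop, hbr⟩ := hlb
      have hg' : (2 : ℝ) ≤ Γ.genus := by exact_mod_cast hg
      obtain ⟨h1, h2, h3⟩ := MetricGraph.WeightedGraph.banana_of_tightAt hc G.polarization
        (hgen ▸ hg') ht hloop hbr
      refine Or.inl ⟨h1, _, _, hloop, ?_, ?_⟩
      · refine MetricGraph.WeightedGraph.toGraph_eq_banana_iff.2 ⟨h3, fun e => ?_⟩
        have := h2 e
        rcases h3 (G.src e) with h | h <;> rcases h3 (G.tgt e) with h' | h'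
        · exact absurd (h.trans h'.symm) this
        · exact Or.inl ⟨h, h'⟩
        · exact Or.inr ⟨h, h'⟩
        · exact absurd (h.trans h'.symm) this
      · have hV : Fintype.card V = 2 :=
          Finset.card_eq_two.2 ⟨_, _, hloop, by ext x; simpa using h3 x⟩
        have h4 : ((Fintype.card E : ℤ) : ℝ) = ((Γ.genus + 1 : ℤ) : ℝ) := by
          push_cast
          rw [hgen, hV]
          simp only [h1, Nat.cast_zero, Finset.sum_const_zero]
          ring
        exact_mod_cast h4
  · rintro (⟨h1, u, v, _, h2, _⟩ | ⟨h, _⟩) o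
    · exact MetricGraph.WeightedGraph.tightAt_of_banana h1 h2 o
    · exact MetricGraph.WeightedGraph.tightAt_of_loops_and_bridges hc h G.q o
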